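/- Let $k$ be a commutative ring of characteristic $0$; all modules, linear maps and tensor products are over $k$. **Hom-associative algebras.** Let $(A,\mu,\alpha)$ be a regular unital (multiplicative) hom-associative algebra: $A$ is a $k$-module, $\mu(a,b)=a\cdot b$ is bilinear, $\alpha:A\to A$ is linear and bijective, $(a\cdot b)\cdot\alpha(c)=\alpha(a)\cdot(b\cdot c)$, $\alpha(a\cdot b)=\alpha(a)\cdot\alpha(b)$, and there is $1\in A$ with $\alpha(1)=1$ and $a\cdot 1=1\cdot a=\alpha(a)$ for all $a$. **Cohomology.** For $n\ge 0$ let $C^n_\alpha(A)$ be the module of multilinear maps $f:A^{n}\to A$ with $\alpha\circ f=f\circ\alpha^{\otimes n}$ (so $C^0_\alpha(A)=\{a\in A:\alpha(a)=a\}$), with $$(\delta_\alpha f)(a_1,\dots,a_{n+1})=\alpha^{n-1}(a_1)\cdot f(a_2,\dots,a_{n+1})+(-1)^{n+1}f(a_1,\dots,a_n)\cdot\alpha^{n-1}(a_{n+1})+\sum_{i=1}^n(-1)^i f(\alpha(a_1),\dots,a_i\cdot a_{i+1},\dots,\alpha(a_{n+1})),$$ and let $H^n_\alpha(A)$ be its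 cohomology. For $f$ of arity $p$, $g$ of arity $q$ and $1\le i\le p$ put $$(f\circ_i g)(a_1,\dots,a_{p+q-1})=f(\alpha^{q-1}(a_1),\dots,\alpha^{q-1}(a_{i-1}),g(a_i,\dots,a_{i+q-1}),\alpha^{q-1}(a_{i+q}),\dots,\alpha^{q-1}(a_{p+q-1})),$$ $f\cup g=(\mu\circ_2 f)\circ_1 g$, and $$[f,g]=\sum_{i=1}^p(-1)^{(q-1)(i-1)}f\circ_i g-(-1)^{(p-1)(q-1)}\sum_{i=1}^q(-1)^{(p-1)(i-1)}g\circ_i f .$$ **Homology.** For $n\ge0$ let $C_n^\alpha(A)=A\otimes A^{\otimes n}$, and for $f$ of arity $p$ put $$f\bullet_i(a_0\otimes\cdots\otimes a_n)=\alpha^{p-1}(a_0)\otimes\cdots\otimes\alpha^{p-1}(a_{i-1})\otimes f(a_i,\dots,a_{i+p-1})\otimes\alpha^{p-1}(a_{i+p})\otimes\cdots\otimes\alpha^{p-1}(a_n),\qquad 0\le i\le n-p+1,$$ and $t(a_0\otimes\cdots\otimes a_n)=a_n\otimes a_0\otimes\cdots\otimes a_{n-1}$. Let $H_n^\alpha(A)$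 be the homology of the boundary $d^\alpha x=\sum_{i=0}^{n-1}(-1)^i\mu\bullet_i x+(-1)^n\mu\bullet_0 t(x)$ on $C_n^\alpha(A)$, $n\ge 1$. Define, for $f$ of arity $p$ and $x\in C_n^\alpha(A)$, $$i_f x=(\mu\circ_2 f)\bullet_0 x\in C^\alpha_{n-p}(A)\quad(p\le n),$$ $$\mathcal L_f x=\sum_{i=1}^{n-p+1}(-1)^{(p-1)(i-1)}f\bullet_i x+\sum_{i=1}^{p}(-1)^{n(i-1)+p-1}f\bullet_0 t^{i-1}(x)\in C^\alpha_{n-p+1}(A)\quad(p\le n+1),$$ $$Bx=\sum_{i=0}^n(-1)^{in}(\mathrm{id}-t)\,t\,(1\bullet_{n+1}t^i(x))\in C^\alpha_{n+1}(A),$$ where $1$ is regarded as an element of $C^0_\alpha(A)$. Extend $H^\bullet_\alpha(A)$ and $H_\bullet^\alpha(A)$ by $0$ to negative degrees. **Theorem.** The maps $\delta_\alpha$ and $d^\alpha$ are differentials ($\delta_\alpha$ preserves the cochain modules $C^\bullet_\alpha(A)$ and $\delta_\alpha^2=0$ on them; $(d^\alpha)^2=0$). The operations $\cup$, $[\,,]$,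 $i$, $\mathcal L$ and $B$ send (co)cycles to (co)cycles and descend to well-defined $k$-(bi)linear operations on $H^\bullet_\alpha(A)$ and $H_\bullet^\alpha(A)$. With these operations (zero whenever a degree is negative), the pair $(H^\bullet_\alpha(A),H_\bullet^\alpha(A))$ is a noncommutative differential calculus, that is, for $f,g,h\in H_\alpha^\bullet(A)$ of degrees $p,q,r$ and on all of $H_\bullet^\alpha(A)$: 1. (Gerstenhaber algebra) $f\cup g=(-1)^{pq}g\cup f$, $(f\cup g)\cup h=f\cup(g\cup h)$, $[f,g]=-(-1)^{(p-1)(q-1)}[g,f]$, $[f,[g,h]]=[[f,g],h]+(-1)^{(p-1)(q-1)}[g,[f,h]]$, and $[f,g\cup h]=[f,g]\cup h+(-1)^{(p-1)q}g\cup[f,h]$; 2. (precalculus) $i_{f\cup g}=i_f\circ i_g$, $\mathcal L_{[f,g]}=\mathcal L_f\circ\mathcal L_g-(-1)^{(p-1)(q-1)}\mathcal L_g\circ\mathcal L_f$, and $i_{[f,g]}=i_f\circ\mathcal L_g-(-1)^{p(q+1)}\mathcal L_g\circ i_f$; 3. (calculus) $B^2=0$ and the Cartan–Rinehart homotopy formula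 $\mathcal L_f=B\circ i_f-(-1)^p\,i_f\circ B$. -/

import Mathlib

open scoped TensorProduct

universe u v w

/-! ### Gerstenhaber algebras, precalculi and noncommutative differential calculi -/

/-- A Gerstenhaber algebra structure on a `ℤ`-graded `k`-module `𝒜`: a graded commutative
associative product of degree `0` and a graded Lie bracket of degree `-1`, related by the
Leibniz rule. The target degree of each operation is a separate index `r`, together with a proof
that it is the right one; `n.negOnePow` is the sign `(-1)^n`. -/
structure GerstenhaberAlgebra (k : Type u) [CommRing k] (𝒜 : ℤ → Type v)
    [∀ p, AddCommGroup (𝒜 p)] [∀ p, Module k (𝒜 p)] where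
  cup : ∀ {p q r : ℤ}, p + q = r → (𝒜 p →ₗ[k] 𝒜 q →ₗ[k] 𝒜 r)
  bracket : ∀ {p q r : ℤ}, p + q - 1 = r → (𝒜 p →ₗ[k] 𝒜 q →ₗ[k] 𝒜 r)
  cup_comm : ∀ {p q r : ℤ} (h : p + q = r) (h' : q + p = r) (f : 𝒜 p) (g : 𝒜 q),
    cup h f g = (p * q).negOnePow • cup h' g f
  cup_assoc : ∀ {p q r pq qr s : ℤ} (h₁ : p + q = pq) (h₂ : pq + r = s) (h₃ : q + r = qr)
    (h₄ : p + qr = s) (f : 𝒜 p) (g : 𝒜 q) (h : 𝒜 r),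
    cup h₂ (cup h₁ f g) h = cup h₄ f (cup h₃ g h)
  bracket_skew : ∀ {p q r : ℤ} (h : p + q - 1 = r) (h' : q + p - 1 = r) (f : 𝒜 p) (g : 𝒜 q),
    bracket h f g = -(((p - 1) * (q - 1)).negOnePow • bracket h' g f)
  /-- graded Jacobi: `[f, [g, h]] = [[f, g], h] + (-1)^{(p-1)(q-1)} [g, [f, h]]` -/
  jacobi : ∀ {p q r pq qr pr s : ℤ} (h₁ : q + r - 1 = qr) (h₂ : p + qr - 1 = s)
    (h₃ : p + q - 1 = pq) (h₄ : pq + r - 1 = s) (h₅ : p + r - 1 = pr) (h₆ : q + pr - 1 = s)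
    (f : 𝒜 p) (g : 𝒜 q) (h : 𝒜 r),
    bracket h₂ f (bracket h₁ g h) = bracket h₄ (bracket h₃ f g) h
      + ((p - 1) * (q - 1)).negOnePow • bracket h₆ g (bracket h₅ f h)
  /-- `[f, g ∪ h] = [f, g] ∪ h + (-1)^{(p-1)q} g ∪ [f, h]` -/
  leibniz : ∀ {p q r pq qr pr s : ℤ} (h₁ : q + r = qr) (h₂ : p + qr - 1 = s)
    (h₃ : p + q - 1 = pq) (h₄ : pq + r = s) (h₅ : p + r - 1 = pr) (h₆ : q + pr = s)
    (f : 𝒜 p) (g : 𝒜 q) (h : 𝒜 r),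
    bracket h₂ f (cup h₁ g h) = cup h₄ (bracket h₃ f g) h
      + ((p - 1) * q).negOnePow • cup h₆ g (bracket h₅ f h)

/-- A precalculus `(𝒜, Ω)`: a Gerstenhaber algebra `𝒜`, a graded module `Ω`, an action `i` of the
algebra `(𝒜, ∪)` on `Ω` and an action `L` of the graded Lie algebra `(𝒜^{•+1}, [ , ])` on `Ω`,
related by `i_{[f,g]} = i_f ∘ L_g - (-1)^{p(q+1)} L_g ∘ i_f`. -/
structure Precalculus (k : Type u) [CommRing k] (𝒜 : ℤ → Type v) (Ω : ℤ → Type w)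
    [∀ p, AddCommGroup (𝒜 p)] [∀ p, Module k (𝒜 p)]
    [∀ n, AddCommGroup (Ω n)] [∀ n, Module k (Ω n)] extends GerstenhaberAlgebra k 𝒜 where
  i : ∀ {p n m : ℤ}, n - p = m → (𝒜 p →ₗ[k] Ω n →ₗ[k] Ω m)
  L : ∀ {p n m : ℤ}, n - p + 1 = m → (𝒜 p →ₗ[k] Ω n →ₗ[k] Ω m)
  i_cup : ∀ {p q pq n m l : ℤ} (h₁ : p + q = pq) (h₂ : n - pq = l) (h₃ : n - q = m)
    (h₄ : m - p = l) (f : 𝒜 p) (g : 𝒜 q) (x : Ω n),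
    i h₂ (cup h₁ f g) x = i h₄ f (i h₃ g x)
  L_bracket : ∀ {p q pq n m m' l : ℤ} (h₁ : p + q - 1 = pq) (h₂ : n - pq + 1 = l)
    (h₃ : n - q + 1 = m) (h₄ : m - p + 1 = l) (h₅ : n - p + 1 = m') (h₆ : m' - q + 1 = l)
    (f : 𝒜 p) (g : 𝒜 q) (x : Ω n),
    L h₂ (bracket h₁ f g) x = L h₄ f (L h₃ g x)
      - ((p - 1) * (q - 1)).negOnePow • L h₆ g (L h₅ f x)
  i_bracket : ∀ {p q pq n m m' l : ℤ} (h₁ : p + q - 1 = pq) (h₂ : n - pq = l)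
    (h₃ : n - q + 1 = m) (h₄ : m - p = l) (h₅ : n - p = m') (h₆ : m' - q + 1 = l)
    (f : 𝒜 p) (g : 𝒜 q) (x : Ω n),
    i h₂ (bracket h₁ f g) x = i h₄ f (L h₃ g x)
      - (p * (q + 1)).negOnePow • L h₆ g (i h₅ f x)

/-- A noncommutative differential calculus: a precalculus with a degree `+1` differential `B` on
`Ω` satisfying the Cartan-Rinehart homotopy formula `L_f = B ∘ i_f - (-1)^p i_f ∘ B`. -/
structure NCDifferentialCalculus (k : Type u) [CommRing k] (𝒜 : ℤ → Type v) (Ω : ℤ → Type w)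
    [∀ p, AddCommGroup (𝒜 p)] [∀ p, Module k (𝒜 p)]
    [∀ n, AddCommGroup (Ω n)] [∀ n, Module k (Ω n)] extends Precalculus k 𝒜 Ω where
  B : ∀ {n m : ℤ}, n + 1 = m → (Ω n →ₗ[k] Ω m)
  B_B : ∀ {n m l : ℤ} (h₁ : n + 1 = m) (h₂ : m + 1 = l) (x : Ω n), B h₂ (B h₁ x) = 0
  cartan : ∀ {p n m l r : ℤ} (h₁ : n - p + 1 = r) (h₂ : n - p = m) (h₃ : m + 1 = r)
    (h₄ : n + 1 = l) (h₅ : l - p = r) (f : 𝒜 p) (x : Ω n),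
    L h₁ f x = B h₃ (i h₂ f x) - p.negOnePow • i h₅ f (B h₄ x)

/-! ### Non-negatively graded modules as `ℤ`-graded modules -/

/-- The extension of an `ℕ`-graded module to a `ℤ`-graded module, zero in negative degrees. -/
def IntExt (V : ℕ → Type v) : ℤ → Type v
  | Int.ofNat n => V n
  | Int.negSucc _ => PUnit

instance IntExt.addCommGroup (V : ℕ → Type v) [∀ n, AddCommGroup (V n)] :
    ∀ n, AddCommGroup (IntExt V n)
  | Int.ofNat n => (inferInstance : AddCommGroup (V n))
  | Int.negSucc _ => (inferInstance : AddCommGroup PUnit.{v + 1})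

instance IntExt.module (k : Type u) [CommRing k] (V : ℕ → Type v) [∀ n, AddCommGroup (V n)]
    [∀ n, Module k (V n)] : ∀ n, Module k (IntExt V n)
  | Int.ofNat n => (inferInstance : Module k (V n))
  | Int.negSucc _ => (inferInstance : Module k PUnit.{v + 1})

/-- The identification of `V n` with the degree `n` part of `IntExt V`, for `n : ℕ`. -/
def IntExt.of (k : Type u) [CommRing k] (V : ℕ → Type v) [∀ n, AddCommGroup (V n)]
    [∀ n, Module k (V n)] (n : ℕ) : V n ≃ₗ[k] IntExt V (n : ℤ) :=
  LinearEquiv.refl k (V n)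

/-! ### Hom-associative algebras -/

/-- A (multiplicative) hom-associative algebra. -/
structure HomAssocAlgebra (k : Type u) (A : Type v) [CommRing k] [AddCommGroup A]
    [Module k A] where
  mul : A →ₗ[k] A →ₗ[k] A
  α : A →ₗ[k] A
  hom_assoc : ∀ a b c, mul (mul a b) (α c) = mul (α a) (mul b c)
  α_mul : ∀ a b, α (mul a b) = mul (α a) (α b)

/-- A regular unital hom-associative algebra. -/
structure RegularUnitalHomAssocAlgebra (k : Type u) (A : Type v) [CommRing k] [AddCommGroup A]
    [Module k A] extends HomAssocAlgebra k A where
  regular : Function.Bijective α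
  one : A
  α_one : α one = one
  mul_one : ∀ a, mul a one = α a
  one_mul : ∀ a, mul one a = α a

/-! ### Substituting a multilinear map into a tuple -/

section Substitution

variable {k : Type u} {A : Type v} {E : Type w} [CommRing k] [AddCommGroup A] [Module k A]
  [AddCommGroup E] [Module k E]

/-- The tuple `(φ a₀, …, φ a_{i-1}, f (a_i, …, a_{i+p-1}), φ a_{i+p}, …, φ a_{N-1})` of length
`M = N - p + 1`. -/
def substTuple {N M p : ℕ} (h : N + 1 = M + p) (i : Fin M) (φ : A →ₗ[k] A)
    (f : MultilinearMap k (fun _ : Fin p => A) A) (a : Fin N → A) : Fin M → A := fun j =>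
  if _ : (j : ℕ) < i then φ (a ⟨j, by omega⟩)
  else if _ : j = i then f (fun l => a ⟨i + l, by omega⟩)
  else φ (a ⟨j + p - 1, by omega⟩)

theorem substTuple_update {N M p : ℕ} (h : N + 1 = M + p) (i : Fin M) (φ : A →ₗ[k] A)
    (f : MultilinearMap k (fun _ : Fin p => A) A) (a : Fin N → A) (l : Fin N) :
    ∃ (j : Fin M) (T : A →ₗ[k] A), ∀ x,
      substTuple h i φ f (Function.update a l x) =
        Function.update (substTuple h i φ f a) j (T x) := by
  by_cases h1 : (l : ℕ) < i
  · refine ⟨⟨l, by omega⟩, φ, fun x => ?_⟩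
    funext j
    by_cases hj : j = ⟨l, by omega⟩
    · subst hj
      simp [substTuple, h1]
    · have hj' : (j : ℕ) ≠ l := fun e => hj (Fin.ext e)
      rw [Function.update_of_ne hj]
      simp only [substTuple]
      split_ifs with c1 c2
      · rw [Function.update_of_ne]; simpa [Fin.ext_iff] using hj'
      · congr 1; funext l'
        rw [Function.update_of_ne]; simp [Fin.ext_iff]; omega
      · rw [Function.update_of_ne]
        have : (j : ℕ) ≠ i := fun e => c2 (Fin.ext e)
        simp [Fin.ext_iff]; omega
  · by_cases h2 : (l : ℕ) < i + p
    · refine ⟨i, f.toLinearMap (fun l' => a ⟨i + l', by omega⟩) ⟨l - i, by omega⟩, fun x => ?_⟩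
      funext j
      by_cases hj : j = i
      · subst hj
        simp only [substTuple, lt_irrefl, dite_false, dite_true, Function.update_self,
          MultilinearMap.toLinearMap_apply]
        congr 1; funext l'
        by_cases e : (j : ℕ) + l' = l
        · have e1 : l' = ⟨l - j, by omega⟩ := Fin.ext (by simp; omega)
          have e2 : (⟨j + l', by omega⟩ : Fin N) = l := Fin.ext e
          rw [e2, Function.update_self, e1, Function.update_self]
        · rw [Function.update_of_ne (by simp [Fin.ext_iff]; omega),
            Function.update_of_ne (by simp [Fin.ext_iff]; omega)]
      · have : (j : ℕ) ≠ i := fun e => hj (Fin.ext e)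
        rw [Function.update_of_ne hj]
        simp only [substTuple, hj, dite_false]
        split_ifs with c1
        · rw [Function.update_of_ne]; simp [Fin.ext_iff]; omega
        · rw [Function.update_of_ne]; simp [Fin.ext_iff]; omega
    · refine ⟨⟨l + 1 - p, by omega⟩, φ, fun x => ?_⟩
      funext j
      by_cases hj : j = ⟨l + 1 - p, by omega⟩
      · have hv : (j : ℕ) = l + 1 - p := by rw [hj]
        have c1 : ¬ (j : ℕ) < i := by omega
        have c2 : ¬ j = i := fun e => by rw [e] at hv; omega
        rw [← hj]
        simp only [substTuple, c1, c2, dite_false, Function.update_self]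
        have e2 : (⟨j + p - 1, by omega⟩ : Fin N) = l := Fin.ext (by simp; omega)
        rw [e2, Function.update_self]
      · have hv : (j : ℕ) ≠ l + 1 - p := fun e => hj (Fin.ext e)
        rw [Function.update_of_ne hj]
        simp only [substTuple]
        split_ifs with c1 c2
        · rw [Function.update_of_ne]; simp [Fin.ext_iff]; omega
        · congr 1; funext l'
          rw [Function.update_of_ne]; simp [Fin.ext_iff]; omega
        · have : (j : ℕ) ≠ i := fun e => c2 (Fin.ext e)
          rw [Function.update_of_ne]; simp [Fin.ext_iff]; omega

/-- The multilinear map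
`(a₀, …, a_{N-1}) ↦ F (φ a₀, …, φ a_{i-1}, f (a_i, …, a_{i+p-1}), φ a_{i+p}, …, φ a_{N-1})`. -/
def substMap {N M p : ℕ} (h : N + 1 = M + p) (i : Fin M) (φ : A →ₗ[k] A)
    (F : MultilinearMap k (fun _ : Fin M => A) E)
    (f : MultilinearMap k (fun _ : Fin p => A) A) : MultilinearMap k (fun _ : Fin N => A) E where
  toFun a := F (substTuple h i φ f a)
  map_update_add' := by
    intro inst a l x y
    rw [Subsingleton.elim inst (instDecidableEqFin N)]
    obtain ⟨j, T, hT⟩ := substTuple_update h i φ f a l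
    rw [hT, hT, hT, map_add, MultilinearMap.map_update_add]
  map_update_smul' := by
    intro inst a l c x
    rw [Subsingleton.elim inst (instDecidableEqFin N)]
    obtain ⟨j, T, hT⟩ := substTuple_update h i φ f a l
    rw [hT, hT, map_smul, MultilinearMap.map_update_smul]

theorem substTuple_eq_update {N M p : ℕ} (h : N + 1 = M + p) (i : Fin M) (φ : A →ₗ[k] A)
    (f : MultilinearMap k (fun _ : Fin p => A) A) (a : Fin N → A) :
    substTuple h i φ f a =
      Function.update (substTuple h i φ 0 a) i (f (fun l => a ⟨i + l, by omega⟩)) := by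
  funext j
  by_cases hj : j = i
  · subst hj; simp [substTuple]
  · simp [substTuple, hj]

theorem substMap_add_left {N M p : ℕ} (h : N + 1 = M + p) (i : Fin M) (φ : A →ₗ[k] A)
    (F G : MultilinearMap k (fun _ : Fin M => A) E)
    (f : MultilinearMap k (fun _ : Fin p => A) A) :
    substMap h i φ (F + G) f = substMap h i φ F f + substMap h i φ G f := rfl

theorem substMap_smul_left {N M p : ℕ} (h : N + 1 = M + p) (i : Fin M) (φ : A →ₗ[k] A) (c : k)
    (F : MultilinearMap k (fun _ : Fin M => A) E)
    (f : MultilinearMap k (fun _ : Fin p => A) A) :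
    substMap h i φ (c • F) f = c • substMap h i φ F f := rfl

theorem substMap_add_right {N M p : ℕ} (h : N + 1 = M + p) (i : Fin M) (φ : A →ₗ[k] A)
    (F : MultilinearMap k (fun _ : Fin M => A) E)
    (f g : MultilinearMap k (fun _ : Fin p => A) A) :
    substMap h i φ F (f + g) = substMap h i φ F f + substMap h i φ F g := by
  ext a
  change F (substTuple h i φ (f + g) a) = F (substTuple h i φ f a) + F (substTuple h i φ g a)
  rw [substTuple_eq_update h i φ (f + g), substTuple_eq_update h i φ f,
    substTuple_eq_update h i φ g, add_apply, MultilinearMap.map_update_add]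

theorem substMap_smul_right {N M p : ℕ} (h : N + 1 = M + p) (i : Fin M) (φ : A →ₗ[k] A) (c : k)
    (F : MultilinearMap k (fun _ : Fin M => A) E)
    (f : MultilinearMap k (fun _ : Fin p => A) A) :
    substMap h i φ F (c • f) = c • substMap h i φ F f := by
  ext a
  change F (substTuple h i φ (c • f) a) = c • F (substTuple h i φ f a)
  rw [substTuple_eq_update h i φ (c • f), substTuple_eq_update h i φ f,
    smul_apply, MultilinearMap.map_update_smul]

end Substitution

/-! ### Hochschild cochains and chains of a regular unital hom-associative algebra -/

namespace RegularUnitalHomAssocAlgebra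

variable {k : Type u} {A : Type v} [CommRing k] [AddCommGroup A] [Module k A]
  (H : RegularUnitalHomAssocAlgebra k A)

/-- The structure map `α` as an automorphism of the module `A`. -/
noncomputable def αEquiv : A ≃ₗ[k] A := LinearEquiv.ofBijective H.α H.regular

/-- `twist p = α^{p-1}`, which is `α⁻¹` for `p = 0`. -/
noncomputable def twist (p : ℕ) : A →ₗ[k] A := (H.αEquiv ^ ((p : ℤ) - 1) : A ≃ₗ[k] A).toLinearMap

/-- The multiplication as a `2`-cochain. -/
def mulCochain : MultilinearMap k (fun _ : Fin 2 => A) A where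
  toFun a := H.mul (a 0) (a 1)
  map_update_add' := by
    intro inst a l x y
    rw [Subsingleton.elim inst (instDecidableEqFin 2)]
    fin_cases l <;> simp
  map_update_smul' := by
    intro inst a l c x
    rw [Subsingleton.elim inst (instDecidableEqFin 2)]
    fin_cases l <;> simp

/-- The unit as a `0`-cochain. -/
def oneCochain : MultilinearMap k (fun _ : Fin 0 => A) A :=
  MultilinearMap.constOfIsEmpty k _ H.one

/-- The partial composition of `f` of arity `p` with `g` of arity `q`,
`(a₁, …, a_{p+q-1}) ↦
  f (α^{q-1} a₁, …, α^{q-1} a_{j-1}, g (a_j, …, a_{j+q-1}), …, α^{q-1} a_{p+q-1})`,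
where `j = i + 1`: positions are counted from `0` here. -/
noncomputable def circ {p q r : ℕ} (h : r + 1 = p + q) (i : Fin p)
    (f : MultilinearMap k (fun _ : Fin p => A) A) (g : MultilinearMap k (fun _ : Fin q => A) A) :
    MultilinearMap k (fun _ : Fin r => A) A :=
  substMap h i (H.twist q) f g

/-- The Hochschild coboundary
`(δ f)(a₁, …, a_{n+1}) = α^{n-1}(a₁) · f (a₂, …, a_{n+1})
  + (-1)^{n+1} f (a₁, …, a_n) · α^{n-1}(a_{n+1})
  + ∑_{j=1}^n (-1)^j f (α a₁, …, α a_{j-1}, a_j · a_{j+1}, α a_{j+2}, …, α a_{n+1})`. -/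
noncomputable def coboundary (n : ℕ) :
    MultilinearMap k (fun _ : Fin n => A) A →ₗ[k] MultilinearMap k (fun _ : Fin (n + 1) => A) A where
  toFun f := H.circ (by omega) 1 H.mulCochain f
    + (-1 : k) ^ (n + 1) • H.circ (by omega) 0 H.mulCochain f
    + ∑ i : Fin n, (-1 : k) ^ ((i : ℕ) + 1) • H.circ (by omega) i f H.mulCochain
  map_add' f g := by
    simp only [circ, substMap_add_left, substMap_add_right, smul_add, Finset.sum_add_distrib]
    abel
  map_smul' c f := by
    simp only [circ, substMap_smul_left, substMap_smul_right, smul_add, Finset.smul_sum,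
      RingHom.id_apply, smul_comm c]

/-- The module `C^n_α(A)` of `n`-cochains: multilinear maps commuting with `α`. For `n = 0` these
are the elements fixed by `α`. -/
def cochains (n : ℕ) : Submodule k (MultilinearMap k (fun _ : Fin n => A) A) where
  carrier := {f | ∀ a, H.α (f a) = f (fun j => H.α (a j))}
  add_mem' hf hg a := by simp [hf a, hg a]
  zero_mem' a := by simp
  smul_mem' c f hf a := by simp [hf a]

/-- Hochschild cocycles. -/
noncomputable def cocycles (n : ℕ) : Submodule k (MultilinearMap k (fun _ : Fin n => A) A) :=
  H.cochains n ⊓ LinearMap.ker (H.coboundary n)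

/-- Hochschild coboundaries. -/
noncomputable def coboundaries : ∀ n : ℕ, Submodule k (MultilinearMap k (fun _ : Fin n => A) A)
  | 0 => ⊥
  | n + 1 => (H.cochains n).map (H.coboundary n)

/-- The Hochschild cohomology `H^n_α(A)`. -/
abbrev Cohomology (n : ℕ) : Type v :=
  H.cocycles n ⧸ (H.coboundaries n).submoduleOf (H.cocycles n)

/-- The cohomology class of a cocycle. -/
noncomputable def cohomologyClass (n : ℕ) : H.cocycles n →ₗ[k] H.Cohomology n :=
  ((H.coboundaries n).submoduleOf (H.cocycles n)).mkQ

/-- The cup product `f ∪ g = (μ ∘₂ f) ∘₁ g`. -/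
noncomputable def cup {p q r : ℕ} (h : p + q = r) (f : MultilinearMap k (fun _ : Fin p => A) A)
    (g : MultilinearMap k (fun _ : Fin q => A) A) : MultilinearMap k (fun _ : Fin r => A) A :=
  H.circ (p := p + 1) (by omega) 0 (H.circ (r := p + 1) (by omega) 1 H.mulCochain f) g

/-- The Gerstenhaber bracket
`[f, g] = ∑_{j=1}^p (-1)^{(q-1)(j-1)} f ∘_j g
  - (-1)^{(p-1)(q-1)} ∑_{j=1}^q (-1)^{(p-1)(j-1)} g ∘_j f`, with `j = i + 1`. -/
noncomputable def bracket {p q r : ℕ} (h : r + 1 = p + q)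
    (f : MultilinearMap k (fun _ : Fin p => A) A) (g : MultilinearMap k (fun _ : Fin q => A) A) :
    MultilinearMap k (fun _ : Fin r => A) A :=
  ∑ i : Fin p, (((q : ℤ) - 1) * (i : ℕ)).negOnePow • H.circ h i f g
    - (((p : ℤ) - 1) * ((q : ℤ) - 1)).negOnePow •
      ∑ i : Fin q, (((p : ℤ) - 1) * (i : ℕ)).negOnePow • H.circ (by omega) i g f

/-- The module `C_n^α(A) = A ⊗ A^{⊗ n}` of `n`-chains. -/
def Chains (_ : RegularUnitalHomAssocAlgebra k A) (n : ℕ) : Type (max u v) :=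
  ⨂[k] (_ : Fin (n + 1)), A

noncomputable instance (n : ℕ) : AddCommGroup (H.Chains n) :=
  inferInstanceAs (AddCommGroup (⨂[k] (_ : Fin (n + 1)), A))

noncomputable instance (n : ℕ) : Module k (H.Chains n) :=
  (inferInstance : Module k (⨂[k] (_ : Fin (n + 1)), A))

/-- The identification of `A^{⊗(n+1)}` with the module of `n`-chains. -/
noncomputable def toChains (n : ℕ) : (⨂[k] (_ : Fin (n + 1)), A) ≃ₗ[k] H.Chains n :=
  LinearEquiv.refl k (⨂[k] (_ : Fin (n + 1)), A)

/-- For `f` of arity `p`,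
`f •_i (a₀ ⊗ ⋯ ⊗ a_n) =
  α^{p-1} a₀ ⊗ ⋯ ⊗ α^{p-1} a_{i-1} ⊗ f (a_i, …, a_{i+p-1}) ⊗ α^{p-1} a_{i+p} ⊗ ⋯ ⊗ α^{p-1} a_n`,
a chain of degree `m = n - p + 1`, for `0 ≤ i ≤ m`. -/
noncomputable def bullet {n m p : ℕ} (h : n + 1 = m + p) (i : Fin (m + 1))
    (f : MultilinearMap k (fun _ : Fin p => A) A) : H.Chains n →ₗ[k] H.Chains m :=
  (H.toChains m).toLinearMap ∘ₗ
    PiTensorProduct.lift (substMap (by omega) i (H.twist p) (PiTensorProduct.tprod k) f) ∘ₗ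
    (H.toChains n).symm.toLinearMap

/-- The cyclic operator `t (a₀ ⊗ a₁ ⊗ ⋯ ⊗ a_n) = a_n ⊗ a₀ ⊗ ⋯ ⊗ a_{n-1}`. -/
noncomputable def cyc (n : ℕ) : Module.End k (H.Chains n) :=
  ((H.toChains n).symm ≪≫ₗ
    PiTensorProduct.reindex k (fun _ : Fin (n + 1) => A) (finRotate (n + 1)) ≪≫ₗ
    H.toChains n).toLinearMap

/-- The Hochschild boundary `d^α : C_{n+1}^α(A) → C_n^α(A)`. Its terms are
`μ •_i (a₀ ⊗ ⋯ ⊗ a_{n+1}) = α a₀ ⊗ ⋯ ⊗ (a_i · a_{i+1}) ⊗ ⋯ ⊗ α a_{n+1}` with sign `(-1)^i`, for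
`0 ≤ i ≤ n`, and `μ •_0 t (a₀ ⊗ ⋯ ⊗ a_{n+1}) = (a_{n+1} · a₀) ⊗ α a₁ ⊗ ⋯ ⊗ α a_n` with sign
`(-1)^{n+1}`. -/
noncomputable def boundary (n : ℕ) : H.Chains (n + 1) →ₗ[k] H.Chains n :=
  ∑ i : Fin (n + 1), (-1 : k) ^ (i : ℕ) • H.bullet (by omega) i H.mulCochain
    + (-1 : k) ^ (n + 1) • H.bullet (by omega) 0 H.mulCochain ∘ₗ H.cyc (n + 1)

/-- Hochschild cycles. -/
noncomputable def cycles : ∀ n : ℕ, Submodule k (H.Chains n)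
  | 0 => ⊤
  | n + 1 => LinearMap.ker (H.boundary n)

/-- Hochschild boundaries. -/
noncomputable def boundaries (n : ℕ) : Submodule k (H.Chains n) :=
  LinearMap.range (H.boundary n)

/-- The Hochschild homology `H_n^α(A)`. -/
abbrev Homology (n : ℕ) : Type (max u v) :=
  H.cycles n ⧸ (H.boundaries n).submoduleOf (H.cycles n)

/-- The homology class of a cycle. -/
noncomputable def homologyClass (n : ℕ) : H.cycles n →ₗ[k] H.Homology n :=
  ((H.boundaries n).submoduleOf (H.cycles n)).mkQ

/-- The cap product `i_f x = (μ ∘₂ f) •_0 x`, that is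
`i_f (a₀ ⊗ ⋯ ⊗ a_n) = α^{p-1} a₀ · f (a₁, …, a_p) ⊗ α^p a_{p+1} ⊗ ⋯ ⊗ α^p a_n`. -/
noncomputable def cap {p n m : ℕ} (h : m + p = n) (f : MultilinearMap k (fun _ : Fin p => A) A) :
    H.Chains n →ₗ[k] H.Chains m :=
  H.bullet (by omega) 0 (H.circ (r := p + 1) (by omega) 1 H.mulCochain f)

/-- The Lie derivative
`L_f x = ∑_{j=1}^{n-p+1} (-1)^{(p-1)(j-1)} f •_j x
  + ∑_{j=1}^p (-1)^{n(j-1)+p-1} f •_0 t^{j-1} x`, with `j = i + 1`. -/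
noncomputable def lie {p n m : ℕ} (h : m + p = n + 1)
    (f : MultilinearMap k (fun _ : Fin p => A) A) : H.Chains n →ₗ[k] H.Chains m :=
  ∑ i : Fin m, (((p : ℤ) - 1) * (i : ℕ)).negOnePow • H.bullet h.symm i.succ f
    + ∑ i : Fin p, ((n : ℤ) * (i : ℕ) + p - 1).negOnePow •
      H.bullet h.symm 0 f ∘ₗ (H.cyc n) ^ (i : ℕ)

/-- The Connes boundary operator `B x = ∑_{i=0}^n (-1)^{in} (id - t) t (1 •_{n+1} t^i x)`. -/
noncomputable def connesB (n : ℕ) : H.Chains n →ₗ[k] H.Chains (n + 1) :=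
  ∑ i : Fin (n + 1), (-1 : k) ^ ((i : ℕ) * n) •
    ((LinearMap.id - H.cyc (n + 1)) ∘ₗ H.cyc (n + 1) ∘ₗ
      H.bullet (by omega) (Fin.last (n + 1)) H.oneCochain ∘ₗ (H.cyc n) ^ (i : ℕ))

end RegularUnitalHomAssocAlgebra

/-! # The noncommutative differential calculus of a hom-associative algebra

Since `α` is bijective, the product can be untwisted: `α⁻¹ (a · b)` is an associative product on `A`
with the same unit, and `α` is an automorphism of it (`wordMul`, `isWordProduct`). Composing a
cochain of arity `p` with `α^{1-p}` and a chain of degree `n` with `α^{-n}` removes all powers of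
`α` from the operations: they become the usual operations on Hochschild chains of the untwisted
algebra and on those Hochschild cochains that commute with `α` (`toWord_circ`, `bullet_chainWord`).
The theorem is thus the classical calculus of an associative algebra, for the subcomplex of
equivariant cochains. All homotopies are natural expressions in the given cochains, hence
equivariant, so the classical proof applies.

In order to handle arbitrary arities, a cochain is a multilinear function of words which vanishes on
words of the wrong length, and sums over positions are sums over factorizations of a word
(`splits`). A chain operation is given by its dual on multilinear functions of words, with values in
arbitrary modules; a natural operator on such functions gives back a map on chains (`op`,
`lift_op`). Duality reverses the order of composition. All signs are Koszul signs for the shifted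
degrees `p - 1` modulo `2`, so that their comparison is a finite check.

The identities rest on a few combinatorial ones. The pre-Lie identity `ins_ins` gives the Jacobi
identity and `δ² = 0`; `lieOp_lieOp` gives the relation between Lie derivatives and the bracket, and
`d² = 0`. The remaining laws hold up to explicit homotopies. Graded commutativity of the cup product
holds up to `ins g γ f`, which inserts one cochain into the other (`wordCup_comm`); the Leibniz rule
up to `ins2`, which inserts two cochains at once (`wordBracket_wordCup`); the relation between
contractions and Lie derivatives up to `capOp g f φ`,
    in which `g` is applied to a block that contains
the leading letter and the value of `f` (`capOp_wordBracket`); the Cartan-Rinehart formula up to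
`rotIns`, which inserts `f` after the leading letter in all rotations, with the unit in front
(`lieOp_eq`). Connes' operator has two terms, the second of which is null homotopic (`dOp_lst`);
the first one, `dOp`, squares to zero up to homotopy (`dOp_dOp`). -/

/-! ### Sums over deconcatenations of a word -/

section Words

section Splits

variable {A : Type v} {E : Type w} [AddCommGroup E]

/-- The sign `(-1)^x`, for `x` an integer modulo `2`. -/
def sgn (x : ZMod 2) : ℤ := if x = 0 then 1 else -1

theorem sgn_add : ∀ x y : ZMod 2, sgn (x + y) = sgn x * sgn y := by decide

theorem sgn_zero : sgn 0 = 1 := rfl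

theorem sgn_one : sgn 1 = -1 := rfl

theorem sgn_smul_sgn_smul (x y : ZMod 2) (e : E) : sgn x • sgn y • e = sgn (x + y) • e := by
  rw [smul_smul, sgn_add]

theorem neg_sgn_smul (x : ZMod 2) (e : E) : -(sgn x • e) = sgn (x + 1) • e := by
  rw [sgn_add, sgn_one]; simp

/-- Signs have to agree only where the terms are nonzero. -/
theorem sgn_smul_congr {x y : ZMod 2} {e e' : E} (he : e = e') (h : e' ≠ 0 → x = y) :
    sgn x • e = sgn y • e' := by
  subst he
  by_cases h0 : e = 0
  · simp [h0]
  · rw [h h0]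

/-- The parity of the length of a word. -/
def par (w : List A) : ZMod 2 := (w.length : ZMod 2)

@[simp] theorem par_nil : par ([] : List A) = 0 := rfl

@[simp] theorem par_cons (a : A) (w : List A) : par (a :: w) = par w + 1 := by simp [par]

@[simp] theorem par_append (u v : List A) : par (u ++ v) = par u + par v := by simp [par]

/-- `splits w F` is the sum of `F u v` over all factorizations `w = u ++ v`. -/
def splits : List A → (List A → List A → E) → E
  | [], F => F [] []
  | a :: w, F => F [] (a :: w) + splits w (fun u v => F (a :: u) v)

@[simp] theorem splits_nil (F : List A → List A → E) : splits [] F = F [] [] := rfl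

theorem splits_cons (a : A) (w : List A) (F : List A → List A → E) :
    splits (a :: w) F = F [] (a :: w) + splits w (fun u v => F (a :: u) v) := rfl

theorem splits_congr' {w : List A} {F G : List A → List A → E}
    (h : ∀ u v, u ++ v = w → F u v = G u v) : splits w F = splits w G := by
  induction w generalizing F G with
  | nil => exact h [] [] rfl
  | cons a w ih =>
    rw [splits_cons, splits_cons, h [] (a :: w) rfl, ih fun u v e => h (a :: u) v (by simp [e])]

theorem splits_congr {w : List A} {F G : List A → List A → E} (h : ∀ u v, F u v = G u v) :
    splits w F = splits w G := splits_congr' fun u v _ => h u v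

theorem splits_zero (w : List A) : splits w (fun _ _ => (0 : E)) = 0 := by
  induction w with
  | nil => rfl
  | cons a w ih => rw [splits_cons, ih, add_zero]

theorem splits_add (w : List A) (F G : List A → List A → E) :
    splits w (fun u v => F u v + G u v) = splits w F + splits w G := by
  induction w generalizing F G with
  | nil => rfl
  | cons a w ih => rw [splits_cons, splits_cons, splits_cons, ih]; abel

theorem smul_splits (c : ℤ) (w : List A) (F : List A → List A → E) :
    c • splits w F = splits w (fun u v => c • F u v) := by
  induction w generalizing F with
  | nil => rfl
  | cons a w ih => rw [splits_cons, splits_cons, smul_add, ih]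

theorem neg_splits (w : List A) (F : List A → List A → E) :
    -splits w F = splits w (fun u v => -F u v) := by
  simpa using smul_splits (-1) w F

theorem map_splits {E' : Type*} [AddCommGroup E'] (φ : E →+ E') (w : List A)
    (F : List A → List A → E) :
    φ (splits w F) = splits w (fun u v => φ (F u v)) := by
  induction w generalizing F with
  | nil => rfl
  | cons a w ih => rw [splits_cons, splits_cons, map_add, ih]

theorem splits_comm (w w' : List A) (F : List A → List A → List A → List A → E) :
    splits w (fun u v => splits w' (fun u' v' => F u v u' v')) =
      splits w' (fun u' v' => splits w (fun u v => F u v u' v')) := by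
  induction w generalizing F with
  | nil => rfl
  | cons a w ih =>
    simp only [splits_cons]
    rw [ih, ← splits_add]

/-- Coassociativity of deconcatenation. The first argument of `F` keeps the unsplit block. -/
theorem splits_splits_left (w : List A) (F : List A → List A → List A → List A → E) :
    splits w (fun u r => splits u (fun a b => F u a b r)) =
      splits w (fun a r => splits r (fun b c => F (a ++ b) a b c)) := by
  induction w generalizing F with
  | nil => rfl
  | cons x w ih =>
    simp only [splits_cons, splits_nil, splits_add, List.nil_append]
    rw [ih fun u a b r => F (x :: u) (x :: a) b r]
    simp only [List.cons_append]
    abel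

theorem splits_append_cons (u : List A) (x : A) (v : List A) (F : List A → List A → E) :
    splits (u ++ x :: v) F =
      splits u (fun a b => F a (b ++ x :: v)) + splits v (fun a b => F (u ++ x :: a) b) := by
  induction u generalizing F with
  | nil => rfl
  | cons y u ih =>
    rw [List.cons_append, splits_cons, ih, splits_cons]
    simp [add_assoc]

/-! The lemmas `splits_nest` put iterated deconcatenations of a word into right-nested form. The
lemmas `splits_congr` compare right-nested sums, where each remainder is the concatenation of the
later blocks. -/

theorem splits_nest₁ (w : List A)
    (F : List A → List A → List A → List A → List A → List A → E) :
    splits w (fun u r => splits r fun v z =>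
        splits u (fun a b => F u a b r v z)) =
      splits w (fun a q => splits q fun b r => splits r fun v z =>
        F (a ++ b) a b r v z) := by
  rw [← splits_splits_left w fun u a b r => splits r fun v z => F u a b r v z]
  exact splits_congr fun u r => splits_comm _ _ _

theorem splits_nest₂ (w : List A)
    (F : List A → List A → List A → List A → List A → List A → List A → List A → E) :
    splits w (fun u r => splits r fun v s => splits s fun c z =>
        splits u (fun a b => F u a b r v s c z)) =
      splits w (fun a q => splits q fun b r => splits r fun v s => splits s fun c z =>
        F (a ++ b) a b r v s c z) := by
  rw [← splits_nest₁ w fun u a b r v s =>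
    splits s fun c z => F u a b r v s c z]
  exact splits_congr fun _ _ => splits_congr fun _ _ => splits_comm _ _ _

theorem splits_nest₃ (w : List A)
    (F : List A → List A → List A → List A → List A → List A → List A → List A → List A → List A →
        E) :
    splits w (fun u r => splits r fun v s => splits s fun c t => splits t fun d z =>
        splits u (fun a b => F u a b r v s c t d z)) =
      splits w (fun a q => splits q fun b r => splits r fun v s => splits s fun c t =>
        splits t fun d z => F (a ++ b) a b r v s c t d z) := by
  rw [← splits_nest₂ w fun u a b r v s c t =>
    splits t fun d z => F u a b r v s c t d z]
  exact splits_congr fun _ _ => splits_congr fun _ _ => splits_congr fun _ _ => splits_comm _ _ _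

theorem splits_nest₄ (w : List A)
    (F : List A → List A → List A → List A → List A → List A → List A → List A → List A → List A →
        List A → List A → E) :
    splits w (fun u r => splits r fun v s => splits s fun c t => splits t fun d x =>
        splits x fun e z => splits u (fun a b => F u a b r v s c t d x e z)) =
      splits w (fun a q => splits q fun b r => splits r fun v s => splits s fun c t =>
        splits t fun d x => splits x fun e z => F (a ++ b) a b r v s c t d x e z) := by
  rw [← splits_nest₃ w fun u a b r v s c t d x =>
    splits x fun e z => F u a b r v s c t d x e z]
  exact splits_congr fun _ _ => splits_congr fun _ _ => splits_congr fun _ _ =>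
    splits_congr fun _ _ => splits_comm _ _ _

theorem splits_congr₃ {w : List A} {F G : List A → List A → List A → List A → List A → List A → E}
    (h' : ∀ a b c d, F a (b ++ (c ++ d)) b (c ++ d) c d = G a (b ++ (c ++ d)) b (c ++ d) c d) :
    splits w (fun a r => splits r fun b s => splits s fun c d => F a r b s c d) =
      splits w (fun a r => splits r fun b s => splits s fun c d => G a r b s c d) :=
  splits_congr fun a r => splits_congr' fun b s e1 =>
    splits_congr' fun c d e2 => by
    subst e1 e2; exact h' _ _ _ _

theorem splits_congr₄ {w : List A} {F G : List A → List A → List A → List A → List A → List A →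
    List A → List A → E}
    (h' : ∀ a b c d e, F a (b ++ (c ++ (d ++ e))) b (c ++ (d ++ e)) c (d ++ e) d e =
        G a (b ++ (c ++ (d ++ e))) b (c ++ (d ++ e)) c (d ++ e) d e) :
    splits w (fun a r => splits r fun b s => splits s fun c t => splits t fun d e =>
        F a r b s c t d e) =
      splits w (fun a r => splits r fun b s => splits s fun c t => splits t fun d e =>
        G a r b s c t d e) :=
  splits_congr fun a r => splits_congr' fun b s e1 =>
    splits_congr' fun c t e2 => splits_congr' fun d e e3 => by
    subst e1 e2 e3; exact h' _ _ _ _ _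

theorem splits_congr₅ {w : List A} {F G : List A → List A → List A → List A → List A → List A →
    List A → List A → List A → List A → E}
    (h' : ∀ a b c d e g, F a (b ++ (c ++ (d ++ (e ++ g)))) b (c ++ (d ++ (e ++ g))) c
        (d ++ (e ++ g)) d (e ++ g) e g =
      G a (b ++ (c ++ (d ++ (e ++ g)))) b (c ++ (d ++ (e ++ g))) c
        (d ++ (e ++ g)) d (e ++ g) e g) :
    splits w (fun a r => splits r fun b s => splits s fun c t => splits t fun d x =>
        splits x fun e g => F a r b s c t d x e g) =
      splits w (fun a r => splits r fun b s => splits s fun c t => splits t fun d x =>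
        splits x fun e g => G a r b s c t d x e g) :=
  splits_congr fun a r => splits_congr' fun b s e1 =>
    splits_congr' fun c t e2 => splits_congr' fun d x e3 =>
    splits_congr' fun e g e4 => by
    subst e1 e2 e3 e4; exact h' _ _ _ _ _ _

theorem splits_congr₆ {w : List A} {F G : List A → List A → List A → List A → List A → List A →
    List A → List A → List A → List A → List A → List A → E}
    (h' : ∀ a b c d e g h, F a (b ++ (c ++ (d ++ (e ++ (g ++ h))))) b
        (c ++ (d ++ (e ++ (g ++ h)))) c (d ++ (e ++ (g ++ h))) d (e ++ (g ++ h)) e (g ++ h) g h =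
      G a (b ++ (c ++ (d ++ (e ++ (g ++ h))))) b
        (c ++ (d ++ (e ++ (g ++ h)))) c (d ++ (e ++ (g ++ h))) d (e ++ (g ++ h)) e (g ++ h) g h) :
    splits w (fun a r => splits r fun b s => splits s fun c t => splits t fun d x =>
        splits x fun e y => splits y fun g h => F a r b s c t d x e y g h) =
      splits w (fun a r => splits r fun b s => splits s fun c t => splits t fun d x =>
        splits x fun e y => splits y fun g h => G a r b s c t d x e y g h) :=
  splits_congr fun a r => splits_congr' fun b s e1 =>
    splits_congr' fun c t e2 => splits_congr' fun d x e3 =>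
    splits_congr' fun e y e4 => splits_congr' fun g h e5 => by
    subst e1 e2 e3 e4 e5; exact h' _ _ _ _ _ _ _

theorem splits_eq_right {w : List A} {F : List A → List A → E} (h : ∀ u v, u ≠ [] → F u v = 0) :
    splits w F = F [] w := by
  cases w with
  | nil => rfl
  | cons a w =>
    rw [splits_cons, splits_congr (G := fun _ _ => 0) fun u v => h _ _ (by simp), splits_zero,
      add_zero]

theorem splits_eq_left {w : List A} {F : List A → List A → E} (h : ∀ u v, v ≠ [] → F u v = 0) :
    splits w F = F w [] := by
  induction w generalizing F with
  | nil => rfl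
  | cons a w ih =>
    rw [splits_cons, h _ _ (by simp), zero_add, ih fun u v hv => h _ _ hv]

theorem exists_of_splits_ne_zero {w : List A} {F : List A → List A → E} (h : splits w F ≠ 0) :
    ∃ u v, u ++ v = w ∧ F u v ≠ 0 := by
  by_contra! hc
  exact h ((splits_congr' hc).trans (splits_zero w))

theorem splits_map {A' : Type*} (φ : A' → A) (w : List A') (F : List A → List A → E) :
    splits (w.map φ) F = splits w fun u v => F (u.map φ) (v.map φ) := by
  induction w generalizing F with
  | nil => rfl
  | cons a w ih => simp only [List.map_cons, splits_cons, ih, List.map_nil]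

end Splits

/-! ### Multilinear functions of words -/

variable {k : Type u} {A : Type v} {E : Type w} [CommRing k] [AddCommGroup A] [Module k A]
  [AddCommGroup E] [Module k E]

variable (k) in
/-- A function of words that is linear in each letter, for words of any length. -/
def WordMultilinear (Φ : List A → E) : Prop :=
  ∀ u v : List A, IsLinearMap k fun x => Φ (u ++ x :: v)

theorem isLinearMap_splits (w : List A) {F : A → List A → List A → E}
    (h : ∀ u v, IsLinearMap k fun x => F x u v) : IsLinearMap k fun x => splits w (F x) where
  map_add x y := by
    rw [← splits_add]; exact splits_congr fun u v => (h u v).map_add x y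
  map_smul c x := by
    have := map_splits (DistribSMul.toAddMonoidHom E c) w (F x)
    simp only [DistribSMul.toAddMonoidHom_apply] at this
    rw [this]
    exact splits_congr fun u v => (h u v).map_smul c x

theorem IsLinearMap.map_splits {F : A → E} (h : IsLinearMap k F) (w : List A)
    (G : List A → List A → A) : F (splits w G) = splits w (fun u v => F (G u v)) :=
  _root_.map_splits (IsLinearMap.mk' F h).toAddMonoidHom w G

theorem IsLinearMap.map_zsmul {F : A → E} (h : IsLinearMap k F) (c : ℤ) (x : A) :
    F (c • x) = c • F x := (IsLinearMap.mk' F h).toAddMonoidHom.map_zsmul c x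

theorem IsLinearMap.zsmul {F : A → E} (h : IsLinearMap k F) (c : ℤ) :
    IsLinearMap k fun x => c • F x where
  map_add x y := by rw [h.map_add, smul_add]
  map_smul c' x := by rw [h.map_smul, smul_comm]

theorem IsLinearMap.add' {F G : A → E} (hF : IsLinearMap k F) (hG : IsLinearMap k G) :
    IsLinearMap k fun x => F x + G x where
  map_add x y := by rw [hF.map_add, hG.map_add]; abel
  map_smul c' x := by rw [hF.map_smul, hG.map_smul, smul_add]

theorem IsLinearMap.comp' {F : A → E} {G : A → A} (hF : IsLinearMap k F) (hG : IsLinearMap k G) :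
    IsLinearMap k fun x => F (G x) where
  map_add x y := by rw [hG.map_add, hF.map_add]
  map_smul c' x := by rw [hG.map_smul, hF.map_smul]

namespace WordMultilinear

variable {Φ Ψ : List A → E}

theorem zero_of_mem (h : WordMultilinear k Φ) {w : List A} (hw : (0 : A) ∈ w) : Φ w = 0 := by
  obtain ⟨u, v, rfl⟩ := List.append_of_mem hw
  exact (h u v).map_zero

theorem head (h : WordMultilinear k Φ) (v : List A) : IsLinearMap k fun x => Φ (x :: v) := h [] v

theorem fix_left (h : WordMultilinear k Φ) (u : List A) :
    WordMultilinear k fun w => Φ (u ++ w) := fun a b => by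
  simpa using h (u ++ a) b

theorem fix_cons (h : WordMultilinear k Φ) (x : A) :
    WordMultilinear k fun w => Φ (x :: w) := h.fix_left [x]

theorem add (h : WordMultilinear k Φ) (h' : WordMultilinear k Ψ) : WordMultilinear k (Φ + Ψ) :=
  fun u v => (h u v).add' (h' u v)

theorem zsmul (h : WordMultilinear k Φ) (c : ℤ) : WordMultilinear k (c • Φ) :=
  fun u v => (h u v).zsmul c

theorem comp_linear {E' : Type*} [AddCommGroup E'] [Module k E'] (h : WordMultilinear k Φ)
    (φ : E →ₗ[k] E') : WordMultilinear k fun w => φ (Φ w) := fun u v =>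
  ⟨fun x y => by simp only [(h u v).map_add, map_add],
    fun c x => by simp only [(h u v).map_smul, map_smul]⟩

end WordMultilinear

end Words

/-! ### Insertions and Lie derivatives on words -/

section WordOperations

variable {k : Type u} {A : Type v} {E : Type w} [CommRing k] [AddCommGroup A] [Module k A]
  [AddCommGroup E] [Module k E]

/-- `ins g ε Φ w = ∑ ± Φ (u g(v) z)` over `w = u v z`, where `g` of parity `ε` passes `u`. -/
def ins (g : List A → A) (ε : ZMod 2) (Φ : List A → E) (w : List A) : E :=
  splits w fun u r => splits r fun v z => sgn (ε * par u) • Φ (u ++ g v :: z)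

/-- `ins2 g ε h η Φ w = ∑ ± Φ (u g(v) s h(v') s')` over `w = u v s v' s'`: the simultaneous
insertion of `g` and, further to the right, `h`, with Koszul signs. -/
def ins2 (g : List A → A) (ε : ZMod 2) (h : List A → A) (η : ZMod 2) (Φ : List A → E)
    (w : List A) : E :=
  splits w fun u r => splits r fun v r => splits r fun s r => splits r fun v' s' =>
    sgn (ε * par u + η * (par u + par v + par s)) • Φ (u ++ g v :: (s ++ h v' :: s'))

/-- `g` vanishes on words whose length has not the parity of `ε + 1`. -/
def HasParity (g : List A → A) (ε : ZMod 2) : Prop := ∀ v, g v ≠ 0 → par v = ε + 1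

/-- The pre-Lie identity: inserting `g` and then `h` amounts to inserting `h` into `g`, or `h` to one
of the two sides of `g`. In this lemma and its analogues below, both sides expand into sums over
factorizations of the word, which match term by term; the signs need to agree only where the term is
nonzero, and there the parities of the blocks are known. -/
theorem ins_ins (g : List A → A) (ε : ZMod 2) {h : List A → A} {η : ZMod 2} (hh : HasParity h η)
    {Φ : List A → E} (hΦ : WordMultilinear k Φ) :
    ins h η (ins g ε Φ) = ins (ins h η g) (ε + η) Φ + ins2 g ε h η Φ
      + sgn (ε * η) • ins2 h η g ε Φ := by
  ext w
  simp only [Pi.add_apply, Pi.smul_apply]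
  have e1 : ∀ u z (w : List A) (G : List A → List A → A),
      Φ (u ++ splits w G :: z) = splits w fun a b => Φ (u ++ G a b :: z) :=
    fun u z w G => (hΦ u z).map_splits w G
  have e2 : ∀ u z (c : ℤ) (x : A), Φ (u ++ (c • x) :: z) = c • Φ (u ++ x :: z) :=
    fun u z c x => (hΦ u z).map_zsmul c x
  simp only [ins, ins2, e1, e2, splits_append_cons, splits_add, smul_add, smul_splits,
    sgn_smul_sgn_smul, splits_nest₁, splits_splits_left,
    List.append_assoc, List.cons_append, par_append, par_cons]
  -- The terms on both sides match in these pairs.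
  have key : ∀ {t₁ t₂ t₃ r₁ r₂ r₃ : E}, t₁ = r₂ → t₂ = r₁ → t₃ = r₃ →
      t₁ + t₂ + t₃ = r₁ + r₂ + r₃ := by
    intros; subst_vars; abel
  refine key ?_ ?_ ?_
  · refine splits_congr₄ fun a b c d e => sgn_smul_congr rfl fun _ => ?_
    generalize par a = x₁, par b = x₂, par c = x₃, ε = x₄, η = x₅
    decide +revert
  · refine splits_congr₄ fun a b c d e => sgn_smul_congr rfl fun _ => ?_
    generalize par a = x₁, par b = x₂, par c = x₃, ε = x₄, η = x₅
    decide +revert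
  · refine splits_congr₄ fun a b c d e => sgn_smul_congr rfl fun h0 => ?_
    rw [hh b fun e => h0 (by simp [e, hΦ.zero_of_mem])]
    generalize par a = x₁, par c = x₃, ε = x₄, η = x₅
    decide +revert

/-- The Lie derivative along `f`, with Koszul signs, on functions of cyclic words. -/
def lieOp (f : List A → A) (ε : ZMod 2) (Φ : List A → E) : List A → E
  | [] => 0
  | a :: w =>
    splits w (fun u r => splits r fun v z => sgn (ε * (par u + 1)) • Φ (a :: (u ++ f v :: z))) +
    splits w (fun u r => splits r fun c v =>
      sgn (par v * (1 + par u + par c)) • Φ (f (v ++ a :: u) :: c))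

/-- The sum of `± Φ (g(z a u f(v) u') c)` over `w = u v u' c z`, on the cyclic word `a w`: `g` is
applied to a block that contains the leading letter `a` and, to the right of `a`, a block to which
`f` has been applied. For `g` a product this is the contraction with `f`; for general `g` it is a
homotopy. -/
def capOp (g f : List A → A) (ε : ZMod 2) (Φ : List A → E) : List A → E
  | [] => 0
  | a :: w =>
    splits w fun u r => splits r fun v r => splits r fun u' r => splits r fun c z =>
      sgn (par z * (1 + par u + par v + par u' + par c) + ε * (par z + 1 + par u)) •
        Φ (g (z ++ a :: (u ++ f v :: u')) :: c)

/-- The terms `± Φ (h(z' g(z a u f(v) u') u'') c)` with three nested operations on the cyclic word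
`a w`, where `w = u v u' u'' c z' z`. -/
def nestOp (h g : List A → A) (η : ZMod 2) (f : List A → A) (ε : ZMod 2) (Φ : List A → E) :
    List A → E
  | [] => 0
  | a :: w =>
    splits w fun u r => splits r fun v r => splits r fun u' r => splits r fun u'' r =>
      splits r fun c r => splits r fun z' z =>
      sgn ((par z + par z') * (1 + par u + par v + par u' + par u'' + par c)
        + η * par z'
        + ε * (par z' + par z + 1 + par u)) •
        Φ (h (z' ++ g (z ++ a :: (u ++ f v :: u')) :: u'') :: c)

/-- The commutator of a Lie derivative with `capOp g f ε`. The terms `nestOp` cancel when the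
identities for the pairs `(h, g)` and `(g, h)` are combined. -/
theorem lieOp_capOp {h g f : List A → A} {η γ ε : ZMod 2} (hh : HasParity h η)
    (hg : HasParity g γ) (hf : HasParity f ε) (hhl : WordMultilinear k h)
    (hgl : WordMultilinear k g) (hfl : WordMultilinear k f)
    {Φ : List A → E} (hΦ : WordMultilinear k Φ) :
    lieOp h η (capOp g f ε Φ) + sgn (η * ε) • capOp g (ins f ε h) (η + ε) Φ
      + sgn (η * ε) • nestOp g h η f ε Φ + sgn (η * (γ + ε)) • nestOp h g γ f ε Φ =
      sgn (η * (γ + ε)) • capOp g f ε (lieOp h η Φ) + sgn (η * ε) • capOp (ins h η g) f ε Φ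
      + capOp g (ins h η f) (η + ε) Φ := by
  ext w
  simp only [Pi.add_apply, Pi.smul_apply]
  cases w with
  | nil => simp [lieOp, capOp, nestOp]
  | cons a₀ w =>
  have e1 : ∀ z (w : List A) (G : List A → List A → A),
      Φ (splits w G :: z) = splits w fun a b => Φ (G a b :: z) :=
    fun z w G => (hΦ.head z).map_splits w G
  have e2 : ∀ z (c : ℤ) (x : A), Φ ((c • x) :: z) = c • Φ (x :: z) :=
    fun z c x => (hΦ.head z).map_zsmul c x
  have e3 : ∀ p u u' z (w : List A) (G : List A → List A → A),
      Φ (g (p ++ a₀ :: (u ++ splits w G :: u')) :: z) =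
        splits w fun a b => Φ (g (p ++ a₀ :: (u ++ G a b :: u')) :: z) := fun p u u' z w G => by
    have := (hgl (p ++ a₀ :: u) u').map_splits w G
    simp only [List.append_assoc, List.cons_append] at this
    rw [this, e1]
  have e4 : ∀ p u u' z (c : ℤ) (x : A),
      Φ (g (p ++ a₀ :: (u ++ (c • x) :: u')) :: z) = c • Φ (g (p ++ a₀ :: (u ++ x :: u')) :: z) :=
    fun p u u' z c x => by
    have := (hgl (p ++ a₀ :: u) u').map_zsmul c x
    simp only [List.append_assoc, List.cons_append] at this
    rw [this, e2]
  have e5 : ∀ z (x y : A), Φ ((x + y) :: z) = Φ (x :: z) + Φ (y :: z) :=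
    fun z x y => (hΦ.head z).map_add x y
  simp only [ins, lieOp, capOp, nestOp, e1, e2, e3, e4, e5, splits_append_cons, splits_add,
    smul_add, smul_splits, sgn_smul_sgn_smul, splits_nest₁, splits_nest₂, splits_nest₃,
    splits_nest₄, splits_splits_left,
    List.append_assoc, List.cons_append, par_append, par_cons]
  -- The terms on both sides, match in these pairs.
  have key : ∀ {l1 l2 l3 l4 l5 l6 l7 l8 l9 r1 r2 c1 c2 c3 c4 c5 c6 r9 : E}, l1 = c1 → l2 = r1 →
      l3 = c6 → l4 = r9 → l5 = c4 → l6 = c2 → l7 = c5 → l8 = c3 → l9 = r2 →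
      l1 + l2 + l3 + l4 + l5 + l6 + l7 + l8 + l9 =
        r1 + r2 + (c1 + (c2 + c3) + (c4 + c5 + c6)) + r9 := by
    intros; subst_vars; abel
  refine key ?_ ?_ ?_ ?_ ?_ ?_ ?_ ?_ ?_
  · refine splits_congr₆ fun a b c d e x y => sgn_smul_congr rfl fun h0 => ?_
    simp only [par_append]
    rw [hh x fun e' => h0 (by simp [e', hΦ.zero_of_mem, hgl.zero_of_mem]),
      hf b fun e' => h0 (by simp [e', hΦ.zero_of_mem, hgl.zero_of_mem])]
    generalize par a = x₁, par c = x₃, par d = x₄, par e = x₅, par y = x₇, ε = y₁, γ = y₂, η = y₃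
    decide +revert
  · refine splits_congr₆ fun a b c d e x y => sgn_smul_congr rfl fun h0 => ?_
    have p₃ := hg (y ++ a₀ :: (a ++ f b :: c)) fun e' => h0 (by simp [e', hΦ.zero_of_mem])
    simp only [par_append, par_cons] at p₃
    rw [hh e fun e' => h0 (by simp [e', hΦ.zero_of_mem]),
      hf b fun e' => h0 (by simp [e', hΦ.zero_of_mem, hgl.zero_of_mem])]
    revert p₃
    generalize par a = x₁, par c = x₃, par d = x₄, par x = x₆, par y = x₇, ε = y₁, γ = y₂, η = y₃
    decide +revert
  · refine splits_congr₆ fun a b c d e x y => sgn_smul_congr rfl fun h0 => ?_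
    rw [hh d fun e' => h0 (by simp [e', hΦ.zero_of_mem, hgl.zero_of_mem]),
      hf b fun e' => h0 (by simp [e', hΦ.zero_of_mem, hgl.zero_of_mem])]
    generalize par a = x₁, par c = x₃, par e = x₅, par x = x₆, par y = x₇, ε = y₁, γ = y₂, η = y₃
    decide +revert
  · refine splits_congr₆ fun a b c d e x y => sgn_smul_congr rfl fun h0 => ?_
    have p₂ := hf (b ++ h c :: d) fun e' => h0 (by simp [e', hΦ.zero_of_mem, hgl.zero_of_mem])
    simp only [par_append, par_cons] at p₂
    rw [hh c fun e' => h0 (by simp [e', hΦ.zero_of_mem, hgl.zero_of_mem, hfl.zero_of_mem])]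
    revert p₂
    generalize par a = x₁, par b = x₂, par d = x₄, par e = x₅, par x = x₆, par y = x₇, ε = y₁, γ =
        y₂, η = y₃
    decide +revert
  · refine splits_congr₆ fun a b c d e x y => sgn_smul_congr rfl fun h0 => ?_
    rw [hh b fun e' => h0 (by simp [e', hΦ.zero_of_mem, hgl.zero_of_mem]),
      hf d fun e' => h0 (by simp [e', hΦ.zero_of_mem, hgl.zero_of_mem])]
    generalize par a = x₁, par c = x₃, par e = x₅, par x = x₆, par y = x₇, ε = y₁, γ = y₂, η = y₃
    decide +revert
  · refine splits_congr₆ fun a b c d e x y => sgn_smul_congr rfl fun h0 => ?_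
    have p₁ := hh (y ++ a₀ :: a) fun e' => h0 (by simp [e', hΦ.zero_of_mem, hgl.zero_of_mem])
    simp only [par_append, par_cons] at p₁
    simp only [par_append]
    revert p₁
    generalize par a = x₁, par b = x₂, par c = x₃, par d = x₄, par e = x₅, par x = x₆, par y =
        x₇, ε = y₁, γ = y₂, η = y₃
    decide +revert
  · refine splits_congr₆ fun a b c d e x y => sgn_smul_congr rfl fun h0 => ?_
    generalize par a = x₁, par b = x₂, par c = x₃, par d = x₄, par e = x₅, par x = x₆, par y =
        x₇, ε = y₁, γ = y₂, η = y₃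
    decide +revert
  · refine splits_congr₆ fun a b c d e x y => sgn_smul_congr rfl fun h0 => ?_
    simp only [par_append]
    generalize par a = x₁, par b = x₂, par c = x₃, par d = x₄, par e = x₅, par x = x₆, par y =
        x₇, ε = y₁, γ = y₂, η = y₃
    decide +revert
  · refine splits_congr₆ fun a b c d e x y => sgn_smul_congr rfl fun h0 => ?_
    have p₂ := hg (y ++ a₀ :: (a ++ f b :: c)) fun e' =>
        h0 (by simp [e', hΦ.zero_of_mem, hhl.zero_of_mem])
    simp only [par_append, par_cons] at p₂
    rw [hf b fun e' => h0 (by simp [e', hΦ.zero_of_mem, hgl.zero_of_mem, hhl.zero_of_mem])]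
    revert p₂
    generalize par a = x₁, par c = x₃, par d = x₄, par e = x₅, par x = x₆, par y = x₇, ε = y₁, γ =
        y₂, η = y₃
    decide +revert

/-- The commutator of an insertion with `ins2`: the block of `y` may be disjoint from those of `g`
and `h`, lie inside one of them, or contain one or both of them. -/
theorem ins2_ins {y g h : List A → A} {υ γ η : ZMod 2} (hy : HasParity y υ)
    (hg : HasParity g γ) (hh : HasParity h η) (hyl : WordMultilinear k y)
        (hgl : WordMultilinear k g)
    {Φ : List A → E} (hΦ : WordMultilinear k Φ) :
    ins2 g γ h η (ins y υ Φ) + sgn (υ * γ) • ins2 (ins y υ g) (υ + γ) h η Φ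
      + sgn (υ * (γ + η)) • ins2 g γ (ins y υ h) (υ + η) Φ =
    sgn (υ * (γ + η)) • ins y υ (ins2 g γ h η Φ) + ins (ins2 g γ h η y) (υ + γ + η) Φ
      + ins2 (ins g γ y) (υ + γ) h η Φ
      + sgn (υ * γ) • ins2 g γ (ins h η y) (υ + η) Φ := by
  ext w
  simp only [Pi.add_apply, Pi.smul_apply]
  have e1 : ∀ u z (w : List A) (G : List A → List A → A),
      Φ (u ++ splits w G :: z) = splits w fun a b => Φ (u ++ G a b :: z) :=
    fun u z w G => (hΦ u z).map_splits w G
  have e2 : ∀ u z (c : ℤ) (x : A), Φ (u ++ (c • x) :: z) = c • Φ (u ++ x :: z) :=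
    fun u z c x => (hΦ u z).map_zsmul c x
  have e3 : ∀ u x s z (w : List A) (G : List A → List A → A),
      Φ (u ++ x :: (s ++ splits w G :: z)) = splits w fun a b => Φ (u ++ x :: (s ++ G a b :: z)) :=
    fun u x s z w G => by simpa using (hΦ (u ++ x :: s) z).map_splits w G
  have e4 : ∀ u x s z (c : ℤ) (y : A),
      Φ (u ++ x :: (s ++ (c • y) :: z)) = c • Φ (u ++ x :: (s ++ y :: z)) :=
    fun u x s z c y => by simpa using (hΦ (u ++ x :: s) z).map_zsmul c y
  simp only [ins, ins2, e1, e2, e3, e4, splits_append_cons, splits_add,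
    smul_add, smul_splits, sgn_smul_sgn_smul, splits_nest₁, splits_nest₂, splits_nest₃,
    splits_splits_left,
    List.append_assoc, List.cons_append, par_append, par_cons]
  -- The terms on both sides match in these pairs.
  have key : ∀ {l1 l2 l3 l4 l5 l6 l7 l8 r1 r2 r3 r4 r5 r6 r7 r8 : E}, l1 = r5 → l2 = r7 → l3 = r6 →
      l4 = r3 → l5 = r8 → l6 = r1 → l7 = r4 → l8 = r2 →
      l1 + (l2 + l3) + (l4 + l5 + l6) + l7 + l8 = r1 + r2 + r3 + r4 + r5 + r6 + r7 + r8 := by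
    intros; subst_vars; abel
  refine key ?_ ?_ ?_ ?_ ?_ ?_ ?_ ?_
  · refine splits_congr₆ fun a b c d e x z => sgn_smul_congr rfl fun h0 => ?_
    rw [hy b fun e' => h0 (by simp [e', hΦ.zero_of_mem]),
      hg d fun e' => h0 (by simp [e', hΦ.zero_of_mem])]
    generalize par a = x₁, par c = x₃, par e = x₅, par x = x₆, par z = x₇, υ = y₁, γ = y₂, η = y₃
    decide +revert
  · refine splits_congr₆ fun a b c d e x z => sgn_smul_congr rfl fun h0 => ?_
    rw [hg c fun e' => h0 (by simp [e', hΦ.zero_of_mem, hyl.zero_of_mem])]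
    generalize par a = x₁, par b = x₂, par d = x₄, par e = x₅, par x = x₆, par z = x₇, υ = y₁, γ =
        y₂, η = y₃
    decide +revert
  · refine splits_congr₆ fun a b c d e x z => sgn_smul_congr rfl fun h0 => ?_
    rw [hg c fun e' => h0 (by simp [e', hΦ.zero_of_mem, hyl.zero_of_mem])]
    generalize par a = x₁, par b = x₂, par d = x₄, par e = x₅, par x = x₆, par z = x₇, υ = y₁, γ =
        y₂, η = y₃
    decide +revert
  · refine splits_congr₆ fun a b c d e x z => sgn_smul_congr rfl fun h0 => ?_
    rw [hg b fun e' => h0 (by simp [e', hΦ.zero_of_mem]),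
      hy d fun e' => h0 (by simp [e', hΦ.zero_of_mem])]
    generalize par a = x₁, par c = x₃, par e = x₅, par x = x₆, par z = x₇, υ = y₁, γ = y₂, η = y₃
    decide +revert
  · refine splits_congr₆ fun a b c d e x z => sgn_smul_congr rfl fun h0 => ?_
    rw [hg b fun e' => h0 (by simp [e', hΦ.zero_of_mem])]
    generalize par a = x₁, par c = x₃, par d = x₄, par e = x₅, par x = x₆, par z = x₇, υ = y₁, γ =
        y₂, η = y₃
    decide +revert
  · refine splits_congr₆ fun a b c d e x z => sgn_smul_congr rfl fun h0 => ?_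
    rw [hg b fun e' => h0 (by simp [e', hΦ.zero_of_mem]),
      hh d fun e' => h0 (by simp [e', hΦ.zero_of_mem])]
    generalize par a = x₁, par c = x₃, par e = x₅, par x = x₆, par z = x₇, υ = y₁, γ = y₂, η = y₃
    decide +revert
  · refine splits_congr₆ fun a b c d e x z => sgn_smul_congr rfl fun h0 => ?_
    have p₂ := hg (b ++ y c :: d) fun e' => h0 (by simp [e', hΦ.zero_of_mem])
    simp only [par_append, par_cons] at p₂
    rw [hy c fun e' => h0 (by simp [e', hΦ.zero_of_mem, hgl.zero_of_mem])]
    revert p₂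
    generalize par a = x₁, par b = x₂, par d = x₄, par e = x₅, par x = x₆, par z = x₇, υ = y₁, γ =
        y₂, η = y₃
    decide +revert
  · refine splits_congr₆ fun a b c d e x z => sgn_smul_congr rfl fun h0 => ?_
    rw [hg b fun e' => h0 (by simp [e', hΦ.zero_of_mem])]
    generalize par a = x₁, par c = x₃, par d = x₄, par e = x₅, par x = x₆, par z = x₇, υ = y₁, γ =
        y₂, η = y₃
    decide +revert

/-- The sum over all ways to apply `g` and `h` to disjoint blocks of a cyclic word, `g` being
applied to the first of the two blocks, where the first block is the one that contains the leading
letter, if there is one. -/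
def lieOp2 (g : List A → A) (γ : ZMod 2) (h : List A → A) (η : ZMod 2) (Φ : List A → E) :
    List A → E
  | [] => 0
  | a :: w =>
    splits w (fun u r => splits r fun v r => splits r fun s r => splits r fun v' s' =>
      sgn (γ * (par u + 1) + η * (par u + 1 + par v + par s)) •
        Φ (a :: (u ++ g v :: (s ++ h v' :: s')))) +
    splits w (fun u r => splits r fun c r => splits r fun v r => splits r fun c' z =>
      sgn (par z * (1 + par u + par c + par v + par c') + η * (par z + 1 + par u + par c)) •
        Φ (g (z ++ a :: u) :: (c ++ h v :: c')))

/-- The composition of two Lie derivatives splits into the terms in which `h` meets `g` and those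
in which the two blocks are disjoint. -/
theorem lieOp_lieOp {g h : List A → A} {γ η : ZMod 2} (hg : HasParity g γ)
    (hh : HasParity h η) (hgl : WordMultilinear k g)
    {Φ : List A → E} (hΦ : WordMultilinear k Φ) :
    lieOp h η (lieOp g γ Φ) =
      lieOp (ins h η g) (γ + η) Φ + lieOp2 g γ h η Φ + sgn (γ * η) • lieOp2 h η g γ Φ := by
  ext w
  simp only [Pi.add_apply, Pi.smul_apply]
  cases w with
  | nil => simp [lieOp, lieOp2]
  | cons a₀ w =>
  have e1 : ∀ z (w : List A) (G : List A → List A → A),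
      Φ (splits w G :: z) = splits w fun a b => Φ (G a b :: z) :=
    fun z w G => (hΦ.head z).map_splits w G
  have e2 : ∀ z (c : ℤ) (x : A), Φ ((c • x) :: z) = c • Φ (x :: z) :=
    fun z c x => (hΦ.head z).map_zsmul c x
  have e3 : ∀ x s z (w : List A) (G : List A → List A → A),
      Φ (x :: (s ++ splits w G :: z)) = splits w fun a b => Φ (x :: (s ++ G a b :: z)) :=
    fun x s z w G => by simpa using (hΦ (x :: s) z).map_splits w G
  have e4 : ∀ x s z (c : ℤ) (y : A),
      Φ (x :: (s ++ (c • y) :: z)) = c • Φ (x :: (s ++ y :: z)) :=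
    fun x s z c y => by simpa using (hΦ (x :: s) z).map_zsmul c y
  have e5 : ∀ z (x y : A), Φ ((x + y) :: z) = Φ (x :: z) + Φ (y :: z) :=
    fun z x y => (hΦ.head z).map_add x y
  simp only [ins, lieOp, lieOp2, e1, e2, e3, e4, e5, splits_append_cons, splits_add,
    smul_add, smul_splits, sgn_smul_sgn_smul, splits_nest₁, splits_nest₂, splits_splits_left,
    List.append_assoc, List.cons_append, par_append, par_cons]
  -- The terms on both sides match in these pairs.
  have key : ∀ {l1 l2 l3 l4 l5 l6 l7 l8 r1 c1 c2 c3 d1 d2 d3 d4 : E}, l1 = d1 → l2 = r1 → l3 = d3 →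
      l4 = c1 → l5 = d2 → l6 = c3 → l7 = d4 → l8 = c2 →
      l1 + l2 + l3 + (l4 + l5 + l6) + (l7 + l8) = r1 + (c1 + c2 + c3) + (d1 + d2) + (d3 + d4) := by
    intros; subst_vars; abel
  refine key ?_ ?_ ?_ ?_ ?_ ?_ ?_ ?_
  · refine splits_congr₄ fun a b c d e => sgn_smul_congr rfl fun h0 => ?_
    rw [hg b fun e' => h0 (by simp [e', hΦ.zero_of_mem])]
    generalize par a = x₁, par c = x₃, par d = x₄, par e = x₅, γ = y₁, η = y₂
    decide +revert
  · refine splits_congr₄ fun a b c d e => sgn_smul_congr rfl fun h0 => ?_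
    generalize par a = x₁, par b = x₂, par c = x₃, par d = x₄, par e = x₅, γ = y₁, η = y₂
    decide +revert
  · refine splits_congr₄ fun a b c d e => sgn_smul_congr rfl fun h0 => ?_
    rw [hh b fun e' => h0 (by simp [e', hΦ.zero_of_mem])]
    generalize par a = x₁, par c = x₃, par d = x₄, par e = x₅, γ = y₁, η = y₂
    decide +revert
  · refine splits_congr₄ fun a b c d e => sgn_smul_congr rfl fun h0 => ?_
    simp only [par_append]
    rw [hh d fun e' => h0 (by simp [e', hΦ.zero_of_mem, hgl.zero_of_mem])]
    generalize par a = x₁, par b = x₂, par c = x₃, par e = x₅, γ = y₁, η = y₂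
    decide +revert
  · refine splits_congr₄ fun a b c d e => sgn_smul_congr rfl fun h0 => ?_
    have p₂ := hg (e ++ a₀ :: a) fun e' => h0 (by simp [e', hΦ.zero_of_mem])
    simp only [par_append, par_cons] at p₂
    rw [hh c fun e' => h0 (by simp [e', hΦ.zero_of_mem])]
    revert p₂
    generalize par a = x₁, par b = x₂, par d = x₄, par e = x₅, γ = y₁, η = y₂
    decide +revert
  · refine splits_congr₄ fun a b c d e => sgn_smul_congr rfl fun h0 => ?_
    rw [hh b fun e' => h0 (by simp [e', hΦ.zero_of_mem, hgl.zero_of_mem])]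
    generalize par a = x₁, par c = x₃, par d = x₄, par e = x₅, γ = y₁, η = y₂
    decide +revert
  · refine splits_congr₄ fun a b c d e => sgn_smul_congr rfl fun h0 => ?_
    have p₂ := hh (e ++ a₀ :: a) fun e' => h0 (by simp [e', hΦ.zero_of_mem])
    simp only [par_append, par_cons] at p₂
    rw [hg c fun e' => h0 (by simp [e', hΦ.zero_of_mem])]
    revert p₂
    generalize par a = x₁, par b = x₂, par d = x₄, par e = x₅, γ = y₁, η = y₂
    decide +revert
  · refine splits_congr₄ fun a b c d e => sgn_smul_congr rfl fun h0 => ?_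
    have p₁ := hh (e ++ a₀ :: a) fun e' => h0 (by simp [e', hΦ.zero_of_mem, hgl.zero_of_mem])
    simp only [par_append, par_cons] at p₁
    simp only [par_append]
    revert p₁
    generalize par a = x₁, par b = x₂, par c = x₃, par d = x₄, par e = x₅, γ = y₁, η = y₂
    decide +revert

/-- The signed sum over all rotations of a word: the norm operator of the cyclic group. -/
def nrm (Φ : List A → E) : List A → E
  | [] => 0
  | a :: w => splits w fun u v => sgn (par v * (1 + par u)) • Φ (v ++ a :: u)

/-- On sums over all rotations, the Lie derivative is the insertion at all places. -/
theorem lieOp_nrm {h : List A → A} {η : ZMod 2} (hh : HasParity h η)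
    {Φ : List A → E} (hΦ : WordMultilinear k Φ) :
    lieOp h η (nrm Φ) = nrm (ins h η Φ) := by
  ext w
  cases w with
  | nil => simp [lieOp, nrm]
  | cons a₀ w =>
  simp only [ins, lieOp, nrm, splits_append_cons, splits_add,
    smul_add, smul_splits, sgn_smul_sgn_smul, splits_nest₁, splits_splits_left,
    List.append_assoc, List.cons_append, par_append, par_cons]
  -- The terms on both sides match in these pairs.
  have key : ∀ {l1 l2 l3 r1 r2 r3 : E}, l1 = r1 → l2 = r3 → l3 = r2 →
      l1 + l2 + l3 = r1 + r2 + r3 := by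
    intros; subst_vars; abel
  refine key ?_ ?_ ?_
  · refine splits_congr₃ fun a b c d => sgn_smul_congr rfl fun h0 => ?_
    simp only [par_append]
    rw [hh c fun e' => h0 (by simp [e', hΦ.zero_of_mem])]
    generalize par a = x₁, par b = x₂, par d = x₄, η = y₁
    decide +revert
  · refine splits_congr₃ fun a b c d => sgn_smul_congr rfl fun h0 => ?_
    rw [hh b fun e' => h0 (by simp [e', hΦ.zero_of_mem])]
    generalize par a = x₁, par c = x₃, par d = x₄, η = y₁
    decide +revert
  · refine splits_congr₃ fun a b c d => sgn_smul_congr rfl fun h0 => ?_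
    have p₁ := hh (d ++ a₀ :: a) fun e' => h0 (by simp [e', hΦ.zero_of_mem])
    simp only [par_append, par_cons] at p₁
    simp only [par_append]
    revert p₁
    generalize par a = x₁, par b = x₂, par c = x₃, par d = x₄, η = y₁
    decide +revert

/-- The signed sum over all ways to apply `f` to a block of `w` and to rotate `a w` so that this
block comes after `a`. -/
def rotIns (f : List A → A) (ε : ZMod 2) (Θ : List A → E) : List A → E
  | [] => 0
  | a :: w => splits w fun u r => splits r fun b r => splits r fun u' v =>
      sgn (par v * (1 + par u + par b + par u') + ε * (par v + 1 + par u)) •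
        Θ (v ++ a :: (u ++ f b :: u'))

/-- The commutator of a Lie derivative with `rotIns`. The last term on the left, where `h` meets
both the leading letter and the block of `f`, gives rise to the contraction in the homotopy
formula. -/
theorem lieOp_rotIns {h f : List A → A} {η ε : ZMod 2} (hh : HasParity h η) (hf : HasParity f ε)
    (hhl : WordMultilinear k h) (hfl : WordMultilinear k f) {Θ : List A → E}
    (hΘ : WordMultilinear k Θ) :
    lieOp h η (rotIns f ε Θ) + sgn (ε * η) • rotIns (ins f ε h) (η + ε) Θ
      + sgn (ε * η) • capOp h f ε (nrm Θ) =
    sgn (ε * η) • rotIns f ε (ins h η Θ) + rotIns (ins h η f) (η + ε) Θ := by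
  ext w
  simp only [Pi.add_apply, Pi.smul_apply]
  cases w with
  | nil => simp [lieOp, rotIns, capOp]
  | cons a₀ w =>
  have e1 : ∀ v u u' (w : List A) (G : List A → List A → A),
      Θ (v ++ a₀ :: (u ++ splits w G :: u')) =
        splits w fun a b => Θ (v ++ a₀ :: (u ++ G a b :: u')) :=
    fun v u u' w G => by simpa using (hΘ (v ++ a₀ :: u) u').map_splits w G
  have e2 : ∀ v u u' (c : ℤ) (x : A),
      Θ (v ++ a₀ :: (u ++ (c • x) :: u')) = c • Θ (v ++ a₀ :: (u ++ x :: u')) :=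
    fun v u u' c x => by simpa using (hΘ (v ++ a₀ :: u) u').map_zsmul c x
  simp only [ins, lieOp, capOp, nrm, rotIns, e1, e2, splits_append_cons, splits_add,
    smul_add, smul_splits, sgn_smul_sgn_smul, splits_nest₁, splits_nest₂, splits_nest₃,
    splits_splits_left,
    List.append_assoc, List.cons_append, par_append, par_cons]
  -- The terms on both sides match in these pairs.
  have key : ∀ {l1 l2 l3 l4 l5 l6 l7 r1 r2 r3 r4 r5 r6 r7 : E}, l1 = r1 → l2 = r6 → l3 = r7 → l4 =
      r4 → l5 = r2 → l6 = r5 → l7 = r3 →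
      l1 + l2 + l3 + l4 + l5 + l6 + l7 = r1 + (r2 + r3) + (r4 + r5 + r6) + r7 := by
    intros; subst_vars; abel
  refine key ?_ ?_ ?_ ?_ ?_ ?_ ?_
  · refine splits_congr₅ fun a b c d e x => sgn_smul_congr rfl fun h0 => ?_
    simp only [par_append]
    rw [hh e fun e' => h0 (by simp [e', hΘ.zero_of_mem]),
      hf b fun e' => h0 (by simp [e', hΘ.zero_of_mem])]
    generalize par a = x₁, par c = x₃, par d = x₄, par x = x₆, ε = y₁, η = y₂
    decide +revert
  · refine splits_congr₅ fun a b c d e x => sgn_smul_congr rfl fun h0 => ?_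
    rw [hh d fun e' => h0 (by simp [e', hΘ.zero_of_mem]),
      hf b fun e' => h0 (by simp [e', hΘ.zero_of_mem])]
    generalize par a = x₁, par c = x₃, par e = x₅, par x = x₆, ε = y₁, η = y₂
    decide +revert
  · refine splits_congr₅ fun a b c d e x => sgn_smul_congr rfl fun h0 => ?_
    have p₂ := hf (b ++ h c :: d) fun e' => h0 (by simp [e', hΘ.zero_of_mem])
    simp only [par_append, par_cons] at p₂
    rw [hh c fun e' => h0 (by simp [e', hΘ.zero_of_mem, hfl.zero_of_mem])]
    revert p₂
    generalize par a = x₁, par b = x₂, par d = x₄, par e = x₅, par x = x₆, ε = y₁, η = y₂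
    decide +revert
  · refine splits_congr₅ fun a b c d e x => sgn_smul_congr rfl fun h0 => ?_
    rw [hh b fun e' => h0 (by simp [e', hΘ.zero_of_mem]),
      hf d fun e' => h0 (by simp [e', hΘ.zero_of_mem])]
    generalize par a = x₁, par c = x₃, par e = x₅, par x = x₆, ε = y₁, η = y₂
    decide +revert
  · refine splits_congr₅ fun a b c d e x => sgn_smul_congr rfl fun h0 => ?_
    have p₁ := hh (x ++ a₀ :: a) fun e' => h0 (by simp [e', hΘ.zero_of_mem])
    simp only [par_append, par_cons] at p₁
    simp only [par_append]
    revert p₁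
    generalize par a = x₁, par b = x₂, par c = x₃, par d = x₄, par e = x₅, par x = x₆, ε = y₁, η =
        y₂
    decide +revert
  · refine splits_congr₅ fun a b c d e x => sgn_smul_congr rfl fun h0 => ?_
    generalize par a = x₁, par b = x₂, par c = x₃, par d = x₄, par e = x₅, par x = x₆, ε = y₁, η =
        y₂
    decide +revert
  · refine splits_congr₅ fun a b c d e x => sgn_smul_congr rfl fun h0 => ?_
    have p₂ := hh (x ++ a₀ :: (a ++ f b :: c)) fun e' => h0 (by simp [e', hΘ.zero_of_mem])
    simp only [par_append, par_cons] at p₂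
    simp only [par_append]
    rw [hf b fun e' => h0 (by simp [e', hΘ.zero_of_mem, hhl.zero_of_mem])]
    revert p₂
    generalize par a = x₁, par c = x₃, par d = x₄, par e = x₅, par x = x₆, ε = y₁, η = y₂
    decide +revert

end WordOperations

/-! ### Arity, equivariance and multilinearity of the word operations -/

section Closure

variable {k : Type u} {A : Type v} {E : Type w} [CommRing k] [AddCommGroup A] [Module k A]
  [AddCommGroup E] [Module k E]

/-- `g` vanishes on words of length other than `p`. -/
def HasArity (g : List A → A) (p : ℤ) : Prop := ∀ v, g v ≠ 0 → (v.length : ℤ) = p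

/-- The parity `p - 1` of a cochain of arity `p`. -/
def parity (p : ℤ) : ZMod 2 := ((p - 1 : ℤ) : ZMod 2)

theorem HasArity.hasParity {g : List A → A} {p : ℤ} (h : HasArity g p) :
    HasParity g (parity p) := fun v hv => by
  have := congrArg (Int.cast : ℤ → ZMod 2) (h v hv)
  simp only [Int.cast_natCast] at this
  simp [par, parity, this]

theorem HasArity.ins {f g : List A → A} {p q : ℤ} (hf : HasArity f p) (hg : HasArity g q)
    (hfl : WordMultilinear k f) (ε : ZMod 2) : HasArity (ins g ε f) (p + q - 1) := fun w hw => by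
  obtain ⟨u, r, rfl, h1⟩ := exists_of_splits_ne_zero hw
  obtain ⟨v, z, rfl, h2⟩ := exists_of_splits_ne_zero h1
  have h3 := hf _ fun h => h2 (by rw [h, smul_zero])
  have h4 := hg v fun h => h2 (by simp [h, hfl.zero_of_mem])
  simp only [List.length_append, List.length_cons] at h3 ⊢
  omega

theorem HasArity.ins2 {f g h : List A → A} {p q r : ℤ} (hf : HasArity f p) (hg : HasArity g q)
    (hh : HasArity h r) (hfl : WordMultilinear k f) (ε η : ZMod 2) :
    HasArity (ins2 g ε h η f) (p + q + r - 2) := fun w hw => by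
  obtain ⟨u, r, rfl, h1⟩ := exists_of_splits_ne_zero hw
  obtain ⟨v, z, rfl, h2⟩ := exists_of_splits_ne_zero h1
  obtain ⟨s, z', rfl, h5⟩ := exists_of_splits_ne_zero h2
  obtain ⟨v', z'', rfl, h6⟩ := exists_of_splits_ne_zero h5
  have h3 := hf _ fun h => h6 (by rw [h, smul_zero])
  have h4 := hg v fun h => h6 (by simp [h, hfl.zero_of_mem])
  have h7 := hh v' fun h => h6 (by simp [h, hfl.zero_of_mem])
  simp only [List.length_append, List.length_cons] at h3 ⊢
  omega

theorem HasArity.add {f g : List A → A} {p : ℤ} (hf : HasArity f p) (hg : HasArity g p) :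
    HasArity (f + g) p := fun w hw => by
  by_cases h : f w = 0
  · exact hg w fun h' => hw (by simp [h, h'])
  · exact hf w h

theorem HasArity.zsmul {f : List A → A} {p : ℤ} (hf : HasArity f p) (c : ℤ) :
    HasArity (c • f) p := fun w hw => hf w fun h => hw (by simp [h])

/-- `f` commutes with `φ`. -/
def Equivariant (φ : A →ₗ[k] A) (f : List A → A) : Prop := ∀ v, f (v.map φ) = φ (f v)

theorem Equivariant.ins {φ : A →ₗ[k] A} {f g : List A → A} (hf : Equivariant φ f)
    (hg : Equivariant φ g) (ε : ZMod 2) : Equivariant φ (ins g ε f) := fun w => by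
  have h : ∀ u v z, f (u.map φ ++ g (v.map φ) :: z.map φ) = φ (f (u ++ g v :: z)) :=
    fun u v z => by rw [hg, ← hf]; simp
  have h' : ∀ (w : List A) (F : List A → List A → A), φ (splits w F) = splits w fun u v =>
      φ (F u v) := fun w F =>
    map_splits φ.toAddMonoidHom w F
  simp only [_root_.ins, splits_map, h, h', map_zsmul, par, List.length_map]

theorem Equivariant.ins2 {φ : A →ₗ[k] A} {f g h : List A → A} (hf : Equivariant φ f)
    (hg : Equivariant φ g) (hh : Equivariant φ h) (ε η : ZMod 2) :
    Equivariant φ (ins2 g ε h η f) := fun w => by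
  have h : ∀ u v s v' z, f (u.map φ ++ g (v.map φ) :: (s.map φ ++ h (v'.map φ) :: z.map φ)) =
      φ (f (u ++ g v :: (s ++ h v' :: z))) :=
    fun u v s v' z => by rw [hg, hh, ← hf]; simp
  have h' : ∀ (w : List A) (F : List A → List A → A), φ (splits w F) = splits w fun u v =>
      φ (F u v) := fun w F =>
    map_splits φ.toAddMonoidHom w F
  simp only [_root_.ins2, splits_map, h, h', map_zsmul, par, List.length_map]

theorem Equivariant.add {φ : A →ₗ[k] A} {f g : List A → A} (hf : Equivariant φ f)
    (hg : Equivariant φ g) : Equivariant φ (f + g) := fun v => by simp [hf v, hg v]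

theorem Equivariant.zsmul {φ : A →ₗ[k] A} {f : List A → A} (hf : Equivariant φ f) (c : ℤ) :
    Equivariant φ (c • f) := fun v => by simp [hf v]

variable {Φ : List A → E} {f g h : List A → A}

namespace WordMultilinear

/-- The function `Φ` is linear in a letter of its argument. -/
theorem slot (hΦ : WordMultilinear k Φ) {F : A → List A} (u v : List A)
    (h : ∀ x : A, F x = u ++ x :: v) : IsLinearMap k fun x => Φ (F x) := by
  simpa only [h] using hΦ u v

/-- The function `Φ` is linear in a letter of a block to which `f` is applied. -/
theorem slot_comp (hΦ : WordMultilinear k Φ) (hf : WordMultilinear k f) {F : A → List A}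
    (u v u' v' : List A) (h : ∀ x : A, F x = u ++ f (u' ++ x :: v') :: v) :
    IsLinearMap k fun x => Φ (F x) := by
  simp only [h]
  exact (hΦ u v).comp' (hf u' v')

/-- The function `Φ` is linear in a letter of a doubly nested block. -/
theorem slot_comp_comp (hΦ : WordMultilinear k Φ) (hg : WordMultilinear k g)
    (hf : WordMultilinear k f) {F : A → List A} (u v u' v' u'' v'' : List A)
    (h : ∀ x : A, F x = u ++ g (u' ++ f (u'' ++ x :: v'') :: v') :: v) :
    IsLinearMap k fun x => Φ (F x) := by
  simp only [h]
  exact (hΦ u v).comp' ((hg u' v').comp' (hf u'' v''))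

theorem ins (hΦ : WordMultilinear k Φ) (hg : WordMultilinear k g) (ε : ZMod 2) :
    WordMultilinear k (ins g ε Φ) := fun p q => by
  simp only [_root_.ins, splits_append_cons, splits_add, par_append, par_cons]
  refine .add' (.add' ?_ ?_) ?_
  · refine isLinearMap_splits _ fun a b => isLinearMap_splits _ fun c d => .zsmul ?_ _
    exact hΦ.slot (a ++ g c :: d) q fun x => by simp
  · refine isLinearMap_splits _ fun a b => isLinearMap_splits _ fun c d => .zsmul ?_ _
    exact hΦ.slot_comp hg a d b c fun x => by simp
  · refine isLinearMap_splits _ fun a b => isLinearMap_splits _ fun c d => .zsmul ?_ _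
    exact hΦ.slot p (a ++ g c :: d) fun x => by simp

theorem ins2 (hΦ : WordMultilinear k Φ) (hg : WordMultilinear k g) (hh : WordMultilinear k h)
    (ε η : ZMod 2) : WordMultilinear k (ins2 g ε h η Φ) := fun p q => by
  simp only [_root_.ins2, splits_append_cons, splits_add, par_append, par_cons]
  refine .add' (.add' (.add' (.add' ?_ ?_) ?_) ?_) ?_
  · refine isLinearMap_splits _ fun a b => isLinearMap_splits _ fun c d =>
      isLinearMap_splits _ fun e s => isLinearMap_splits _ fun v z => .zsmul ?_ _
    exact hΦ.slot (a ++ g c :: (e ++ h v :: z)) q fun x => by simp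
  · refine isLinearMap_splits _ fun a b => isLinearMap_splits _ fun c d =>
      isLinearMap_splits _ fun e s => isLinearMap_splits _ fun v z => .zsmul ?_ _
    exact hΦ.slot_comp hh (a ++ g c :: e) z s v fun x => by simp
  · refine isLinearMap_splits _ fun a b => isLinearMap_splits _ fun c d =>
      isLinearMap_splits _ fun e s => isLinearMap_splits _ fun v z => .zsmul ?_ _
    exact hΦ.slot (a ++ g c :: d) (e ++ h v :: z) fun x => by simp
  · refine isLinearMap_splits _ fun a b => isLinearMap_splits _ fun c d =>
      isLinearMap_splits _ fun e s => isLinearMap_splits _ fun v z => .zsmul ?_ _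
    exact hΦ.slot_comp hg a (e ++ h v :: z) b c fun x => by simp
  · refine isLinearMap_splits _ fun a b => isLinearMap_splits _ fun c d =>
      isLinearMap_splits _ fun e s => isLinearMap_splits _ fun v z => .zsmul ?_ _
    exact hΦ.slot p (a ++ g c :: (e ++ h v :: z)) fun x => by simp

theorem lieOp (hΦ : WordMultilinear k Φ) (hf : WordMultilinear k f) (ε : ZMod 2) :
    WordMultilinear k (lieOp f ε Φ)
  | [], w => by
    simp only [List.nil_append, _root_.lieOp]
    refine .add' (isLinearMap_splits _ fun a b => isLinearMap_splits _ fun c d => .zsmul ?_ _)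
      (isLinearMap_splits _ fun a b => isLinearMap_splits _ fun c d => .zsmul ?_ _)
    · exact hΦ.slot [] (a ++ f c :: d) fun x => by simp
    · exact hΦ.slot_comp hf [] c d a fun x => by simp
  | a₀ :: p, q => by
    simp only [List.cons_append, _root_.lieOp, splits_append_cons, splits_add, par_append, par_cons]
    refine .add' (.add' (.add' ?_ ?_) ?_) (.add' (.add' ?_ ?_) ?_)
    · refine isLinearMap_splits _ fun a b => isLinearMap_splits _ fun c d => .zsmul ?_ _
      exact hΦ.slot (a₀ :: (a ++ f c :: d)) q fun x => by simp
    · refine isLinearMap_splits _ fun a b => isLinearMap_splits _ fun c d => .zsmul ?_ _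
      exact hΦ.slot_comp hf (a₀ :: a) d b c fun x => by simp
    · refine isLinearMap_splits _ fun a b => isLinearMap_splits _ fun c d => .zsmul ?_ _
      exact hΦ.slot (a₀ :: p) (a ++ f c :: d) fun x => by simp
    · refine isLinearMap_splits _ fun a b => isLinearMap_splits _ fun c d => .zsmul ?_ _
      exact hΦ.slot_comp hf [] c d (q ++ a₀ :: a) fun x => by simp
    · refine isLinearMap_splits _ fun a b => isLinearMap_splits _ fun c d => .zsmul ?_ _
      exact hΦ.slot (f (d ++ a₀ :: a) :: b) c fun x => by simp
    · refine isLinearMap_splits _ fun a b => isLinearMap_splits _ fun c d => .zsmul ?_ _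
      exact hΦ.slot_comp hf [] c (d ++ a₀ :: p) a fun x => by simp

theorem nrm (hΦ : WordMultilinear k Φ) : WordMultilinear k (nrm Φ)
  | [], w => by
    simp only [List.nil_append, _root_.nrm]
    exact isLinearMap_splits _ fun a b => .zsmul (hΦ b a) _
  | a₀ :: p, q => by
    simp only [List.cons_append, _root_.nrm, splits_append_cons, par_append, par_cons]
    refine .add' (isLinearMap_splits _ fun a b => .zsmul ?_ _)
      (isLinearMap_splits _ fun a b => .zsmul ?_ _)
    · exact hΦ.slot b (q ++ a₀ :: a) fun x => by simp
    · exact hΦ.slot (b ++ a₀ :: p) a fun x => by simp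

theorem rotIns (hΦ : WordMultilinear k Φ) (hf : WordMultilinear k f) (ε : ZMod 2) :
    WordMultilinear k (rotIns f ε Φ)
  | [], w => by
    simp only [List.nil_append, _root_.rotIns]
    exact isLinearMap_splits _ fun a b => isLinearMap_splits _ fun c d =>
      isLinearMap_splits _ fun e z => .zsmul (hΦ _ _) _
  | a₀ :: p, q => by
    simp only [List.cons_append, _root_.rotIns, splits_append_cons, splits_add, par_append,
        par_cons]
    refine .add' (.add' (.add' ?_ ?_) ?_) ?_
    · refine isLinearMap_splits _ fun a b => isLinearMap_splits _ fun c d =>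
        isLinearMap_splits _ fun e z => .zsmul ?_ _
      exact hΦ.slot z (q ++ a₀ :: (a ++ f c :: e)) fun x => by simp
    · refine isLinearMap_splits _ fun a b => isLinearMap_splits _ fun c d =>
        isLinearMap_splits _ fun e z => .zsmul ?_ _
      exact hΦ.slot (z ++ a₀ :: (a ++ f c :: d)) e fun x => by simp
    · refine isLinearMap_splits _ fun a b => isLinearMap_splits _ fun c d =>
        isLinearMap_splits _ fun e z => .zsmul ?_ _
      exact hΦ.slot_comp hf (z ++ a₀ :: a) e b c fun x => by simp
    · refine isLinearMap_splits _ fun a b => isLinearMap_splits _ fun c d =>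
        isLinearMap_splits _ fun e z => .zsmul ?_ _
      exact hΦ.slot (z ++ a₀ :: p) (a ++ f c :: e) fun x => by simp

theorem capOp (hΦ : WordMultilinear k Φ) (hg : WordMultilinear k g) (hf : WordMultilinear k f)
    (ε : ZMod 2) : WordMultilinear k (capOp g f ε Φ)
  | [], w => by
    simp only [List.nil_append, _root_.capOp]
    exact isLinearMap_splits _ fun a b => isLinearMap_splits _ fun c d =>
      isLinearMap_splits _ fun e z => isLinearMap_splits _ fun s t =>
      .zsmul (hΦ.slot_comp hg [] _ _ _ fun x => rfl) _
  | a₀ :: p, q => by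
    simp only [List.cons_append, _root_.capOp, splits_append_cons, splits_add, par_append, par_cons]
    refine .add' (.add' (.add' (.add' ?_ ?_) ?_) ?_) ?_
    · refine isLinearMap_splits _ fun a b => isLinearMap_splits _ fun c d =>
        isLinearMap_splits _ fun e z => isLinearMap_splits _ fun s t => .zsmul ?_ _
      exact hΦ.slot_comp hg [] s t (q ++ a₀ :: (a ++ f c :: e)) fun x => by simp
    · refine isLinearMap_splits _ fun a b => isLinearMap_splits _ fun c d =>
        isLinearMap_splits _ fun e z => isLinearMap_splits _ fun s t => .zsmul ?_ _
      exact hΦ.slot (g (t ++ a₀ :: (a ++ f c :: e)) :: z) s fun x => by simp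
    · refine isLinearMap_splits _ fun a b => isLinearMap_splits _ fun c d =>
        isLinearMap_splits _ fun e z => isLinearMap_splits _ fun s t => .zsmul ?_ _
      exact hΦ.slot_comp hg [] s (t ++ a₀ :: (a ++ f c :: d)) e fun x => by simp
    · refine isLinearMap_splits _ fun a b => isLinearMap_splits _ fun c d =>
        isLinearMap_splits _ fun e z => isLinearMap_splits _ fun s t => .zsmul ?_ _
      exact hΦ.slot_comp_comp hg hf [] s (t ++ a₀ :: a) e b c fun x => by simp
    · refine isLinearMap_splits _ fun a b => isLinearMap_splits _ fun c d =>
        isLinearMap_splits _ fun e z => isLinearMap_splits _ fun s t => .zsmul ?_ _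
      exact hΦ.slot_comp hg [] s (t ++ a₀ :: p) (a ++ f c :: e) fun x => by simp

end WordMultilinear

end Closure

/-! ### Linearity of the word operations -/

section TargetLinearity

variable {A : Type v} {E : Type w} [AddCommGroup E] {Φ Ψ : List A → E}

theorem ins_add (g : List A → A) (ε : ZMod 2) (Φ Ψ : List A → E) :
    ins g ε (Φ + Ψ) = ins g ε Φ + ins g ε Ψ := by
  ext w; simp only [ins, Pi.add_apply, smul_add, splits_add]

theorem ins_zsmul (g : List A → A) (ε : ZMod 2) (c : ℤ) (Φ : List A → E) :
    ins g ε (c • Φ) = c • ins g ε Φ := by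
  ext w; simp only [ins, Pi.smul_apply, smul_splits, smul_comm c]

theorem ins_zero (g : List A → A) (ε : ZMod 2) : ins g ε (0 : List A → E) = 0 := by
  simpa using ins_zsmul g ε 0 (0 : List A → E)

theorem ins2_zero (g h : List A → A) (ε η : ZMod 2) : ins2 g ε h η (0 : List A → E) = 0 := by
  ext w; simp only [ins2, Pi.zero_apply, smul_zero, splits_zero]

theorem ins2_zsmul (g h : List A → A) (ε η : ZMod 2) (c : ℤ) (Φ : List A → E) :
    ins2 g ε h η (c • Φ) = c • ins2 g ε h η Φ := by
  ext w; simp only [ins2, Pi.smul_apply, smul_splits, smul_comm c]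

theorem lieOp_zsmul (f : List A → A) (ε : ZMod 2) (c : ℤ) (Φ : List A → E) :
    lieOp f ε (c • Φ) = c • lieOp f ε Φ := by
  ext w
  cases w with
  | nil => simp [lieOp]
  | cons a w => simp only [lieOp, Pi.smul_apply, smul_splits, smul_add, smul_comm c]

theorem rotIns_add (f : List A → A) (ε : ZMod 2) (Φ Ψ : List A → E) :
    rotIns f ε (Φ + Ψ) = rotIns f ε Φ + rotIns f ε Ψ := by
  ext w
  cases w with
  | nil => simp [rotIns]
  | cons a w => simp only [rotIns, Pi.add_apply, smul_add, splits_add]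

theorem rotIns_zsmul (f : List A → A) (ε : ZMod 2) (c : ℤ) (Φ : List A → E) :
    rotIns f ε (c • Φ) = c • rotIns f ε Φ := by
  ext w
  cases w with
  | nil => simp [rotIns]
  | cons a w => simp only [rotIns, Pi.smul_apply, smul_splits, smul_comm c]

theorem rotIns_congr (f : List A → A) (ε : ZMod 2) (h : ∀ a w, Φ (a :: w) = Ψ (a :: w)) :
    rotIns f ε Φ = rotIns f ε Ψ := by
  ext w
  cases w with
  | nil => rfl
  | cons a w =>
    refine splits_congr₃ fun u b u' v => ?_
    cases v <;> simp [h]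

theorem nrm_add (Φ Ψ : List A → E) : nrm (Φ + Ψ) = nrm Φ + nrm Ψ := by
  ext w
  cases w with
  | nil => simp [nrm]
  | cons a w => simp only [nrm, Pi.add_apply, smul_add, splits_add]

theorem nrm_zsmul (c : ℤ) (Φ : List A → E) : nrm (c • Φ) = c • nrm Φ := by
  ext w
  cases w with
  | nil => simp [nrm]
  | cons a w => simp only [nrm, Pi.smul_apply, smul_splits, smul_comm c]

theorem nrm_congr {Φ Ψ : List A → E} (h : ∀ a w, Φ (a :: w) = Ψ (a :: w)) : nrm Φ = nrm Ψ := by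
  ext w
  cases w with
  | nil => rfl
  | cons a w =>
    refine splits_congr fun u v => ?_
    cases v <;> simp [h]

end TargetLinearity

section Linearity

variable {k : Type u} {A : Type v} {E : Type w} [CommRing k] [AddCommGroup A] [Module k A]
  [AddCommGroup E] [Module k E] {Φ Ψ : List A → E} {f f' g g' h h' : List A → A}

theorem add_ins (hΦ : WordMultilinear k Φ) (g g' : List A → A) (ε : ZMod 2) :
    ins (g + g') ε Φ = ins g ε Φ + ins g' ε Φ := by
  ext w
  simp only [ins, Pi.add_apply, fun u z x y => (hΦ u z).map_add x y, smul_add, splits_add]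

theorem zsmul_ins (hΦ : WordMultilinear k Φ) (c : ℤ) (g : List A → A) (ε : ZMod 2) :
    ins (c • g) ε Φ = c • ins g ε Φ := by
  ext w
  simp only [ins, Pi.smul_apply, fun u z c x => (hΦ u z).map_zsmul c x, smul_splits, smul_comm c]

theorem zero_ins (hΦ : WordMultilinear k Φ) (ε : ZMod 2) : ins 0 ε Φ = 0 := by
  simpa using zsmul_ins hΦ 0 0 ε

theorem add_ins2 (hΦ : WordMultilinear k Φ) (g g' h : List A → A) (ε η : ZMod 2) :
    ins2 (g + g') ε h η Φ = ins2 g ε h η Φ + ins2 g' ε h η Φ := by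
  ext w
  simp only [ins2, Pi.add_apply, fun u z x y => (hΦ u z).map_add x y, smul_add, splits_add]

theorem zsmul_ins2 (hΦ : WordMultilinear k Φ) (c : ℤ) (g h : List A → A) (ε η : ZMod 2) :
    ins2 (c • g) ε h η Φ = c • ins2 g ε h η Φ := by
  ext w
  simp only [ins2, Pi.smul_apply, fun u z c x => (hΦ u z).map_zsmul c x, smul_splits, smul_comm c]

theorem ins2_add_right (hΦ : WordMultilinear k Φ) (g h h' : List A → A) (ε η : ZMod 2) :
    ins2 g ε (h + h') η Φ = ins2 g ε h η Φ + ins2 g ε h' η Φ := by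
  have e : ∀ u x s z (y y' : A), Φ (u ++ x :: (s ++ (y + y') :: z)) =
      Φ (u ++ x :: (s ++ y :: z)) + Φ (u ++ x :: (s ++ y' :: z)) :=
    fun u x s z y y' => by simpa using (hΦ (u ++ x :: s) z).map_add y y'
  ext w
  simp only [ins2, Pi.add_apply, e, smul_add, splits_add]

theorem ins2_zsmul_right (hΦ : WordMultilinear k Φ) (c : ℤ) (g h : List A → A) (ε η : ZMod 2) :
    ins2 g ε (c • h) η Φ = c • ins2 g ε h η Φ := by
  have e : ∀ u x s z (c : ℤ) (y : A), Φ (u ++ x :: (s ++ (c • y) :: z)) =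
      c • Φ (u ++ x :: (s ++ y :: z)) :=
    fun u x s z c y => by simpa using (hΦ (u ++ x :: s) z).map_zsmul c y
  ext w
  simp only [ins2, Pi.smul_apply, e, smul_splits, smul_comm c]

end Linearity

/-! ### Bracket and cup product of word cochains -/

section Cochains

variable {k : Type u} {A : Type v} [CommRing k] [AddCommGroup A] [Module k A]
  {f g h m : List A → A} {φ γ η : ZMod 2}

/-- The Gerstenhaber bracket of word cochains `f` and `g` of parities `φ` and `γ`, where the parity
of a cochain of arity `p` is that of `p - 1`. The bracket with a product `m`, of parity `1`, is the
Hochschild differential up to sign. -/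
def wordBracket (f : List A → A) (φ : ZMod 2) (g : List A → A) (γ : ZMod 2) : List A → A :=
  ins g γ f + sgn (φ * γ + 1) • ins f φ g

theorem HasParity.add (hf : HasParity f φ) (hg : HasParity g φ) : HasParity (f + g) φ :=
  fun w hw => by
  by_cases h : f w = 0
  · exact hg w fun h' => hw (by simp [h, h'])
  · exact hf w h

theorem HasParity.zsmul (hf : HasParity f φ) (c : ℤ) : HasParity (c • f) φ :=
  fun w hw => hf w fun h => hw (by simp [h])

theorem HasParity.ins (hf : HasParity f φ) (hg : HasParity g γ)
    (hfl : WordMultilinear k f) : HasParity (ins g γ f) (φ + γ) := fun w hw => by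
  obtain ⟨u, r, rfl, h1⟩ := exists_of_splits_ne_zero hw
  obtain ⟨v, z, rfl, h2⟩ := exists_of_splits_ne_zero h1
  have h3 := hf _ fun h => h2 (by rw [h, smul_zero])
  have h4 := hg v fun h => h2 (by simp [h, hfl.zero_of_mem])
  simp only [par_append, par_cons] at h3 ⊢
  rw [h4]
  linear_combination h3

theorem HasParity.wordBracket (hf : HasParity f φ) (hg : HasParity g γ)
    (hfl : WordMultilinear k f) (hgl : WordMultilinear k g) :
    HasParity (wordBracket f φ g γ) (φ + γ) :=
  (hf.ins hg hfl).add ((add_comm γ φ ▸ hg.ins hf hgl).zsmul _)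

theorem wordBracket_add (hfl : WordMultilinear k f) (g h : List A → A) :
    wordBracket f φ (g + h) γ = wordBracket f φ g γ + wordBracket f φ h γ := by
  simp only [wordBracket, ins_add, add_ins hfl]
  module

theorem wordBracket_zsmul (hfl : WordMultilinear k f) (c : ℤ) (g : List A → A) :
    wordBracket f φ (c • g) γ = c • wordBracket f φ g γ := by
  simp only [wordBracket, ins_zsmul, zsmul_ins hfl]
  module

theorem add_wordBracket (hhl : WordMultilinear k h) (f g : List A → A) :
    wordBracket (f + g) φ h γ = wordBracket f φ h γ + wordBracket g φ h γ := by
  simp only [wordBracket, ins_add, add_ins hhl]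
  module

theorem zsmul_wordBracket (hgl : WordMultilinear k g) (c : ℤ) (f : List A → A) :
    wordBracket (c • f) φ g γ = c • wordBracket f φ g γ := by
  simp only [wordBracket, ins_zsmul, zsmul_ins hgl]
  module

theorem wordBracket_skew : wordBracket f φ g γ = -(sgn (φ * γ) • wordBracket g γ f φ) := by
  simp only [wordBracket, smul_add, smul_smul, ← sgn_add, neg_add]
  match_scalars <;> (generalize φ = x, γ = y; decide +revert)

/-- For a cochain `f` that is closed with respect to `m`, the two insertions that make up its
differential agree up to sign. -/
theorem ins_eq_of_wordBracket_eq_zero (c : wordBracket f φ m 1 = 0) :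
    ins m 1 f = sgn φ • ins f φ m := by
  simp only [wordBracket] at c
  linear_combination (norm := skip) c
  match_scalars <;> (generalize φ = x; decide +revert)

/-- All terms of the Jacobi identity are rewritten through the pre-Lie identity `ins_ins`; the
terms `ins2` are symmetric and cancel. -/
theorem wordBracket_jacobi (hf : HasParity f φ) (hg : HasParity g γ) (hh : HasParity h η)
    (hfl : WordMultilinear k f) (hgl : WordMultilinear k g) (hhl : WordMultilinear k h) :
    wordBracket f φ (wordBracket g γ h η) (γ + η) =
      wordBracket (wordBracket f φ g γ) (φ + γ) h η +
        sgn (φ * γ) • wordBracket g γ (wordBracket f φ h η) (φ + η) := by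
  have e : ∀ {x z : List A → A} {ζ : ZMod 2} (y : List A → A) (υ : ZMod 2), HasParity z ζ →
      WordMultilinear k x → ins (ins z ζ y) (υ + ζ) x =
        ins z ζ (ins y υ x) - ins2 y υ z ζ x - sgn (υ * ζ) • ins2 z ζ y υ x :=
    fun y υ hz hxl => by
      rw [ins_ins y υ hz hxl]; abel
  have i₁ := e g γ hh hfl
  have i₂ := e h η hg hfl
  have i₃ := e f φ hh hgl
  have i₄ := e h η hf hgl
  have i₅ := e f φ hg hhl
  have i₆ := e g γ hf hhl
  rw [add_comm η γ] at i₂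
  rw [add_comm η φ] at i₄
  rw [add_comm γ φ] at i₆
  simp only [wordBracket, ins_add, ins_zsmul, add_ins hfl, add_ins hgl, add_ins hhl,
    zsmul_ins hfl, zsmul_ins hgl, zsmul_ins hhl, i₁, i₂, i₃, i₄, i₅, i₆]
  match_scalars <;> (generalize φ = x, γ = y, η = z; decide +revert)

/-- `m` is an associative product with unit `e`, as a function of words supported in length `2`. -/
structure IsWordProduct (k : Type u) {A : Type v} [CommRing k] [AddCommGroup A] [Module k A]
    (m : List A → A) (e : A) : Prop where
  multilinear : WordMultilinear k m
  arity : HasArity m 2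
  assoc : ∀ a b c, m [m [a, b], c] = m [a, m [b, c]]
  one_mul : ∀ a, m [e, a] = a
  mul_one : ∀ a, m [a, e] = a

namespace IsWordProduct

variable {e : A}

theorem hasParity (hm : IsWordProduct k m e) : HasParity m 1 := hm.arity.hasParity

theorem eq_zero (hm : IsWordProduct k m e) {w : List A} (hw : w.length ≠ 2) : m w = 0 := by
  by_contra h
  exact hw (by exact_mod_cast hm.arity w h)

/-- Associativity, as the Maurer-Cartan equation. -/
theorem ins_self (hm : IsWordProduct k m e) : ins m 1 m = 0 := by
  ext w
  by_contra h
  have hl := (hm.arity.ins hm.arity hm.multilinear 1) w h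
  have hl' : w.length = 3 := by omega
  obtain ⟨a, b, c, rfl⟩ := List.length_eq_three.1 hl'
  have hz : ∀ w : List A, (0 : A) ∈ w → m w = 0 := fun w => hm.multilinear.zero_of_mem
  refine h ?_
  simp [ins, splits_cons, hm.eq_zero, hz, sgn_one, sgn_zero, hm.assoc]

theorem bracket_bracket_self (hm : IsWordProduct k m e) (hf : HasParity f φ)
    (hfl : WordMultilinear k f) :
    wordBracket (wordBracket f φ m 1) (φ + 1) m 1 = 0 := by
  have hml := hm.multilinear
  have i₁ := ins_ins m 1 hm.hasParity hfl
  have i₂ := ins_ins m 1 hf hml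
  have i₃ := ins_ins f φ hm.hasParity hml
  rw [hm.ins_self] at i₁
  rw [hm.ins_self, ins_zero, add_comm 1 φ] at i₂
  rw [zero_ins hfl] at i₁
  simp only [wordBracket, ins_add, ins_zsmul, add_ins hml, zsmul_ins hml]
  linear_combination (norm := skip) i₁ + sgn (φ + 1) • i₃ + i₂
  match_scalars <;> (generalize φ = x; decide +revert)

/-- Inserting cochains into the two slots of the product is compatible with the differential. -/
theorem bracket_ins2 (hm : IsWordProduct k m e) (hg : HasParity g γ) (hh : HasParity h η)
    (hgl : WordMultilinear k g) :
    wordBracket (ins2 g γ h η m) (γ + η + 1) m 1 =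
      sgn η • ins2 (wordBracket g γ m 1) (γ + 1) h η m +
        ins2 g γ (wordBracket h η m 1) (η + 1) m := by
  have hml := hm.multilinear
  have i₁ := ins2_ins hm.hasParity hg hh hml hgl hml
  rw [hm.ins_self, ins2_zero] at i₁
  rw [show 1 + γ + η = γ + η + 1 by ring, add_comm 1 γ, add_comm 1 η] at i₁
  simp only [wordBracket, add_ins2 hml, zsmul_ins2 hml, ins2_add_right hml, ins2_zsmul_right hml]
  linear_combination (norm := skip) (sgn (γ + η + 1)) • i₁
  match_scalars <;> (generalize γ = y, η = z; decide +revert)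

/-- The pre-Lie product of two cochains is a homotopy for the graded commutativity of the cup
product. -/
theorem bracket_ins (hm : IsWordProduct k m e) (hg : HasParity g γ)
    (hfl : WordMultilinear k f) :
    wordBracket (ins g γ f) (φ + γ) m 1 =
      ins (wordBracket g γ m 1) (γ + 1) f + sgn γ • ins g γ (wordBracket f φ m 1) +
        sgn (φ + γ) • (ins2 f φ g γ m + sgn (φ * γ) • ins2 g γ f φ m) := by
  have hml := hm.multilinear
  have i₁ := ins_ins g γ hm.hasParity hfl
  have i₂ := ins_ins f φ hg hml
  have i₃ := ins_ins m 1 hg hfl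
  rw [add_comm 1 γ] at i₃
  simp only [wordBracket, add_ins hfl, zsmul_ins hfl, ins_add, ins_zsmul]
  linear_combination (norm := skip) i₁ - sgn (φ + γ + 1) • i₂ - sgn γ • i₃
  match_scalars <;> (generalize φ = x, γ = y; decide +revert)

/-- The Leibniz rule holds up to the differential of `ins2 g γ h η f`. -/
theorem bracket_ins2_right (hm : IsWordProduct k m e) (hf : HasParity f φ) (hg : HasParity g γ)
    (hh : HasParity h η) (hfl : WordMultilinear k f) (hgl : WordMultilinear k g)
    (cf : wordBracket f φ m 1 = 0) (cg : wordBracket g γ m 1 = 0)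
    (ch : wordBracket h η m 1 = 0) :
    wordBracket f φ (ins2 g γ h η m) (γ + η + 1) =
      sgn φ • (ins2 (wordBracket f φ g γ) (φ + γ) h η m +
        sgn (φ * γ) • ins2 g γ (wordBracket f φ h η) (φ + η) m) -
      sgn (γ + η) • wordBracket (ins2 g γ h η f) (φ + γ + η) m 1 := by
  have hml := hm.multilinear
  have i₁ := ins2_ins hm.hasParity hg hh hml hgl hfl
  have i₂ := ins2_ins hf hg hh hfl hgl hml
  rw [ins_eq_of_wordBracket_eq_zero cf, ins_eq_of_wordBracket_eq_zero cg,
    ins_eq_of_wordBracket_eq_zero ch, ins2_zsmul, zsmul_ins2 hfl, ins2_zsmul_right hfl,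
    show 1 + γ + η = γ + η + 1 by ring] at i₁
  simp only [wordBracket, add_ins2 hml, zsmul_ins2 hml, ins2_add_right hml, ins2_zsmul_right hml]
  linear_combination (norm := skip) sgn φ • i₂ - i₁
  match_scalars <;> (generalize φ = x, γ = y, η = z; decide +revert)

end IsWordProduct

/-- The cup product, with respect to the product `m`. -/
def wordCup (m f g : List A → A) (w : List A) : A := splits w fun u v => m [g u, f v]

namespace IsWordProduct

variable {e : A}

/-- The cup product fills the two slots of `m`. The sign is the one for moving `f` past `g`. All
other terms of `ins2` have at least three letters in `m`, and vanish. -/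
theorem wordCup_eq (hm : IsWordProduct k m e) (hg : HasParity g γ) (φ : ZMod 2) :
    wordCup m f g = sgn (φ * (γ + 1)) • ins2 g γ f φ m := by
  ext w
  have hz : ∀ w : List A, (0 : A) ∈ w → m w = 0 := fun w => hm.multilinear.zero_of_mem
  rw [Pi.smul_apply, ins2, smul_splits, splits_eq_right]
  · simp only [smul_splits, wordCup]
    refine splits_congr fun u r => ?_
    rw [splits_eq_right, splits_eq_left]
    · simp only [List.nil_append, par_nil, sgn_smul_sgn_smul, zero_add, mul_zero, add_zero]
      by_cases h : g u = 0
      · rw [h, hz _ (by simp), smul_zero]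
      · rw [hg u h]
        have : φ * (γ + 1) + φ * (γ + 1) = 0 := CharTwo.add_self_eq_zero _
        rw [this, sgn_zero, one_smul]
    · intro u v hv
      rw [hm.eq_zero, smul_zero, smul_zero]
      have := List.length_pos_iff.2 hv
      simp; omega
    · intro u v hu
      refine (splits_congr fun _ _ => ?_).trans (splits_zero _)
      rw [hm.eq_zero, smul_zero, smul_zero]
      have := List.length_pos_iff.2 hu
      simp; omega
  · intro u v hu
    simp only [smul_splits]
    refine (splits_congr fun _ _ => (splits_congr fun _ _ => (splits_congr fun _ _ => ?_).trans
      (splits_zero _)).trans (splits_zero _)).trans (splits_zero _)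
    rw [hm.eq_zero, smul_zero, smul_zero]
    have := List.length_pos_iff.2 hu
    simp; omega

theorem wordCup_assoc (hm : IsWordProduct k m e) :
    wordCup m (wordCup m f g) h = wordCup m f (wordCup m g h) := by
  ext w
  have e₁ : ∀ x (w : List A) (G : List A → List A → A),
      m [x, splits w G] = splits w fun a b => m [x, G a b] := fun x w G =>
    (hm.multilinear [x] []).map_splits w G
  have e₂ : ∀ x (w : List A) (G : List A → List A → A),
      m [splits w G, x] = splits w fun a b => m [G a b, x] := fun x w G =>
    (hm.multilinear [] [x]).map_splits w G
  simp only [wordCup, e₁, e₂, splits_splits_left, hm.assoc]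

/-- The cup product of closed cochains is graded commutative up to the differential of
`ins g γ f`. -/
theorem wordCup_comm (hm : IsWordProduct k m e) (hf : HasParity f φ) (hg : HasParity g γ)
    (hfl : WordMultilinear k f)
    (cf : wordBracket f φ m 1 = 0) (cg : wordBracket g γ m 1 = 0) :
    wordCup m f g = sgn ((φ + 1) * (γ + 1)) • wordCup m g f +
      wordBracket (sgn γ • ins g γ f) (φ + γ) m 1 := by
  have i := hm.bracket_ins (φ := φ) hg hfl
  rw [cf, cg, zero_ins hfl, ins_zero] at i
  rw [hm.wordCup_eq hg φ, hm.wordCup_eq hf γ]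
  simp only [wordBracket, zsmul_ins hm.multilinear, ins_zsmul] at i ⊢
  linear_combination (norm := skip) -(sgn γ • i)
  match_scalars <;> (generalize φ = x, γ = y; decide +revert)

/-- The differential is a derivation of the cup product. -/
theorem wordBracket_wordCup_self (hm : IsWordProduct k m e) (hf : HasParity f φ)
    (hg : HasParity g γ) (hgl : WordMultilinear k g) :
    wordBracket (wordCup m f g) (φ + γ + 1) m 1 =
      wordCup m f (wordBracket g γ m 1) + sgn (γ + 1) • wordCup m (wordBracket f φ m 1) g := by
  have i := hm.bracket_ins2 hg hf hgl
  rw [hm.wordCup_eq hg φ, hm.wordCup_eq hg (φ + 1),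
    hm.wordCup_eq (hg.wordBracket hm.hasParity hgl hm.multilinear) φ,
    zsmul_wordBracket hm.multilinear, add_comm φ γ, i]
  match_scalars <;> (generalize φ = x, γ = y; decide +revert)

/-- The bracket with a closed cochain is a derivation of the cup product up to the differential of
`ins2 h η g γ f`. -/
theorem wordBracket_wordCup (hm : IsWordProduct k m e) (hf : HasParity f φ) (hg : HasParity g γ)
    (hh : HasParity h η) (hfl : WordMultilinear k f) (hhl : WordMultilinear k h)
    (cf : wordBracket f φ m 1 = 0) (cg : wordBracket g γ m 1 = 0)
    (ch : wordBracket h η m 1 = 0) :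
    wordBracket f φ (wordCup m g h) (γ + η + 1) = wordCup m (wordBracket f φ g γ) h +
      sgn (φ * (γ + 1)) • wordCup m g (wordBracket f φ h η) +
      wordBracket (sgn (γ * η + η + 1) • ins2 h η g γ f) (φ + γ + η) m 1 := by
  have i := hm.bracket_ins2_right hf hh hg hfl hhl cf ch cg
  rw [hm.wordCup_eq hh γ, hm.wordCup_eq hh (φ + γ),
    hm.wordCup_eq (hf.wordBracket hh hfl hhl) γ, wordBracket_zsmul hfl, add_comm γ η, i,
    zsmul_wordBracket hm.multilinear, show φ + η + γ = φ + γ + η by ring]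
  match_scalars <;> (generalize φ = x, γ = y, η = z; decide +revert)

end IsWordProduct

end Cochains

/-! ### The cyclic operator and the norm -/

section Cyclic

variable {A : Type v} {E : Type w} [AddCommGroup E]

theorem splits_concat (w : List A) (x : A) (F : List A → List A → E) :
    splits (w ++ [x]) F = splits w (fun u v => F u (v ++ [x])) + F (w ++ [x]) [] := by
  rw [splits_append_cons, splits_nil]

/-- If `G` is obtained from `F` by moving the dividing line by one letter, then the sums of `F` and
`G` over all factorizations differ by the two extreme terms only. -/
theorem splits_telescope (w : List A) {F G : List A → List A → E}
    (h : ∀ u x v, G (u ++ [x]) v = F u (x :: v)) :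
    splits w F + G [] w = splits w G + F w [] := by
  induction w generalizing F G with
  | nil => simp [add_comm]
  | cons a w ih =>
    have := ih (F := fun u v => F (a :: u) v) (G := fun u v => G (a :: u) v)
      fun u x v => h (a :: u) x v
    rw [splits_cons, splits_cons, ← h [] a w, List.nil_append]
    linear_combination (norm := abel) this

/-- The signed cyclic operator, moving the last letter of a word to the front. -/
def lst (Φ : List A → E) (w : List A) : E :=
  match w.reverse with
  | [] => 0
  | x :: c => sgn (par c) • Φ (x :: c.reverse)

theorem lst_concat (Φ : List A → E) (w : List A) (x : A) :
    lst Φ (w ++ [x]) = sgn (par w) • Φ (x :: w) := by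
  simp [lst, par]

theorem exists_eq_concat (a : A) (w : List A) : ∃ c x, a :: w = c ++ [x] := by
  rcases List.eq_nil_or_concat' (a :: w) with h | ⟨c, x, h⟩
  · simp at h
  · exact ⟨c, x, h⟩

/-- The norm is unchanged under precomposition with the cyclic operator, by telescoping. -/
theorem nrm_lst (Φ : List A → E) : nrm (lst Φ) = nrm Φ := by
  ext w
  cases w with
  | nil => rfl
  | cons a w =>
    simp only [nrm]
    have := splits_telescope w (F := fun u v => sgn (par v * (1 + par u)) • Φ (v ++ a :: u))
      (G := fun u v => sgn (par v * (1 + par u)) • lst Φ (v ++ a :: u)) fun u x v => by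
        have := lst_concat Φ (v ++ a :: u) x
        simp only [List.append_assoc, List.cons_append] at this
        simp only [this, sgn_smul_sgn_smul, par_append, par_cons, par_nil, List.cons_append]
        congr 2
        generalize par u = x, par v = y
        decide +revert
    rw [lst_concat, sgn_smul_sgn_smul] at this
    simp only [par_nil, add_zero, mul_one, CharTwo.add_self_eq_zero, sgn_zero, one_smul, zero_mul,
      List.nil_append, add_left_inj] at this
    exact this.symm

theorem lst_nrm (Φ : List A → E) : lst (nrm Φ) = nrm Φ := by
  ext w
  rcases List.eq_nil_or_concat' w with rfl | ⟨c, x, rfl⟩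
  · rfl
  rw [lst_concat]
  cases c with
  | nil => simp [sgn_zero]
  | cons a w =>
    simp only [List.cons_append, nrm, splits_concat, splits_cons, smul_add, smul_splits,
      sgn_smul_sgn_smul, List.nil_append, List.append_assoc, par_cons, par_append, par_nil]
    rw [add_comm]
    congr 1
    · refine splits_congr' fun u v h => ?_
      rw [← h, par_append]
      congr 2
      generalize par u = x, par v = y
      decide +revert
    · congr 2
      generalize par w = x
      decide +revert

/-- For each block to which `f` is applied, the terms of `rotIns` for `Φ` and for `lst Φ` telescope
over the rotations. The two boundary terms are the two kinds of terms at the ends: the block comes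
first, or the rotation is trivial. -/
theorem rotIns_add_nrm [AddCommGroup A] {f : List A → A} {ε : ZMod 2} (hf : HasParity f ε)
    {k : Type u} [CommRing k] [Module k A] [Module k E] {Φ : List A → E}
    (hΦ : WordMultilinear k Φ) :
    rotIns f ε Φ + nrm (fun w => splits w fun v c => Φ (f v :: c)) =
      lieOp f ε Φ + rotIns f ε (lst Φ) := by
  ext w
  cases w with
  | nil => simp [rotIns, nrm, lieOp]
  | cons a w =>
    simp only [Pi.add_apply, rotIns, nrm, lieOp]
    have key : ∀ u b r,
        splits r (fun u' v => sgn (par v * (1 + par u + par b + par u') + ε * (par v + 1 + par u)) •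
          Φ (v ++ a :: (u ++ f b :: u'))) +
          sgn ((par b + par r) * (1 + par u)) • Φ (f b :: (r ++ a :: u)) =
        splits r (fun u' v => sgn (par v * (1 + par u + par b + par u') + ε * (par v + 1 + par u)) •
          lst Φ (v ++ a :: (u ++ f b :: u'))) + sgn (ε * (par u + 1)) • Φ
          (a :: (u ++ f b :: r)) := by
      intro u b r
      have h := splits_telescope r
        (F := fun u' v => sgn (par v * (1 + par u + par b + par u') + ε * (par v + 1 + par u)) •
          Φ (v ++ a :: (u ++ f b :: u')))
        (G := fun u' v => sgn (par v * (1 + par u + par b + par u') + ε * (par v + 1 + par u)) •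
          lst Φ (v ++ a :: (u ++ f b :: u'))) fun u' x v => by
        have := lst_concat Φ (v ++ a :: (u ++ f b :: u')) x
        simp only [List.append_assoc, List.cons_append] at this
        simp only [this, sgn_smul_sgn_smul, par_append, par_cons, par_nil, List.cons_append]
        refine sgn_smul_congr rfl fun h0 => ?_
        rw [hf b fun e' => h0 (by simp [e', hΦ.zero_of_mem])]
        generalize par u = x₁, par v = x₂, par u' = x₃, ε = y₁
        decide +revert
      have h' := lst_concat Φ (r ++ a :: u) (f b)
      simp only [List.append_assoc, List.cons_append] at h'
      rw [h', sgn_smul_sgn_smul] at h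
      simp only [List.nil_append, par_nil, zero_mul, zero_add] at h
      rw [add_comm (par u) 1, ← h]
      congr 1
      refine sgn_smul_congr rfl fun h0 => ?_
      rw [hf b fun e' => h0 (by simp [e', hΦ.zero_of_mem])]
      simp only [par_append, par_cons]
      generalize par u = x₁, par r = x₂, ε = y₁
      decide +revert
    have e₁ : splits w (fun u r => splits r fun b v =>
        sgn ((par b + par v) * (1 + par u)) • Φ (f b :: (v ++ a :: u))) =
        splits w fun u r => sgn (par r * (1 + par u)) • splits r fun b v =>
          Φ (f b :: (v ++ a :: u)) := by
      refine splits_congr fun u r => ?_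
      rw [smul_splits]
      refine splits_congr' fun b v h => ?_
      rw [← h, par_append]
    have e₂ := splits_congr (w := w) fun u r => splits_congr (w := r) fun b r' => key u b r'
    simp only [splits_add] at e₂
    rw [e₁] at e₂
    simp only [splits_append_cons, smul_add, splits_add, smul_splits, splits_splits_left,
      par_append] at e₂ ⊢
    simp only [show ∀ x y z : ZMod 2, x * (1 + (y + z)) = x * (1 + y + z) from
      fun x y z => by ring] at e₂ ⊢
    linear_combination (norm := abel) e₂

end Cyclic

section Linearity

variable {k : Type u} {A : Type v} {E : Type w} [CommRing k] [AddCommGroup A] [Module k A]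
  [AddCommGroup E] [Module k E] {Φ Ψ : List A → E} {f g h : List A → A}

theorem zero_lieOp (hΦ : WordMultilinear k Φ) (ε : ZMod 2) : lieOp 0 ε Φ = 0 := by
  ext w
  cases w <;> simp [lieOp, hΦ.zero_of_mem, splits_zero]

theorem add_lieOp (hΦ : WordMultilinear k Φ) (f g : List A → A) (ε : ZMod 2) :
    lieOp (f + g) ε Φ = lieOp f ε Φ + lieOp g ε Φ := by
  ext w
  cases w with
  | nil => simp [lieOp]
  | cons a w =>
    simp only [lieOp, Pi.add_apply, fun c x y => (hΦ.head c).map_add x y,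
      fun u z x y => (hΦ.fix_cons a u z).map_add x y, smul_add, splits_add]
    abel

theorem zsmul_lieOp (hΦ : WordMultilinear k Φ) (c : ℤ) (f : List A → A) (ε : ZMod 2) :
    lieOp (c • f) ε Φ = c • lieOp f ε Φ := by
  ext w
  cases w with
  | nil => simp [lieOp]
  | cons a w =>
    simp only [lieOp, Pi.smul_apply, fun z c x => (hΦ.head z).map_zsmul c x,
      fun u z c x => (hΦ.fix_cons a u z).map_zsmul c x, smul_add, smul_splits, smul_comm c]

theorem zsmul_capOp (hΦ : WordMultilinear k Φ) (g f : List A → A) (ε : ZMod 2) (c : ℤ) :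
    capOp (c • g) f ε Φ = c • capOp g f ε Φ := by
  ext w
  cases w with
  | nil => simp [capOp]
  | cons a w =>
    simp only [capOp, Pi.smul_apply, fun z c x => (hΦ.head z).map_zsmul c x, smul_splits,
      smul_comm c]

theorem zero_capOp (hΦ : WordMultilinear k Φ) (f : List A → A) (ε : ZMod 2) :
    capOp 0 f ε Φ = 0 := by
  simpa using zsmul_capOp hΦ 0 f ε 0

theorem capOp_add_mid (hΦ : WordMultilinear k Φ) (hg : WordMultilinear k g) (f f' : List A → A)
    (ε : ZMod 2) : capOp g (f + f') ε Φ = capOp g f ε Φ + capOp g f' ε Φ := by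
  ext w
  cases w with
  | nil => simp [capOp]
  | cons a w =>
    have e : ∀ z u u' (x y : A), g (z ++ a :: (u ++ (x + y) :: u')) =
        g (z ++ a :: (u ++ x :: u')) + g (z ++ a :: (u ++ y :: u')) := fun z u u' x y => by
      simpa using (hg (z ++ a :: u) u').map_add x y
    simp only [capOp, Pi.add_apply, e, fun z x y => (hΦ.head z).map_add x y, smul_add, splits_add]

theorem capOp_zsmul_mid (hΦ : WordMultilinear k Φ) (hg : WordMultilinear k g) (c : ℤ)
    (f : List A → A) (ε : ZMod 2) : capOp g (c • f) ε Φ = c • capOp g f ε Φ := by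
  ext w
  cases w with
  | nil => simp [capOp]
  | cons a w =>
    have e : ∀ z u u' (c : ℤ) (x : A), g (z ++ a :: (u ++ (c • x) :: u')) =
        c • g (z ++ a :: (u ++ x :: u')) := fun z u u' c x => by
      simpa using (hg (z ++ a :: u) u').map_zsmul c x
    simp only [capOp, Pi.smul_apply, e, fun z c x => (hΦ.head z).map_zsmul c x, smul_splits,
      smul_comm c]

theorem zsmul_rotIns (hΦ : WordMultilinear k Φ) (c : ℤ) (f : List A → A) (ε : ZMod 2) :
    rotIns (c • f) ε Φ = c • rotIns f ε Φ := by
  ext w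
  cases w with
  | nil => simp [rotIns]
  | cons a w =>
    have e : ∀ z u u' (c : ℤ) (x : A), Φ (z ++ a :: (u ++ (c • x) :: u')) =
        c • Φ (z ++ a :: (u ++ x :: u')) := fun z u u' c x => by
      simpa using (hΦ (z ++ a :: u) u').map_zsmul c x
    simp only [rotIns, Pi.smul_apply, e, smul_splits, smul_comm c]

end Linearity

/-! ### The calculus of a word product -/

section Calculus

variable {k : Type u} {A : Type v} {E : Type w} [CommRing k] [AddCommGroup A] [Module k A]
  [AddCommGroup E] [Module k E] {Φ Ψ : List A → E} {f g h m : List A → A} {e : A}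
  {φ γ η : ZMod 2}

/-- The commutator of Lie derivatives: the terms `lieOp2` for disjoint blocks cancel. -/
theorem lieOp_wordBracket (hg : HasParity g γ) (hh : HasParity h η) (hgl : WordMultilinear k g)
    (hhl : WordMultilinear k h) (hΦ : WordMultilinear k Φ) :
    lieOp (wordBracket g γ h η) (γ + η) Φ =
      lieOp h η (lieOp g γ Φ) - sgn (γ * η) • lieOp g γ (lieOp h η Φ) := by
  have i₁ := lieOp_lieOp hg hh hgl hΦ
  have i₂ := lieOp_lieOp hh hg hhl hΦ
  rw [add_comm η γ] at i₂
  rw [i₁, i₂]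
  simp only [wordBracket, add_lieOp hΦ, zsmul_lieOp hΦ]
  match_scalars <;> (generalize γ = x, η = y; decide +revert)

/-- The operation dual to the cap product with `f`, for the product `m`. -/
def wordCap (m f : List A → A) (Φ : List A → E) : List A → E
  | [] => 0
  | a :: w => splits w fun v c => Φ (m [a, f v] :: c)

/-- `dOp e Φ` is the sum of the signed values of `Φ` on the words obtained from the rotations of a
word by putting `e` in front. -/
def dOp (e : A) (Φ : List A → E) : List A → E := nrm fun w => Φ (e :: w)

namespace IsWordProduct

theorem lieOp_lieOp_self (hm : IsWordProduct k m e) (hΦ : WordMultilinear k Φ) :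
    lieOp m 1 (lieOp m 1 Φ) = 0 := by
  have i₁ := lieOp_lieOp hm.hasParity hm.hasParity hm.multilinear hΦ
  rw [i₁, hm.ins_self, zero_lieOp hΦ]
  simp [sgn_one]

/-- A product `m` has only room for `a` and the value of `f`. -/
theorem capOp_eq (hm : IsWordProduct k m e) (hΦ : WordMultilinear k Φ) (f : List A → A)
    (φ : ZMod 2) : capOp m f φ Φ = sgn φ • wordCap m f Φ := by
  ext w
  cases w with
  | nil => simp [capOp, wordCap]
  | cons a w =>
    -- `m` vanishes on words with more than two letters.
    have hz : ∀ u v c, 2 < (u ++ a :: v).length → Φ (m (u ++ a :: v) :: c) = 0 :=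
      fun u v c hl => by rw [hm.eq_zero (by omega), hΦ.zero_of_mem (by simp)]
    simp only [capOp, wordCap, Pi.smul_apply, smul_splits]
    rw [splits_eq_right]
    · refine splits_congr fun v r => ?_
      rw [splits_eq_right, splits_eq_left]
      · simp
      · intro u v hv
        rw [hz, smul_zero]
        have := List.length_pos_iff.2 hv
        simp; omega
      · intro u v hu
        refine (splits_congr fun _ _ => ?_).trans (splits_zero _)
        rw [hz, smul_zero]
        have := List.length_pos_iff.2 hu
        simp; omega
    · intro u v hu
      refine (splits_congr fun _ _ => (splits_congr fun _ _ => (splits_congr fun _ _ => ?_).trans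
        (splits_zero _)).trans (splits_zero _)).trans (splits_zero _)
      rw [hz, smul_zero]
      have := List.length_pos_iff.2 hu
      simp; omega

/-- Functions of words are dual to chains, so the contractions compose in the opposite order. -/
theorem wordCap_wordCup (hm : IsWordProduct k m e) (hΦ : WordMultilinear k Φ)
    (f g : List A → A) :
    wordCap m (wordCup m f g) Φ = wordCap m g (wordCap m f Φ) := by
  ext w
  cases w with
  | nil => rfl
  | cons a w =>
    have e₁ : ∀ x (w : List A) (G : List A → List A → A),
        m [x, splits w G] = splits w fun a b => m [x, G a b] := fun x w G =>
      (hm.multilinear [x] []).map_splits w G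
    have e₂ : ∀ z (w : List A) (G : List A → List A → A),
        Φ (splits w G :: z) = splits w fun a b => Φ (G a b :: z) :=
      fun z w G => (hΦ.head z).map_splits w G
    simp only [wordCap, wordCup, e₁, e₂, hm.assoc, splits_splits_left]

/-- Up to sign, the commutator of the boundary with the contraction by `f` is the contraction by the
differential of `f`. -/
theorem lieOp_capOp_self (hm : IsWordProduct k m e) (hf : HasParity f φ)
    (hfl : WordMultilinear k f) (hΦ : WordMultilinear k Φ) :
    lieOp m 1 (capOp m f φ Φ) + sgn φ • capOp m f φ (lieOp m 1 Φ) =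
      capOp m (wordBracket f φ m 1) (φ + 1) Φ := by
  have i := lieOp_capOp hm.hasParity hm.hasParity hf
    hm.multilinear hm.multilinear hfl hΦ
  rw [hm.ins_self, zero_capOp hΦ, add_comm 1 φ] at i
  simp only [wordBracket, capOp_add_mid hΦ hm.multilinear, capOp_zsmul_mid hΦ hm.multilinear]
  linear_combination (norm := skip) i
  match_scalars <;> (generalize φ = x; decide +revert)

/-- The relation between contractions, Lie derivatives and the bracket holds up to the homotopy
`capOp g f φ`. -/
theorem capOp_wordBracket (hm : IsWordProduct k m e) (hf : HasParity f φ) (hg : HasParity g γ)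
    (hfl : WordMultilinear k f) (hgl : WordMultilinear k g) (hΦ : WordMultilinear k Φ)
    (cf : wordBracket f φ m 1 = 0) (cg : wordBracket g γ m 1 = 0) :
    capOp m (wordBracket f φ g γ) (φ + γ) Φ =
      lieOp g γ (capOp m f φ Φ) - sgn (γ + γ * φ) • capOp m f φ (lieOp g γ Φ) -
      sgn (γ * φ + γ + φ) • (lieOp m 1 (capOp g f φ Φ) -
        sgn (γ + φ) • capOp g f φ (lieOp m 1 Φ)) := by
  have hml := hm.multilinear
  -- The commutators of `lieOp m` with `capOp g f` and of `lieOp g` with `capOp m f`. Their terms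
  -- `nestOp` agree, and those with an insertion into or of `m` cancel since `f` and `g` are closed.
  -- What remains is the contraction with the bracket.
  have i₁ := lieOp_capOp hm.hasParity hg hf hml hgl hfl hΦ
  have i₂ := lieOp_capOp hg hm.hasParity hf hgl hml hfl hΦ
  rw [ins_eq_of_wordBracket_eq_zero cf, ins_eq_of_wordBracket_eq_zero cg, capOp_zsmul_mid hΦ hgl,
      zsmul_capOp hΦ] at i₁
  rw [add_comm γ φ] at i₂
  simp only [wordBracket, capOp_add_mid hΦ hml, capOp_zsmul_mid hΦ hml]
  linear_combination (norm := skip) sgn (γ * φ + γ + φ) • i₁ - i₂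
  match_scalars <;> (generalize φ = x, γ = y; decide +revert)

/-- The boundary of a word that starts with the unit. -/
theorem lieOp_one_cons (hm : IsWordProduct k m e) (hΦ : WordMultilinear k Φ) (a : A)
    (w : List A) :
    lieOp m 1 Φ (e :: a :: w) =
      Φ (a :: w) - lst Φ (a :: w) - ins m 1 (fun w => Φ (e :: w)) (a :: w) := by
  have hz : ∀ w c, w.length ≠ 2 → Φ (m w :: c) = 0 :=
    fun w c hl => by rw [hm.eq_zero hl, hΦ.zero_of_mem (by simp)]
  have e₁ : splits (a :: w) (fun u r => splits r fun v z =>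
      sgn (1 * (par u + 1)) • Φ (e :: (u ++ m v :: z))) =
      -ins m 1 (fun w => Φ (e :: w)) (a :: w) := by
    simp only [ins, neg_splits, neg_sgn_smul, _root_.one_mul]
  have e₂ : splits (a :: w) (fun u r => splits r fun c v =>
      sgn (par v * (1 + par u + par c)) • Φ (m (v ++ e :: u) :: c)) =
      Φ (a :: w) - lst Φ (a :: w) := by
    rw [splits_cons, add_comm, sub_eq_add_neg]
    congr 1
    · rw [splits_eq_right, splits_eq_left]
      · simp [hm.one_mul, sgn_zero]
      · intro u v hv
        rw [hz, smul_zero]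
        have := List.length_pos_iff.2 hv
        simp; omega
      · intro u v hu
        refine (splits_congr fun _ _ => ?_).trans (splits_zero _)
        rw [hz, smul_zero]
        have := List.length_pos_iff.2 hu
        simp; omega
    · obtain ⟨c, x, h⟩ := exists_eq_concat a w
      rw [h, splits_concat, splits_eq_left, lst_concat]
      · rw [hz ([] ++ [e])]
        · simp [hm.mul_one, sgn_add, sgn_one]
        · simp
      · intro u v hv
        rw [hz, smul_zero]
        have := List.length_pos_iff.2 hv
        simp; omega
  rw [lieOp, e₁, e₂]
  abel

/-- Connes' operator anticommutes with the boundary. -/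
theorem lieOp_dOp (hm : IsWordProduct k m e) (hΦ : WordMultilinear k Φ) :
    lieOp m 1 (dOp e Φ) = -dOp e (lieOp m 1 Φ) := by
  rw [dOp, lieOp_nrm hm.hasParity (hΦ.fix_cons e), dOp]
  have : nrm (fun w => lieOp m 1 Φ (e :: w)) =
      nrm (Φ + (-1 : ℤ) • lst Φ + (-1 : ℤ) • ins m 1 fun w => Φ (e :: w)) :=
    nrm_congr fun a w => by
      rw [hm.lieOp_one_cons hΦ]
      simp [sub_eq_add_neg]
  rw [this, nrm_add, nrm_add, nrm_zsmul, nrm_zsmul, nrm_lst]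
  module

/-- The two terms of Connes' operator differ by the cyclic operator. The second one is null
homotopic. -/
theorem dOp_lst (hm : IsWordProduct k m e) (hΦ : WordMultilinear k Φ) :
    dOp e (lst Φ) = lieOp m 1 (nrm fun w => Φ (e :: e :: w)) -
      nrm fun w => lieOp m 1 Φ (e :: e :: w) := by
  rw [lieOp_nrm hm.hasParity ((hΦ.fix_cons e).fix_cons e)]
  have : nrm (fun w => lieOp m 1 Φ (e :: e :: w)) =
      nrm ((-1 : ℤ) • (fun w => lst Φ (e :: w)) + ins m 1 fun w => Φ (e :: e :: w)) :=
    nrm_congr fun a w => by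
      rw [hm.lieOp_one_cons hΦ]
      have h : ins m 1 (fun w => Φ (e :: w)) (e :: a :: w) = Φ (e :: a :: w) -
          ins m 1 (fun w => Φ (e :: e :: w)) (a :: w) := by
        have hz : ∀ w c, w.length ≠ 2 → Φ (e :: m w :: c) = 0 :=
          fun w c hl => by rw [hm.eq_zero hl, hΦ.zero_of_mem (by simp)]
        rw [ins, splits_cons, sub_eq_add_neg, ins, neg_splits]
        congr 1
        · simp only [splits_cons, List.nil_append]
          rw [hz, hz, splits_eq_right]
          · simp [hm.one_mul, sgn_zero]
          · intro u v hu
            rw [hz, smul_zero]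
            have := List.length_pos_iff.2 hu
            simp; omega
          · simp
          · simp
        · simp only [neg_splits, neg_sgn_smul, par_cons, _root_.one_mul, List.cons_append]
      rw [h]
      simp
      abel
  rw [this, nrm_add, nrm_zsmul, dOp]
  module

/-- The norm operator is invariant under rotations, hence the square of `dOp` is null homotopic. -/
theorem dOp_dOp (hm : IsWordProduct k m e) (hΦ : WordMultilinear k Φ) :
    dOp e (dOp e Φ) = lieOp m 1 (nrm fun w => dOp e Φ (e :: e :: w)) +
      nrm fun w => dOp e (lieOp m 1 Φ) (e :: e :: w) := by
  have h : lst (dOp e Φ) = dOp e Φ := lst_nrm _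
  have := hm.dOp_lst (Φ := dOp e Φ) (hΦ.fix_cons e).nrm
  rw [h, hm.lieOp_dOp hΦ] at this
  rw [this]
  have h' : (nrm fun w => (-dOp e (lieOp m 1 Φ)) (e :: e :: w)) =
      (-1 : ℤ) • nrm fun w => dOp e (lieOp m 1 Φ) (e :: e :: w) := by
    rw [← nrm_zsmul]
    congr 1
    ext w
    simp
  rw [h']
  module

/-- The Cartan-Rinehart formula, with the homotopy `rotIns f φ (Φ (e :: ·))`. -/
theorem lieOp_eq (hm : IsWordProduct k m e) (hf : HasParity f φ) (hfl : WordMultilinear k f)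
    (hΦ : WordMultilinear k Φ) (cf : wordBracket f φ m 1 = 0) :
    lieOp f φ Φ = dOp e (wordCap m f Φ) + sgn φ • wordCap m f (dOp e Φ) +
      sgn φ • lieOp m 1 (rotIns f φ fun w => Φ (e :: w)) +
      rotIns f φ fun w => lieOp m 1 Φ (e :: w) := by
  have hΘ := hΦ.fix_cons e
  have i₁ := lieOp_rotIns hm.hasParity hf hm.multilinear hfl hΘ
  have i₂ := rotIns_add_nrm hf hΦ
  have h₁ : (nrm fun w => splits w fun v c => Φ (f v :: c)) = dOp e (wordCap m f Φ) := by
    simp only [dOp, wordCap, hm.one_mul]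
  have h₂ : rotIns f φ (ins m 1 fun w => Φ (e :: w)) =
      rotIns f φ (Φ + (-1 : ℤ) • lst Φ + (-1 : ℤ) • fun w => lieOp m 1 Φ (e :: w)) :=
    rotIns_congr f φ fun a w => by
      simp [hm.lieOp_one_cons hΦ]
      abel
  rw [h₁] at i₂
  rw [ins_eq_of_wordBracket_eq_zero cf, zsmul_rotIns hΘ, h₂, rotIns_add, rotIns_add, rotIns_zsmul,
      rotIns_zsmul,
    hm.capOp_eq hΘ.nrm, ← dOp] at i₁
  linear_combination (norm := skip) -i₂ - sgn φ • i₁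
  match_scalars <;> (generalize φ = x; decide +revert)

end IsWordProduct

end Calculus

/-! ### Multilinear maps as functions of words -/

section Tuples

variable {A : Type v}

theorem exists_ofFn_update {n : ℕ} (a : Fin n → A) (i : Fin n) :
    ∃ u v : List A, ∀ x, List.ofFn (Function.update a i x) = u ++ x :: v := by
  refine ⟨(List.ofFn a).take i, (List.ofFn a).drop (i + 1), fun x => ?_⟩
  refine List.ext_getElem (by simp; omega) fun j h1 h2 => ?_
  rw [List.getElem_ofFn]
  simp only [List.length_ofFn] at h1
  rcases lt_trichotomy j i with h | h | h
  · rw [Function.update_of_ne (by simp [Fin.ext_iff]; omega),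
      List.getElem_append_left (by simp; omega)]
    simp
  · subst h
    rw [List.getElem_append_right (by simp)]
    simp
  · rw [Function.update_of_ne (by simp [Fin.ext_iff]; omega),
      List.getElem_append_right (by simp; omega), List.getElem_cons, dif_neg (by simp; omega)]
    simp only [List.getElem_drop, List.getElem_ofFn]
    congr 1
    ext
    simp
    omega

theorem exists_eq_ofFn {w : List A} {n : ℕ} (h : w.length = n) :
    ∃ a : Fin n → A, w = List.ofFn a := by
  subst h
  exact ⟨fun i => w[i], by simp⟩

end Tuples

section OnWords

variable {k : Type u} {A : Type v} {E : Type w} [CommRing k] [AddCommGroup A] [Module k A]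
  [AddCommGroup E] [Module k E]

/-- A multilinear map as a function of words, zero on words of the wrong length. -/
def MultilinearMap.onWords {n : ℕ} (F : MultilinearMap k (fun _ : Fin n => A) E) (w : List A) : E :=
  if h : w.length = n then F fun i => w[i] else 0

namespace MultilinearMap

variable {n : ℕ} (F G : MultilinearMap k (fun _ : Fin n => A) E)

theorem onWords_ofFn (a : Fin n → A) : F.onWords (List.ofFn a) = F a := by
  simp [onWords]

theorem onWords_of_ne {w : List A} (h : w.length ≠ n) : F.onWords w = 0 := dif_neg h

theorem onWords_add : (F + G).onWords = F.onWords + G.onWords := by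
  ext w
  by_cases h : w.length = n <;> simp [onWords, h]

theorem onWords_smul (c : k) : (c • F).onWords = c • F.onWords := by
  ext w
  by_cases h : w.length = n <;> simp [onWords, h]

theorem onWords_zsmul (c : ℤ) : (c • F).onWords = c • F.onWords := by
  ext w
  by_cases h : w.length = n <;> simp [onWords, h]

theorem onWords_sum {ι : Type*} (s : Finset ι) (F : ι → MultilinearMap k (fun _ : Fin n => A) E)
    (w : List A) : (∑ i ∈ s, F i).onWords w = ∑ i ∈ s, (F i).onWords w := by
  by_cases h : w.length = n <;> simp [onWords, h]

theorem onWords_wordMultilinear : WordMultilinear k F.onWords := fun u v => by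
  by_cases h : n = u.length + (v.length + 1)
  · subst h
    have e : ∀ x, F.onWords (u ++ x :: v) =
        F (Function.update (fun i => (u ++ (0 : A) :: v)[i]'(by simp))
          ⟨u.length, by omega⟩ x) := by
      intro x
      rw [onWords, dif_pos (by simp)]
      congr 1
      ext i
      by_cases hi : i = ⟨u.length, by omega⟩
      · subst hi; simp
      · rw [Function.update_of_ne hi]
        have hi' : (i : ℕ) ≠ u.length := fun h => hi (Fin.ext h)
        simp only [Fin.getElem_fin]
        rcases lt_or_gt_of_ne hi' with h1 | h1
        · rw [List.getElem_append_left h1, List.getElem_append_left h1]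
        · rw [List.getElem_append_right h1.le, List.getElem_append_right h1.le,
            List.getElem_cons, List.getElem_cons, dif_neg (by omega), dif_neg (by omega)]
    exact ⟨fun x y => by simp only [e, F.map_update_add], fun c x => by
      simp only [e, F.map_update_smul]⟩
  · have e : ∀ x, F.onWords (u ++ x :: v) = 0 := fun x => F.onWords_of_ne (by
      simpa using Ne.symm h)
    exact ⟨fun x y => by simp only [e, add_zero], fun c x => by simp only [e, smul_zero]⟩

end MultilinearMap

/-- The multilinear map given by the restriction of a multilinear function of words to the words
of length `n`. -/
def WordMultilinear.toMultilinearMap {Φ : List A → E} (h : WordMultilinear k Φ) (n : ℕ) :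
    MultilinearMap k (fun _ : Fin n => A) E where
  toFun a := Φ (List.ofFn a)
  map_update_add' := by
    intro inst a i x y
    rw [Subsingleton.elim inst (instDecidableEqFin n)]
    obtain ⟨u, v, e⟩ := exists_ofFn_update a i
    rw [e, e, e, (h u v).map_add]
  map_update_smul' := by
    intro inst a i c x
    rw [Subsingleton.elim inst (instDecidableEqFin n)]
    obtain ⟨u, v, e⟩ := exists_ofFn_update a i
    rw [e, e, (h u v).map_smul]

theorem WordMultilinear.toMultilinearMap_apply {Φ : List A → E} (h : WordMultilinear k Φ) {n : ℕ}
    (a : Fin n → A) : h.toMultilinearMap n a = Φ (List.ofFn a) := rfl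

theorem WordMultilinear.onWords_toMultilinearMap {Φ : List A → E} (h : WordMultilinear k Φ)
    {n : ℕ} {w : List A} (hw : w.length = n) : (h.toMultilinearMap n).onWords w = Φ w := by
  obtain ⟨a, rfl⟩ := exists_eq_ofFn hw
  rw [MultilinearMap.onWords_ofFn, h.toMultilinearMap_apply]

/-- The tuple of a partial composition, read as a word. -/
theorem ofFn_substTuple {N M p : ℕ} (h : N + 1 = M + p) (i : Fin M) (φ : A →ₗ[k] A)
    (f : MultilinearMap k (fun _ : Fin p => A) A) {u v z : List A} (hu : u.length = i)
    (hv : v.length = p) (hw : (u ++ (v ++ z)).length = N) :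
    List.ofFn (substTuple h i φ f fun j => (u ++ (v ++ z))[j]) =
      u.map φ ++ f.onWords v :: z.map φ := by
  simp only [List.length_append] at hw
  refine List.ext_getElem (by simp; omega) fun j h1 h2 => ?_
  simp only [List.length_ofFn] at h1
  rw [List.getElem_ofFn, substTuple]
  simp only
  split_ifs with c1 c2
  · rw [List.getElem_append_left (by simp; omega)]
    simp only [List.getElem_map, Fin.getElem_fin]
    rw [List.getElem_append_left (by omega)]
  · have : j = u.length := by rw [hu]; exact congrArg Fin.val c2
    subst this
    rw [List.getElem_append_right (by simp)]
    simp only [List.length_map, Nat.sub_self, List.getElem_cons_zero, MultilinearMap.onWords]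
    rw [dif_pos hv]
    congr 1
    ext l
    simp only [Fin.getElem_fin]
    rw [List.getElem_append_right (by omega), List.getElem_append_left (by omega)]
    congr 1
    omega
  · have c3 : j ≠ i := fun e => c2 (Fin.ext e)
    rw [List.getElem_append_right (by simp; omega), List.getElem_cons, dif_neg (by simp; omega)]
    simp only [List.getElem_map, Fin.getElem_fin]
    rw [List.getElem_append_right (by omega), List.getElem_append_right (by omega)]
    congr 2
    simp
    omega

theorem onWords_substMap {N M p : ℕ} (h : N + 1 = M + p) (i : Fin M) (φ : A →ₗ[k] A)
    (F : MultilinearMap k (fun _ : Fin M => A) E)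
    (f : MultilinearMap k (fun _ : Fin p => A) A) {u v z : List A} (hu : u.length = i)
    (hv : v.length = p) (hw : (u ++ (v ++ z)).length = N) :
    (substMap h i φ F f).onWords (u ++ (v ++ z)) =
      F.onWords (u.map φ ++ f.onWords v :: z.map φ) := by
  rw [← ofFn_substTuple h i φ f hu hv hw, F.onWords_ofFn, MultilinearMap.onWords, dif_pos hw]
  rfl

end OnWords

/-! ### Deconcatenation sums as sums over lengths -/

section SplitsSum

variable {A : Type v} {E : Type w} [AddCommGroup E]

theorem splits_eq_sum (w : List A) (F : List A → List A → E) :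
    splits w F = ∑ i ∈ Finset.range (w.length + 1), F (w.take i) (w.drop i) := by
  induction w generalizing F with
  | nil => simp
  | cons a w ih =>
    rw [splits_cons, ih, List.length_cons, Finset.sum_range_succ' _ (w.length + 1), add_comm]
    simp only [List.take_succ_cons, List.drop_succ_cons, List.take_zero, List.drop_zero]

/-- Only factorizations with a first factor of the given length contribute. -/
theorem splits_eq_single {w : List A} {F : List A → List A → E} (u v : List A) (hw : w = u ++ v)
    (h : ∀ u' v', u'.length ≠ u.length → F u' v' = 0) : splits w F = F u v := by
  subst hw
  rw [splits_eq_sum, Finset.sum_eq_single u.length]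
  · simp
  · intro i hi hne
    refine h _ _ ?_
    simp at hi ⊢
    omega
  · intro hi
    simp at hi

/-- A sum over the factorizations `w = u v z` with `v` of a fixed length, as a sum over the length
of `u`. -/
theorem splits_splits_eq_sum {N M p : ℕ} (h : N + 1 = M + p) {w : List A} (hw : w.length = N)
    {G : List A → List A → List A → E} (hG : ∀ u v z, v.length ≠ p → G u v z = 0)
    {g : Fin M → E} (hg : ∀ (i : Fin M) u v z, w = u ++ (v ++ z) → u.length = i →
      v.length = p → g i = G u v z) :
    splits w (fun u r => splits r fun v z => G u v z) = ∑ i, g i := by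
  rw [splits_eq_sum, hw]
  have h0 : ∀ i ∈ Finset.range (N + 1), i ∉ Finset.range M →
      splits (w.drop i) (fun v z => G (w.take i) v z) = 0 := fun i hi' hi => by
    refine (splits_congr' (G := fun _ _ => 0) fun v z e => hG _ _ _ ?_).trans (splits_zero _)
    have := congrArg List.length e
    simp at this hi hi'
    omega
  rw [← Finset.sum_subset (Finset.range_subset_range.2 (by omega)) h0, Finset.sum_range]
  refine Finset.sum_congr rfl fun i _ => ?_
  rw [splits_eq_single ((w.drop i).take p) ((w.drop i).drop p) (by simp) fun u' v' hl =>
      hG _ _ _ ?_]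
  · refine (hg i _ _ _ (by simp) ?_ ?_).symm <;> simp <;> omega
  · simp at hl
    omega

theorem splits_eq_sum_right (w : List A)
    (F : List A → List A → E) : splits w F =
      ∑ i ∈ Finset.range (w.length + 1), F (w.take (w.length - i)) (w.drop (w.length - i)) := by
  rw [splits_eq_sum, ← Finset.sum_range_reflect]
  rfl

end SplitsSum

/-! ### Untwisting a hom-associative algebra -/

namespace RegularUnitalHomAssocAlgebra

variable {k : Type u} {A : Type v} {E : Type w} [CommRing k] [AddCommGroup A] [Module k A]
  [AddCommGroup E] [Module k E] (H : RegularUnitalHomAssocAlgebra k A)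

/-- The integral powers of the structure map. -/
noncomputable def pow (n : ℤ) : A →ₗ[k] A := (H.αEquiv ^ n : A ≃ₗ[k] A).toLinearMap

theorem pow_add_apply (m n : ℤ) (x : A) : H.pow (m + n) x = H.pow m (H.pow n x) := by
  simp [pow, zpow_add]

theorem pow_zero_apply (x : A) : H.pow 0 x = x := by simp [pow]

theorem pow_one_apply (x : A) : H.pow 1 x = H.α x := by simp [pow, αEquiv]

theorem twist_eq_pow (p : ℕ) : H.twist p = H.pow (p - 1) := rfl

/-- An integral power of the structure map preserves whatever the structure map and its inverse
preserve. -/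
theorem pow_induction {P : (A → A) → Prop} (h0 : P id) (h1 : ∀ φ, P φ → P (H.α ∘ φ))
    (h2 : ∀ φ, P φ → P (H.pow (-1) ∘ φ)) (n : ℤ) : P (H.pow n) := by
  induction n using Int.induction_on with
  | zero => simpa [pow] using h0
  | succ n ih =>
    convert h1 _ ih using 1
    ext x
    rw [add_comm, H.pow_add_apply, H.pow_one_apply]; rfl
  | pred n ih =>
    convert h2 _ ih using 1
    ext x
    rw [sub_eq_add_neg, add_comm, H.pow_add_apply]; rfl

theorem pow_neg_one_α (x : A) : H.pow (-1) (H.α x) = x := by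
  rw [← H.pow_one_apply, ← H.pow_add_apply]; exact H.pow_zero_apply x

theorem α_pow_neg_one (x : A) : H.α (H.pow (-1) x) = x := by
  rw [← H.pow_one_apply, ← H.pow_add_apply]; exact H.pow_zero_apply x

theorem pow_mul (n : ℤ) : ∀ a b, H.pow n (H.mul a b) = H.mul (H.pow n a) (H.pow n b) := by
  refine H.pow_induction (P := fun φ => ∀ a b, φ (H.mul a b) = H.mul (φ a) (φ b))
    (fun _ _ => rfl) (fun φ h a b => by simp [h, H.α_mul]) (fun φ h a b => ?_) n
  simp only [Function.comp, h]
  apply H.regular.1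
  rw [H.α_mul, H.α_pow_neg_one, H.α_pow_neg_one, H.α_pow_neg_one]

theorem pow_one' (n : ℤ) : H.pow n H.one = H.one := by
  refine H.pow_induction (P := fun φ => φ H.one = H.one) rfl (fun φ h => by simp [h, H.α_one])
    (fun φ h => ?_) n
  rw [Function.comp, h]
  conv_lhs => rw [← H.α_one]
  exact H.pow_neg_one_α _

theorem equivariant_pow {f : List A → A} (h : Equivariant H.α f) (n : ℤ) :
    Equivariant (H.pow n) f := by
  refine H.pow_induction (P := fun φ => ∀ v : List A, f (v.map φ) = φ (f v)) (by simp)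
    (fun φ hφ v => ?_) (fun φ hφ v => ?_) n
  · rw [← List.map_map, h, hφ]; rfl
  · rw [← List.map_map]
    apply H.regular.1
    rw [← h, List.map_map, Function.comp_apply, H.α_pow_neg_one, ← hφ]
    congr 1
    refine (List.map_congr_left fun x _ => ?_).trans (List.map_id _)
    exact H.α_pow_neg_one x

/-- The associative product `α⁻¹ (a · b)` obtained by untwisting, as a function of words. -/
noncomputable def wordMul : List A → A
  | [a, b] => H.pow (-1) (H.mul a b)
  | _ => 0

theorem wordMul_pair (a b : A) : H.wordMul [a, b] = H.pow (-1) (H.mul a b) := rfl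

theorem wordMul_eq_onWords (w : List A) :
    H.wordMul w = H.pow (-1) (H.mulCochain.onWords w) := by
  match w with
  | [] | [_] | _ :: _ :: _ :: _ => simp [wordMul, MultilinearMap.onWords]
  | [a, b] => simp [wordMul, MultilinearMap.onWords, mulCochain]

theorem isWordProduct : IsWordProduct k H.wordMul H.one where
  multilinear := by
    have : H.wordMul = fun w => H.pow (-1) (H.mulCochain.onWords w) :=
      funext H.wordMul_eq_onWords
    rw [this]
    exact H.mulCochain.onWords_wordMultilinear.comp_linear _
  arity w hw := by
    rw [wordMul_eq_onWords] at hw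
    by_contra h
    refine hw ?_
    rw [H.mulCochain.onWords_of_ne, map_zero]
    exact_mod_cast h
  assoc a b c := by
    simp only [wordMul_pair, H.pow_mul]
    have := H.hom_assoc (H.pow (-1) (H.pow (-1) a)) (H.pow (-1) (H.pow (-1) b))
      (H.pow (-1) (H.pow (-1) c))
    rwa [H.α_pow_neg_one, H.α_pow_neg_one] at this
  one_mul a := by rw [wordMul_pair, H.one_mul, H.pow_neg_one_α]
  mul_one a := by rw [wordMul_pair, H.mul_one, H.pow_neg_one_α]

theorem equivariant_wordMul : Equivariant H.α H.wordMul := fun w => by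
  match w with
  | [] | [_] | _ :: _ :: _ :: _ => simp [wordMul]
  | [a, b] =>
    simp only [List.map_cons, List.map_nil, wordMul_pair]
    rw [← H.α_mul, H.pow_neg_one_α, H.α_pow_neg_one]

/-- The function of words `α^{1-p} ∘ f` given by a map `f` of arity `p`. In these terms the
operations on Hochschild cochains are those of the untwisted associative algebra. -/
noncomputable def toWord {p : ℕ} (f : MultilinearMap k (fun _ : Fin p => A) A) (w : List A) : A :=
  H.pow (1 - p) (f.onWords w)

section ToWord

variable {p q r : ℕ} (f g : MultilinearMap k (fun _ : Fin p => A) A)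

theorem toWord_add : H.toWord (f + g) = H.toWord f + H.toWord g := by
  ext w; simp [toWord, f.onWords_add]

theorem toWord_smul (c : k) : H.toWord (c • f) = c • H.toWord f := by
  ext w; simp [toWord, f.onWords_smul]

theorem toWord_mulCochain : H.toWord H.mulCochain = H.wordMul := by
  ext w; rw [wordMul_eq_onWords, toWord]; norm_num

theorem toWord_oneCochain : H.toWord H.oneCochain [] = H.one := by
  simp [toWord, MultilinearMap.onWords, oneCochain, H.pow_one']

theorem toWord_of_ne {w : List A} (h : w.length ≠ p) : H.toWord f w = 0 := by
  rw [toWord, f.onWords_of_ne h, map_zero]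

theorem toWord_wordMultilinear : WordMultilinear k (H.toWord f) :=
  f.onWords_wordMultilinear.comp_linear _

theorem toWord_hasArity : HasArity (H.toWord f) p := fun w hw => by
  by_contra h
  exact hw (H.toWord_of_ne f (by exact_mod_cast h))

theorem pow_toWord (w : List A) : H.pow (p - 1) (H.toWord f w) = f.onWords w := by
  rw [toWord, ← H.pow_add_apply, show (p - 1 + (1 - p) : ℤ) = 0 by ring, H.pow_zero_apply]

variable {f g}

theorem mem_cochains_iff : f ∈ H.cochains p ↔ Equivariant H.α f.onWords := by
  constructor
  · intro h w
    by_cases hw : w.length = p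
    · obtain ⟨a, rfl⟩ := exists_eq_ofFn hw
      rw [List.map_ofFn, f.onWords_ofFn, f.onWords_ofFn, h a]
      rfl
    · rw [f.onWords_of_ne hw, f.onWords_of_ne (by simpa using hw), map_zero]
  · intro h a
    have := h (List.ofFn a)
    rw [List.map_ofFn, f.onWords_ofFn, f.onWords_ofFn] at this
    exact this.symm

theorem toWord_equivariant_iff : Equivariant H.α (H.toWord f) ↔ f ∈ H.cochains p := by
  have e : ∀ x, H.α (H.pow (1 - p) x) = H.pow (1 - p) (H.α x) := fun x => by
    rw [← H.pow_one_apply, ← H.pow_one_apply, ← H.pow_add_apply, ← H.pow_add_apply, add_comm]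
  have inj : Function.Injective (H.pow (1 - p)) :=
    (H.αEquiv ^ (1 - (p : ℤ)) : A ≃ₗ[k] A).injective
  rw [mem_cochains_iff]
  refine forall_congr' fun v => ?_
  rw [toWord, toWord, e]
  exact inj.eq_iff

/-- A partial composition at words of the right length, in terms of `toWord`. -/
theorem onWords_substMap_twist {N M : ℕ} (h : N + 1 = M + p) (i : Fin M)
    (F : MultilinearMap k (fun _ : Fin M => A) E) (f : MultilinearMap k (fun _ : Fin p => A) A)
    {u v z : List A} (hu : u.length = i) (hv : v.length = p) (hw : (u ++ (v ++ z)).length = N) :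
    (substMap h i (H.twist p) F f).onWords (u ++ (v ++ z)) =
      F.onWords ((u ++ H.toWord f v :: z).map (H.pow (p - 1))) := by
  rw [onWords_substMap h i _ F f hu hv hw, twist_eq_pow]
  simp [H.pow_toWord]

/-- Partial compositions lose their twist: `α^{1-(p+q-1)}` is `α^{1-p}` composed with `α^{1-q}`,
and the equivariance of `f` moves the powers of `α` into the arguments. -/
theorem toWord_circ (h : r + 1 = p + q) (i : Fin p) (hf : f ∈ H.cochains p)
    (g : MultilinearMap k (fun _ : Fin q => A) A) {u v z : List A} (hu : u.length = i)
    (hv : v.length = q) (hw : (u ++ (v ++ z)).length = r) :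
    H.toWord (H.circ h i f g) (u ++ (v ++ z)) = H.toWord f (u ++ H.toWord g v :: z) := by
  have hf' := H.equivariant_pow (H.mem_cochains_iff.1 hf) (q - 1)
  rw [toWord, circ, H.onWords_substMap_twist h i f g hu hv hw, hf', ← H.pow_add_apply, toWord]
  congr 2
  omega

theorem toWord_sum_circ (h : r + 1 = p + q) (hf : f ∈ H.cochains p)
    (g : MultilinearMap k (fun _ : Fin q => A) A) (ε : ZMod 2) :
    H.toWord (∑ i : Fin p, sgn (ε * (i : ℕ)) • H.circ h i f g) =
      ins (H.toWord g) ε (H.toWord f) := by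
  ext w
  by_cases hw : w.length = r
  · rw [ins, splits_splits_eq_sum h hw (g := fun i : Fin p =>
      sgn (ε * (i : ℕ)) • H.toWord (H.circ h i f g) w)]
    · simp only [toWord, MultilinearMap.onWords_sum, MultilinearMap.onWords_zsmul, map_sum,
        Pi.smul_apply, map_zsmul]
    · intro u v z hv
      rw [H.toWord_of_ne g hv, (H.toWord_wordMultilinear f).zero_of_mem (by simp), smul_zero]
    · intro i u v z hw' hu hv
      subst hw'
      rw [H.toWord_circ h i hf g hu hv hw, par, hu]
  · rw [H.toWord_of_ne _ hw]
    by_contra hne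
    have := (H.toWord_hasArity f).ins (H.toWord_hasArity g) (H.toWord_wordMultilinear f) ε w
      (Ne.symm hne)
    omega

theorem negOnePow_smul {V : Type*} [AddCommGroup V] (n : ℤ) (x : V) :
    n.negOnePow • x = sgn (n : ZMod 2) • x := by
  rcases Int.even_or_odd n with h | h
  · rw [Int.negOnePow_even n h, (ZMod.intCast_zmod_eq_zero_iff_dvd n 2).2 (by
      exact_mod_cast h.two_dvd), sgn_zero, one_smul, one_smul]
  · obtain ⟨j, rfl⟩ := h
    rw [Int.negOnePow_odd _ ⟨j, rfl⟩]
    have : ((2 * j + 1 : ℤ) : ZMod 2) = 1 := by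
      push_cast
      rw [show (2 : ZMod 2) = 0 from rfl]
      ring
    rw [this, sgn_one, Units.smul_def]
    simp

theorem neg_one_pow_smul {V : Type*} [AddCommGroup V] [Module k V] (n : ℕ) (x : V) :
    (-1 : k) ^ n • x = sgn (n : ZMod 2) • x := by
  have := negOnePow_smul n x
  rw [Int.cast_natCast] at this
  rw [← this, Units.smul_def, ← Int.cast_smul_eq_zsmul k]
  simp [Int.negOnePow_def]

theorem toWord_zsmul (c : ℤ) : H.toWord (c • f) = c • H.toWord f := by
  ext w; simp [toWord, f.onWords_zsmul]

theorem toWord_neg : H.toWord (-f) = -H.toWord f := by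
  simpa using H.toWord_zsmul (f := f) (-1)

theorem toWord_sub : H.toWord (f - g) = H.toWord f - H.toWord g := by
  rw [sub_eq_add_neg, toWord_add, toWord_neg, sub_eq_add_neg]

theorem parity_natCast (p : ℕ) : (((p : ℤ) - 1 : ℤ) : ZMod 2) = parity p := rfl

theorem toWord_bracket (h : r + 1 = p + q) (hf : f ∈ H.cochains p)
    {g : MultilinearMap k (fun _ : Fin q => A) A} (hg : g ∈ H.cochains q) :
    H.toWord (H.bracket h f g) = wordBracket (H.toWord f) (parity p) (H.toWord g) (parity q) := by
  have h' : r + 1 = q + p := by omega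
  have e₁ := H.toWord_sum_circ h hf g (parity q)
  have e₂ := H.toWord_sum_circ h' hg f (parity p)
  simp only [bracket, negOnePow_smul, Int.cast_mul, parity_natCast, Int.cast_natCast, toWord_sub,
    toWord_zsmul, e₁, e₂, wordBracket, sgn_add, sgn_one]
  module

theorem mulCochain_mem : H.mulCochain ∈ H.cochains 2 := by
  rw [← toWord_equivariant_iff, toWord_mulCochain]
  exact H.equivariant_wordMul

theorem oneCochain_mem : H.oneCochain ∈ H.cochains 0 := fun _ => by
  simp [oneCochain, H.α_one]

/-- The Hochschild differential, in the sign convention of `coboundary`, is the negative of the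
bracket with the product. -/
theorem toWord_coboundary (hf : f ∈ H.cochains p) :
    H.toWord (H.coboundary p f) =
      -wordBracket (H.toWord f) (parity p) H.wordMul 1 := by
  have e₁ := H.toWord_sum_circ (r := p + 1) (by omega) hf H.mulCochain 1
  have e₂ := H.toWord_sum_circ (r := p + 1) (by omega) H.mulCochain_mem f (parity p)
  rw [Fin.sum_univ_two] at e₂
  have e : H.coboundary p f = sgn (parity p) • (sgn (parity p * (0 : Fin 2).val) •
      H.circ (r := p + 1) (by omega) 0 H.mulCochain f +
      sgn (parity p * (1 : Fin 2).val) • H.circ (r := p + 1) (by omega) 1 H.mulCochain f) -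
      ∑ i : Fin p, sgn (1 * (i : ℕ)) • H.circ (by omega) i f H.mulCochain := by
    have e0 : (((p + 1 : ℕ)) : ZMod 2) = parity p := by
      simp only [parity]; push_cast; generalize (p : ZMod 2) = x; decide +revert
    have e1 : ∀ i : ℕ, sgn ((i + 1 : ℕ) : ZMod 2) = -sgn (1 * (i : ZMod 2)) := fun i => by
      rw [Nat.cast_add, sgn_add]; simp [sgn_one]
    simp only [coboundary, LinearMap.coe_mk, AddHom.coe_mk, neg_one_pow_smul, e0, e1, neg_smul,
      Finset.sum_neg_distrib, sub_eq_add_neg]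
    congr 1
    simp only [Fin.val_zero, Fin.val_one, Nat.cast_zero, Nat.cast_one, _root_.mul_one, mul_zero,
      sgn_zero, one_smul, smul_add, sgn_smul_sgn_smul, CharTwo.add_self_eq_zero]
    abel
  rw [e, toWord_sub, toWord_zsmul, e₁, e₂, toWord_mulCochain, wordBracket, sgn_add]
  simp only [sgn_one, _root_.mul_one]
  module

theorem toWord_circ_one_mulCochain (h : q + 1 = 2 + p) (a : A) (w : List A) :
    H.toWord (H.circ h 1 H.mulCochain f) (a :: w) = H.wordMul [a, H.toWord f w] := by
  obtain rfl : q = p + 1 := by omega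
  by_cases hw : w.length = p
  · have := H.toWord_circ h 1 H.mulCochain_mem f (u := [a]) (v := w) (z := []) rfl hw (by
      simp [hw])
    rw [toWord_mulCochain] at this
    simpa using this
  · rw [H.toWord_of_ne _ (by simpa using hw), H.toWord_of_ne _ hw,
      H.isWordProduct.multilinear.zero_of_mem (by simp)]

theorem circ_one_mulCochain_mem (h : q + 1 = 2 + p) (hf : f ∈ H.cochains p) :
    H.circ h 1 H.mulCochain f ∈ H.cochains q := by
  rw [← toWord_equivariant_iff]
  intro w
  cases w with
  | nil => rw [List.map_nil, H.toWord_of_ne, map_zero]; simp; omega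
  | cons a w =>
    rw [List.map_cons, toWord_circ_one_mulCochain, toWord_circ_one_mulCochain,
      ← H.equivariant_wordMul, H.toWord_equivariant_iff.2 hf]
    rfl

theorem toWord_cup (h : p + q = r) (hf : f ∈ H.cochains p)
    (g : MultilinearMap k (fun _ : Fin q => A) A) :
    H.toWord (H.cup h f g) = wordCup H.wordMul (H.toWord f) (H.toWord g) := by
  have hF := H.circ_one_mulCochain_mem (q := p + 1) (by omega) hf
  have hz : ∀ w : List A, (0 : A) ∈ w → H.wordMul w = 0 := fun w =>
    H.isWordProduct.multilinear.zero_of_mem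
  ext w
  by_cases hw : w.length = r
  · rw [wordCup, splits_eq_single (w.take q) (w.drop q) (by simp), cup,
      ← H.toWord_circ_one_mulCochain (q := p + 1) (by omega)]
    · have := H.toWord_circ (r := r) (by omega) 0 hF g (u := []) (v := w.take q) (z := w.drop q) rfl
        (by simp; omega) (by simpa using hw)
      simpa using this
    · intro u v hu
      rw [H.toWord_of_ne g, hz _ (by simp)]
      simpa [show q ≤ w.length by omega] using hu
  · rw [H.toWord_of_ne _ hw, wordCup]
    refine ((splits_congr' fun u v e => ?_).trans (splits_zero _)).symm
    by_contra hne
    have h1 := H.toWord_hasArity g u fun h => hne (hz _ (by simp [h]))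
    have h2 := H.toWord_hasArity f v fun h => hne (hz _ (by simp [h]))
    have := congrArg List.length e
    simp at this
    omega

end ToWord

end RegularUnitalHomAssocAlgebra

/-! ### Chains of words -/

namespace RegularUnitalHomAssocAlgebra

variable {k : Type u} {A : Type v} {E : Type w} [CommRing k] [AddCommGroup A] [Module k A]
  [AddCommGroup E] [Module k E] (H : RegularUnitalHomAssocAlgebra k A)

/-- The chain `α^{-n} a₀ ⊗ ⋯ ⊗ α^{-n} a_n` given by a word `a₀ ⋯ a_n`. In these terms the
operations on Hochschild chains are those of the untwisted associative algebra. -/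
noncomputable def chainWord (n : ℕ) (w : List A) : H.Chains n :=
  ((H.toChains n).toLinearMap.compMultilinearMap (PiTensorProduct.tprod k)).onWords
    (w.map (H.pow (-n)))

theorem chainWord_of_ne {n : ℕ} {w : List A} (h : w.length ≠ n + 1) : H.chainWord n w = 0 :=
  MultilinearMap.onWords_of_ne _ (by simpa using h)

theorem wordMultilinear_chainWord (n : ℕ) : WordMultilinear k (H.chainWord n) := fun u v => by
  have h := ((H.toChains n).toLinearMap.compMultilinearMap
    (PiTensorProduct.tprod k)).onWords_wordMultilinear (u.map (H.pow (-n))) (v.map (H.pow (-n)))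
  have h' := h.comp' (H.pow (-n)).isLinear
  simpa [chainWord] using h'

theorem chainWord_ofFn {n : ℕ} (a : Fin (n + 1) → A) :
    H.chainWord n (List.ofFn a) =
      H.toChains n (PiTensorProduct.tprod k fun i => H.pow (-n) (a i)) := by
  rw [chainWord, List.map_ofFn, MultilinearMap.onWords_ofFn]
  rfl

theorem chainWord_ofFn_pow {n : ℕ} (a : Fin (n + 1) → A) :
    H.chainWord n (List.ofFn fun i => H.pow n (a i)) =
      H.toChains n (PiTensorProduct.tprod k a) := by
  rw [chainWord_ofFn]
  congr 2
  ext i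
  rw [← H.pow_add_apply, neg_add_cancel, H.pow_zero_apply]

/-- Linear maps on chains agree if they agree on the chains given by words. -/
theorem chains_hom_ext {n : ℕ} {φ ψ : H.Chains n →ₗ[k] E}
    (h : ∀ w : List A, w.length = n + 1 → φ (H.chainWord n w) = ψ (H.chainWord n w)) : φ = ψ := by
  have : φ ∘ₗ (H.toChains n).toLinearMap = ψ ∘ₗ (H.toChains n).toLinearMap := by
    refine PiTensorProduct.ext (MultilinearMap.ext fun a => ?_)
    have := h (List.ofFn fun i => H.pow n (a i)) (by simp)
    rwa [chainWord_ofFn_pow] at this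
  ext x
  exact LinearMap.congr_fun this ((H.toChains n).symm x)

open Classical in
/-- The linear map on chains given by a multilinear function of words; it is zero if the function
is not multilinear. -/
noncomputable def chainLift (n : ℕ) (Φ : List A → E) : H.Chains n →ₗ[k] E :=
  if h : WordMultilinear k Φ then
    PiTensorProduct.lift ((h.toMultilinearMap (n + 1)).compLinearMap fun _ => H.pow n) ∘ₗ
      (H.toChains n).symm.toLinearMap
  else 0

theorem chainLift_chainWord {n : ℕ} {Φ : List A → E} (h : WordMultilinear k Φ) {w : List A}
    (hw : w.length = n + 1) : H.chainLift n Φ (H.chainWord n w) = Φ w := by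
  obtain ⟨a, rfl⟩ := exists_eq_ofFn hw
  rw [chainWord_ofFn]
  simp [chainLift, h, WordMultilinear.toMultilinearMap_apply, ← H.pow_add_apply, H.pow_zero_apply]

variable {n m p : ℕ} {f : MultilinearMap k (fun _ : Fin p => A) A}

/-- Insertion into a chain loses its twist, as for cochains. -/
theorem bullet_chainWord (h : n + 1 = m + p) (i : Fin (m + 1)) (hf : f ∈ H.cochains p)
    {u v z : List A} (hu : u.length = i) (hv : v.length = p)
    (hw : (u ++ (v ++ z)).length = n + 1) :
    H.bullet h i f (H.chainWord n (u ++ (v ++ z))) = H.chainWord m (u ++ H.toWord f v :: z) := by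
  obtain ⟨a, ha⟩ := exists_eq_ofFn hw
  have e : H.bullet h i f (H.chainWord n (u ++ (v ++ z))) = H.toChains m
      ((substMap (show n + 1 + 1 = m + 1 + p by omega) i (H.twist p)
        (PiTensorProduct.tprod k) f).onWords
        ((u ++ (v ++ z)).map (H.pow (-n)))) := by
    rw [ha, chainWord_ofFn, List.map_ofFn, MultilinearMap.onWords_ofFn]
    simp [bullet, Function.comp_def]
  rw [e, List.map_append, List.map_append, H.onWords_substMap_twist _ i _ f (by simpa using hu)
    (by simpa using hv) (by simpa using hw),
    H.equivariant_pow (H.toWord_equivariant_iff.2 hf) (-n)]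
  have e' : u.map (H.pow (-n)) ++ H.pow (-n) (H.toWord f v) :: z.map (H.pow (-n)) =
      (u ++ H.toWord f v :: z).map (H.pow (-n)) := by simp
  rw [e', List.map_map, chainWord]
  have e'' : (H.pow (p - 1) ∘ H.pow (-n) : A → A) = H.pow (-m) := by
    ext x
    rw [Function.comp_apply, ← H.pow_add_apply, show (p - 1 + -n : ℤ) = -m by omega]
  rw [e'']
  by_cases hl : (u ++ H.toWord f v :: z).length = m + 1
  · obtain ⟨b, hb⟩ := exists_eq_ofFn hl
    rw [hb, List.map_ofFn, MultilinearMap.onWords_ofFn, MultilinearMap.onWords_ofFn]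
    rfl
  · rw [MultilinearMap.onWords_of_ne _ (by simpa using hl), MultilinearMap.onWords_of_ne _
      (by simpa using hl), map_zero]

theorem cyc_chainWord (c : List A) (x : A) :
    H.cyc n (H.chainWord n (c ++ [x])) = H.chainWord n (x :: c) := by
  by_cases hc : c.length = n
  · obtain ⟨a, rfl⟩ := exists_eq_ofFn hc
    have e₁ : List.ofFn a ++ [x] = List.ofFn (Fin.snoc a x : Fin (n + 1) → A) := by
      rw [List.ofFn_succ_last]
      simp
    have e₂ : x :: List.ofFn a = List.ofFn (Fin.cons x a : Fin (n + 1) → A) := by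
      rw [List.ofFn_succ]
      simp
    rw [e₁, e₂, chainWord_ofFn, chainWord_ofFn]
    simp only [cyc, LinearEquiv.coe_coe, LinearEquiv.trans_apply, LinearEquiv.symm_apply_apply]
    rw [PiTensorProduct.reindex_tprod]
    congr 2
    ext i
    have := congrFun (Fin.snoc_eq_cons_rotate a x) ((finRotate (n + 1)).symm i)
    rw [this]
    simp
  · rw [H.chainWord_of_ne (by simpa using hc), H.chainWord_of_ne (by simpa using hc), map_zero]

theorem cyc_pow_chainWord (s v : List A) :
    (H.cyc n ^ v.length) (H.chainWord n (s ++ v)) = H.chainWord n (v ++ s) := by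
  induction v using List.reverseRecOn generalizing s with
  | nil => simp
  | append_singleton v x ih =>
    rw [List.length_append, List.length_singleton, pow_succ, Module.End.mul_apply,
      ← List.append_assoc, cyc_chainWord, ← List.cons_append, ih]
    simp

/-- In the first sum of `lie`, `f` is applied to blocks that do not contain the leading letter. In
the second one the cyclic operator first moves a final block `v` of the word to the front, and then
`f` is applied to `v`, the leading letter and the letters after it. -/
theorem lie_chainWord (h : m + p = n + 1) (hf : f ∈ H.cochains p) {w : List A}
    (hw : w.length = n + 1) :
    H.lie h f (H.chainWord n w) =
      sgn (parity p) • lieOp (H.toWord f) (parity p) (H.chainWord m) w := by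
  obtain ⟨a, w, rfl⟩ := List.exists_cons_of_length_eq_add_one hw
  simp only [List.length_cons, Nat.add_right_cancel_iff] at hw
  have hz : ∀ w : List A, (0 : A) ∈ w → H.chainWord m w = 0 := fun w =>
    (H.wordMultilinear_chainWord m).zero_of_mem
  simp only [lie, LinearMap.add_apply, lieOp, smul_add, LinearMap.sum_apply]
  congr 1
  · simp only [smul_splits, sgn_smul_sgn_smul]
    refine (splits_splits_eq_sum (M := m) (p := p) (by omega) hw ?_ ?_).symm
    · intro u v z hv
      rw [H.toWord_of_ne f hv, hz _ (by simp), smul_zero]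
    · intro i u v z hw' hu hv
      subst hw'
      have := H.bullet_chainWord h.symm i.succ hf (u := a :: u) (v := v) (z := z) (by simp [hu]) hv
        (by simpa using hw)
      simp only [List.cons_append] at this
      rw [LinearMap.smul_apply, this, negOnePow_smul, Int.cast_mul, Int.cast_natCast,
        parity_natCast, par, hu]
      congr 2
      generalize parity (p : ℤ) = x, ((i : ℕ) : ZMod 2) = y
      decide +revert
  · rw [← splits_splits_left w fun s u c v => sgn (par v * (1 + par u + par c)) •
      H.chainWord m (H.toWord f (v ++ a :: u) :: c), splits_eq_sum_right, hw,
      ← Finset.sum_subset (Finset.range_subset_range.2 (show p ≤ n + 1 by omega)), Finset.sum_range,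
      Finset.smul_sum]
    · refine Finset.sum_congr rfl fun i _ => ?_
      obtain ⟨s, v, rfl, hs⟩ : ∃ s v, w = s ++ v ∧ s.length = n - i :=
        ⟨w.take (n - i), w.drop (n - i), by simp, by simp; omega⟩
      have hv : v.length = i := by simp at hw; omega
      obtain ⟨u, c, rfl, hu⟩ : ∃ u c, s = u ++ c ∧ u.length = p - 1 - i :=
        ⟨s.take (p - 1 - i), s.drop (p - 1 - i), by simp, by simp; omega⟩
      rw [← hs, List.take_left, List.drop_left, splits_eq_single u c rfl]
      · have h₁ := H.cyc_pow_chainWord (n := n) (a :: (u ++ c)) v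
        have h₂ := H.bullet_chainWord h.symm 0 hf (u := []) (v := v ++ a :: u) (z := c) rfl
          (by simp; omega) (by simp at hw ⊢; omega)
        simp only [List.append_assoc, List.cons_append, List.nil_append] at h₁ h₂
        rw [LinearMap.smul_apply, LinearMap.comp_apply, ← hv, List.append_assoc, h₁, h₂,
          negOnePow_smul, sgn_smul_sgn_smul]
        congr 2
        have e₁ : (n : ZMod 2) = par u + par c + par v := by
          rw [← hw]; simp [par, add_assoc]
        have e₂ : ((v.length : ℕ) : ZMod 2) = par v := rfl
        push_cast
        rw [e₁, e₂, parity]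
        push_cast
        generalize par u = x, par v = y, par c = z, (p : ZMod 2) = t
        decide +revert
      · intro u' c' hu'
        rw [H.toWord_of_ne f, hz _ (by simp), smul_zero]
        simp
        omega
    · intro i hi hi'
      refine (splits_congr fun u c => ?_).trans (splits_zero _)
      rw [H.toWord_of_ne f, hz _ (by simp), smul_zero]
      simp at hi hi' ⊢
      omega

/-- The factor `id - t` gives rise to the two terms: the unit comes first, or second. -/
theorem connesB_chainWord {w : List A} (hw : w.length = n + 1) :
    H.connesB n (H.chainWord n w) = dOp H.one
      (H.chainWord (n + 1) + sgn (n : ZMod 2) • lst (H.chainWord (n + 1))) w := by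
  obtain ⟨a, w, rfl⟩ := List.exists_cons_of_length_eq_add_one hw
  simp only [List.length_cons, Nat.add_right_cancel_iff] at hw
  simp only [connesB, dOp, nrm, LinearMap.sum_apply]
  rw [splits_eq_sum_right, hw, Finset.sum_range]
  refine Finset.sum_congr rfl fun i _ => ?_
  obtain ⟨s, v, rfl, hs⟩ : ∃ s v, w = s ++ v ∧ s.length = n - i :=
    ⟨w.take (n - i), w.drop (n - i), by simp, by simp; omega⟩
  have hv : v.length = i := by simp at hw; omega
  have h₁ := H.cyc_pow_chainWord (n := n) (a :: s) v
  have h₂ := H.bullet_chainWord (n := n) (m := n + 1) (by omega) (Fin.last (n + 1))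
    H.oneCochain_mem (u := v ++ a :: s) (v := []) (z := []) (by simp at hw ⊢; omega) rfl
    (by simp at hw ⊢; omega)
  rw [toWord_oneCochain] at h₂
  obtain ⟨c, x, hc⟩ : ∃ c x, v ++ a :: s = c ++ [x] := by
    rcases List.eq_nil_or_concat' (v ++ a :: s) with h | h
    · simp at h
    · exact h
  have h₃ := H.cyc_chainWord (n := n + 1) (v ++ a :: s) H.one
  have h₄ := H.cyc_chainWord (n := n + 1) (H.one :: c) x
  have h₅ := lst_concat (H.chainWord (n + 1)) (H.one :: c) x
  simp only [List.append_assoc, List.cons_append, List.append_nil] at h₁ h₂ h₃ h₄ h₅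
  rw [← hs, List.take_left, List.drop_left, LinearMap.smul_apply, LinearMap.comp_apply,
    LinearMap.comp_apply, LinearMap.comp_apply, ← hv, h₁, h₂, h₃, LinearMap.sub_apply,
    LinearMap.id_apply, hc, h₄, Pi.add_apply, Pi.smul_apply, h₅, neg_one_pow_smul,
    sgn_smul_sgn_smul]
  have hn : (n : ZMod 2) = par c := by
    have := congrArg List.length hc
    simp at this hw
    rw [par]
    congr 1
    omega
  have hn' : (n : ZMod 2) = par s + par v := by
    rw [← hw]; simp [par]
  have e₂ : ((v.length : ℕ) : ZMod 2) = par v := rfl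
  have e₃ : par c + par (H.one :: c) = 1 := by
    rw [par_cons, ← add_assoc, CharTwo.add_self_eq_zero, zero_add]
  rw [hn, e₃, sgn_one, neg_smul, one_smul, ← sub_eq_add_neg]
  congr 2
  push_cast
  rw [e₂, hn']
  generalize par s = x, par v = y
  decide +revert

end RegularUnitalHomAssocAlgebra

/-! ### Natural operators on functions of words -/

section Natural

variable {k : Type u} {A : Type v} [CommRing k] [AddCommGroup A] [Module k A]

/-- An operator on functions of words with values in arbitrary modules that preserves
multilinearity and is natural in the module of values. -/
structure IsNatural (k : Type u) {A : Type v} [CommRing k] [AddCommGroup A] [Module k A]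
    (X : ∀ {E : Type w} [AddCommGroup E] [Module k E], (List A → E) → List A → E) : Prop where
  multilinear : ∀ {E : Type w} [AddCommGroup E] [Module k E] {Φ : List A → E},
    WordMultilinear k Φ → WordMultilinear k (X Φ)
  map : ∀ {E E' : Type w} [AddCommGroup E] [Module k E] [AddCommGroup E'] [Module k E']
    (φ : E →ₗ[k] E') (Φ : List A → E), X (φ ∘ Φ) = φ ∘ X Φ

/-- A natural operator `X` such that the values of `X Φ` on words of length `N + d` depend only on
the values of `Φ` on words of length `N`. -/
structure IsWordOp (k : Type u) {A : Type v} [CommRing k] [AddCommGroup A] [Module k A]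
    (X : ∀ {E : Type w} [AddCommGroup E] [Module k E], (List A → E) → List A → E) (d : ℤ) : Prop
    extends IsNatural k X where
  congr : ∀ {E : Type w} [AddCommGroup E] [Module k E] {Φ Ψ : List A → E},
    WordMultilinear k Φ → WordMultilinear k Ψ → ∀ {N : ℤ},
    (∀ a w, ((a :: w : List A).length : ℤ) = N → Φ (a :: w) = Ψ (a :: w)) →
    ∀ w, (w.length : ℤ) = N + d → X Φ w = X Ψ w

theorem LinearMap.map_splits {B E E' : Type*} [AddCommGroup E] [Module k E] [AddCommGroup E']
    [Module k E'] (φ : E →ₗ[k] E') (w : List B) (F : List B → List B → E) :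
    φ (splits w F) = splits w fun u v => φ (F u v) :=
  _root_.map_splits φ.toAddMonoidHom w F

theorem IsNatural.map_zero {X : ∀ {E : Type w} [AddCommGroup E] [Module k E],
    (List A → E) → List A → E} (h : IsNatural k X) {E : Type w} [AddCommGroup E] [Module k E] :
    X (0 : List A → E) = 0 := by
  have := h.map (0 : E →ₗ[k] E) 0
  ext w
  have := congrFun this w
  simpa using this

theorem IsNatural.comp {X Y : ∀ {E : Type w} [AddCommGroup E] [Module k E],
    (List A → E) → List A → E} (hX : IsNatural k X) (hY : IsNatural k Y) : IsNatural k (fun Φ => X (Y Φ)) where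
  multilinear hΦ := hX.multilinear (hY.multilinear hΦ)
  map φ Φ := by rw [hY.map, hX.map]

variable {f g m : List A → A} {p : ℤ} {ε : ZMod 2}

theorem isNatural_nrm_cons_cons (e : A) :
    IsNatural.{u, v, w} k (fun Φ => nrm fun w => Φ (e :: e :: w)) where
  multilinear hΦ := ((hΦ.fix_cons e).fix_cons e).nrm
  map φ Φ := by
    ext w
    cases w <;> simp [nrm, LinearMap.map_splits]

theorem isNatural_capOp (hg : WordMultilinear k g) (hf : WordMultilinear k f) :
    IsNatural.{u, v, w} k (fun Φ => capOp g f ε Φ) where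
  multilinear hΦ := hΦ.capOp hg hf ε
  map φ Φ := by
    ext w
    cases w <;> simp [capOp, LinearMap.map_splits]

theorem isNatural_rotIns_cons (hf : WordMultilinear k f) (e : A) :
    IsNatural.{u, v, w} k (fun Φ => rotIns f ε fun w => Φ (e :: w)) where
  multilinear hΦ := (hΦ.fix_cons e).rotIns hf ε
  map φ Φ := by
    ext w
    cases w <;> simp [rotIns, LinearMap.map_splits]

theorem isWordOp_lieOp (hf : HasArity f p) (hfl : WordMultilinear k f) :
    IsWordOp.{u, v, w} k (fun Φ => lieOp f ε Φ) (p - 1) where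
  multilinear hΦ := hΦ.lieOp hfl ε
  map φ Φ := by
    ext w
    cases w <;> simp [lieOp, LinearMap.map_splits]
  congr hΦ hΨ N h w hw := by
    cases w with
    | nil => rfl
    | cons a w =>
      simp only [lieOp]
      congr 1
      · refine splits_congr' fun u r e₁ => splits_congr' fun v z e₂ => ?_
        subst e₂ e₁
        by_cases hv : f v = 0
        · rw [hΦ.zero_of_mem (by simp [hv]), hΨ.zero_of_mem (by simp [hv])]
        · have := hf v hv
          rw [h]
          simp at hw ⊢
          omega
      · refine splits_congr' fun u r e₁ => splits_congr' fun v z e₂ => ?_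
        subst e₂ e₁
        by_cases hv : f (z ++ a :: u) = 0
        · rw [hΦ.zero_of_mem (by simp [hv]), hΨ.zero_of_mem (by simp [hv])]
        · have := hf _ hv
          rw [h]
          simp at hw this ⊢
          omega

theorem isWordOp_wordCap (hm : WordMultilinear k m) (hf : HasArity f p)
    (hfl : WordMultilinear k f) : IsWordOp.{u, v, w} k (fun Φ => wordCap m f Φ) p where
  multilinear {E _ _ Φ} hΦ := by
    rintro (_ | ⟨a₀, u⟩) v
    · simp only [List.nil_append, wordCap]
      exact isLinearMap_splits _ fun b c => hΦ.slot_comp hm [] c [] [f b] fun x => rfl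
    · simp only [List.cons_append, wordCap, splits_append_cons]
      refine .add' (isLinearMap_splits _ fun b c => ?_) (isLinearMap_splits _ fun b c => ?_)
      · exact hΦ.slot (m [a₀, f b] :: c) v fun x => by simp
      · exact hΦ.slot_comp_comp hm hfl [] c [a₀] [] u b fun x => by simp
  map φ Φ := by
    ext w
    cases w <;> simp [wordCap, LinearMap.map_splits]
  congr hΦ hΨ N h w hw := by
    cases w with
    | nil => rfl
    | cons a w =>
      refine splits_congr' fun v c e₁ => ?_
      subst e₁
      by_cases hv : f v = 0
      · have : m [a, f v] = 0 := hm.zero_of_mem (by simp [hv])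
        rw [hΦ.zero_of_mem (by simp [this]), hΨ.zero_of_mem (by simp [this])]
      · have := hf v hv
        rw [h]
        simp at hw ⊢
        omega

theorem isWordOp_dOp (e : A) : IsWordOp.{u, v, w} k (fun Φ => dOp e Φ) (-1) where
  multilinear hΦ := (hΦ.fix_cons e).nrm
  map φ Φ := by
    ext w
    cases w <;> simp [dOp, nrm, LinearMap.map_splits]
  congr hΦ hΨ N h w hw := by
    cases w with
    | nil => rfl
    | cons a w =>
      refine splits_congr' fun v c e₁ => ?_
      subst e₁
      refine congrArg _ (h _ _ ?_)
      simp at hw ⊢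
      omega

end Natural

/-! ### Linearity over the base ring -/

section Smul

variable {k : Type u} {A : Type v} {E : Type w} [CommRing k] [AddCommGroup A] [Module k A]
  [AddCommGroup E] [Module k E] {Φ : List A → E} {f g h m : List A → A} {φ γ ε : ZMod 2}

theorem smul_splits' {B : Type*} (c : k) (w : List B) (F : List B → List B → E) :
    c • splits w F = splits w fun u v => c • F u v :=
  LinearMap.map_splits (LinearMap.lsmul k E c) w F

theorem WordMultilinear.smul (h : WordMultilinear k Φ) (c : k) : WordMultilinear k (c • Φ) :=
  h.comp_linear (LinearMap.lsmul k E c)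

theorem ins_smul {B : Type*} (g : List B → B) (ε : ZMod 2) (c : k) (Φ : List B → E) :
    ins g ε (c • Φ) = c • ins g ε Φ := by
  ext w; simp only [ins, Pi.smul_apply, smul_splits', smul_comm c]

theorem smul_ins (hΦ : WordMultilinear k Φ) (c : k) (g : List A → A) (ε : ZMod 2) :
    ins (c • g) ε Φ = c • ins g ε Φ := by
  ext w
  simp only [ins, Pi.smul_apply, fun u z c x => (hΦ u z).map_smul c x, smul_splits', smul_comm c]

theorem wordBracket_smul (hfl : WordMultilinear k f) (c : k) (g : List A → A) :
    wordBracket f φ (c • g) γ = c • wordBracket f φ g γ := by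
  simp only [wordBracket, ins_smul, smul_ins hfl, smul_add, smul_comm c]

theorem smul_wordBracket (hgl : WordMultilinear k g) (c : k) (f : List A → A) :
    wordBracket (c • f) φ g γ = c • wordBracket f φ g γ := by
  simp only [wordBracket, ins_smul, smul_ins hgl, smul_add, smul_comm c]

theorem wordCup_add (hm : WordMultilinear k m) (f g g' : List A → A) :
    wordCup m f (g + g') = wordCup m f g + wordCup m f g' := by
  ext w
  simp only [wordCup, Pi.add_apply, fun z x y => (hm.head z).map_add x y, splits_add]

theorem wordCup_smul (hm : WordMultilinear k m) (c : k) (f g : List A → A) :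
    wordCup m f (c • g) = c • wordCup m f g := by
  ext w
  simp only [wordCup, Pi.smul_apply, fun z c x => (hm.head z).map_smul c x, smul_splits']

theorem add_wordCup (hm : WordMultilinear k m) (f f' g : List A → A) :
    wordCup m (f + f') g = wordCup m f g + wordCup m f' g := by
  have e : ∀ a x y, m [a, x + y] = m [a, x] + m [a, y] := fun a x y => (hm [a] []).map_add x y
  ext w
  simp only [wordCup, Pi.add_apply, e, splits_add]

theorem smul_wordCup (hm : WordMultilinear k m) (c : k) (f g : List A → A) :
    wordCup m (c • f) g = c • wordCup m f g := by
  have e : ∀ a (c : k) x, m [a, c • x] = c • m [a, x] := fun a c x => (hm [a] []).map_smul c x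
  ext w
  simp only [wordCup, Pi.smul_apply, e, smul_splits']

theorem add_wordCap (hm : WordMultilinear k m) (hΦ : WordMultilinear k Φ) (f f' : List A → A) :
    wordCap m (f + f') Φ = wordCap m f Φ + wordCap m f' Φ := by
  have e : ∀ a x y, m [a, x + y] = m [a, x] + m [a, y] := fun a x y => (hm [a] []).map_add x y
  ext w
  cases w with
  | nil => simp [wordCap]
  | cons a w =>
    simp only [wordCap, Pi.add_apply, e, fun z x y => (hΦ.head z).map_add x y, splits_add]

theorem smul_wordCap (hm : WordMultilinear k m) (hΦ : WordMultilinear k Φ) (c : k)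
    (f : List A → A) : wordCap m (c • f) Φ = c • wordCap m f Φ := by
  have e : ∀ a (c : k) x, m [a, c • x] = c • m [a, x] := fun a c x => (hm [a] []).map_smul c x
  ext w
  cases w with
  | nil => simp [wordCap]
  | cons a w =>
    simp only [wordCap, Pi.smul_apply, e, fun z c x => (hΦ.head z).map_smul c x, smul_splits']

theorem smul_lieOp (hΦ : WordMultilinear k Φ) (c : k) (f : List A → A) (ε : ZMod 2) :
    lieOp (c • f) ε Φ = c • lieOp f ε Φ := by
  ext w
  cases w with
  | nil => simp [lieOp]
  | cons a w =>
    simp only [lieOp, Pi.smul_apply, fun z c x => (hΦ.head z).map_smul c x,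
      fun u z c x => (hΦ.fix_cons a u z).map_smul c x, smul_add, smul_splits', smul_comm c]

end Smul

/-! ### Equivariant word cochains -/

section Cochains

variable {k : Type u} {A : Type v} [CommRing k] [AddCommGroup A] [Module k A]
  {f g h m : List A → A} {e : A} {φ : A →ₗ[k] A} {p q r : ℤ}

/-- `f` is a cochain of arity `p`: it is multilinear, vanishes on words of length other than `p`
and commutes with `φ`. -/
structure IsCochain (φ : A →ₗ[k] A) (p : ℤ) (f : List A → A) : Prop where
  multilinear : WordMultilinear k f
  arity : HasArity f p
  equivariant : Equivariant φ f

theorem parity_add_sub_one (p q : ℤ) : parity (p + q - 1) = parity p + parity q := by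
  simp only [parity]; push_cast; ring

theorem parity_add (p q : ℤ) : parity (p + q) = parity p + parity q + 1 := by
  simp only [parity]; push_cast; ring

theorem parity_sub_one (p : ℤ) : parity (p - 1) = parity p + 1 := by
  simp only [parity]; push_cast; generalize (p : ZMod 2) = x; decide +revert

namespace IsCochain

theorem hasParity (hf : IsCochain φ p f) : HasParity f (parity p) := hf.arity.hasParity

theorem add (hf : IsCochain φ p f) (hg : IsCochain φ p g) : IsCochain φ p (f + g) :=
  ⟨hf.multilinear.add hg.multilinear, hf.arity.add hg.arity, hf.equivariant.add hg.equivariant⟩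

theorem zsmul (hf : IsCochain φ p f) (c : ℤ) : IsCochain φ p (c • f) :=
  ⟨hf.multilinear.zsmul c, hf.arity.zsmul c, hf.equivariant.zsmul c⟩

theorem smul (hf : IsCochain φ p f) (c : k) : IsCochain φ p (c • f) :=
  ⟨hf.multilinear.smul c, fun w hw => hf.arity w fun h => hw (by simp [h]),
    fun v => by simp [hf.equivariant v]⟩

theorem zero : IsCochain φ p (0 : List A → A) :=
  ⟨fun _ _ => ⟨fun _ _ => by simp, fun _ _ => by simp⟩, fun _ h => (h rfl).elim,
    fun _ => by simp⟩

theorem eq_zero (hf : IsCochain φ p f) (hp : p < 0) : f = 0 := by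
  ext w
  by_contra h
  have := hf.arity w h
  omega

theorem ins (hf : IsCochain φ p f) (hg : IsCochain φ q g) (ε : ZMod 2) :
    IsCochain φ (p + q - 1) (ins g ε f) :=
  ⟨hf.multilinear.ins hg.multilinear ε, hf.arity.ins hg.arity hf.multilinear ε,
    hf.equivariant.ins hg.equivariant ε⟩

theorem ins2 (hf : IsCochain φ p f) (hg : IsCochain φ q g) (hh : IsCochain φ r h) (ε η : ZMod 2) :
    IsCochain φ (p + q + r - 2) (ins2 g ε h η f) :=
  ⟨hf.multilinear.ins2 hg.multilinear hh.multilinear ε η,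
    hf.arity.ins2 hg.arity hh.arity hf.multilinear ε η,
    hf.equivariant.ins2 hg.equivariant hh.equivariant ε η⟩

theorem wordBracket (hf : IsCochain φ p f) (hg : IsCochain φ q g) (ε η : ZMod 2) :
    IsCochain φ (p + q - 1) (wordBracket f ε g η) :=
  (hf.ins hg η).add (by simpa only [add_comm q p] using (hg.ins hf ε).zsmul _)

theorem wordCup (hm : IsWordProduct k m e) (hm' : Equivariant φ m) (hf : IsCochain φ p f)
    (hg : IsCochain φ q g) : IsCochain φ (p + q) (wordCup m f g) := by
  rw [hm.wordCup_eq hg.hasParity (parity p)]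
  have := (ins2 ⟨hm.multilinear, hm.arity, hm'⟩ hg hf (parity q) (parity p)).zsmul
    (sgn (parity p * (parity q + 1)))
  rwa [show 2 + q + p - 2 = p + q by ring] at this

end IsCochain

end Cochains

/-! ### Operators on chains in integral degrees -/

namespace RegularUnitalHomAssocAlgebra

variable {k : Type u} {A : Type v} {E : Type w} [CommRing k] [AddCommGroup A] [Module k A]
  [AddCommGroup E] [Module k E] (H : RegularUnitalHomAssocAlgebra k A)

/-- `chainWord`, for all integral degrees; there are no chains of negative degree. -/
noncomputable def chain : ∀ n : ℤ, List A → IntExt H.Chains n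
  | Int.ofNat n => H.chainWord n
  | Int.negSucc _ => 0

/-- `chainLift`, for all integral degrees. -/
noncomputable def lift : ∀ (n : ℤ) (_ : List A → E), IntExt H.Chains n →ₗ[k] E
  | Int.ofNat n, Φ => H.chainLift n Φ
  | Int.negSucc _, _ => 0

theorem wordMultilinear_chain : ∀ n : ℤ, WordMultilinear k (H.chain n)
  | Int.ofNat n => H.wordMultilinear_chainWord n
  | Int.negSucc _ => fun _ _ => ⟨fun _ _ => rfl, fun _ _ => rfl⟩

theorem chain_nil : ∀ n : ℤ, H.chain n [] = 0
  | Int.ofNat n => H.chainWord_of_ne (by simp)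
  | Int.negSucc _ => rfl

theorem chain_of_ne : ∀ {n : ℤ} {w : List A}, (w.length : ℤ) ≠ n + 1 → H.chain n w = 0
  | Int.ofNat n, w, h => H.chainWord_of_ne fun h' => h (by simp [h'])
  | Int.negSucc _, _, _ => rfl

theorem lift_chain : ∀ {n : ℤ} {Φ : List A → E} (_ : WordMultilinear k Φ) {a : A} {w : List A}
    (_ : ((a :: w).length : ℤ) = n + 1), H.lift n Φ (H.chain n (a :: w)) = Φ (a :: w)
  | Int.ofNat n, Φ, h, a, w, hw =>
    H.chainLift_chainWord h (by simp at hw ⊢; omega)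
  | Int.negSucc n, Φ, h, a, w, hw => by
    simp at hw

/-- Words of length `n + 1` generate the chains of degree `n`. The empty word can be
left out: its length is that for degree `-1`, where there are no chains. -/
theorem hom_ext : ∀ {n : ℤ} {φ ψ : IntExt H.Chains n →ₗ[k] E}
    (_ : ∀ a w, ((a :: w : List A).length : ℤ) = n + 1 →
      φ (H.chain n (a :: w)) = ψ (H.chain n (a :: w))), φ = ψ
  | Int.ofNat n, φ, ψ, h => by
    refine H.chains_hom_ext fun w hw => ?_
    obtain ⟨a, w, rfl⟩ := List.exists_cons_of_length_eq_add_one hw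
    exact h a w (by simp at hw ⊢; omega)
  | Int.negSucc n, φ, ψ, h => LinearMap.ext fun x => by
    obtain rfl : x = 0 := Subsingleton.elim (α := PUnit) _ _
    rw [map_zero, map_zero]

theorem lift_congr {n : ℤ} {Φ Ψ : List A → E} (hΦ : WordMultilinear k Φ)
    (hΨ : WordMultilinear k Ψ)
    (h : ∀ a w, ((a :: w : List A).length : ℤ) = n + 1 → Φ (a :: w) = Ψ (a :: w)) :
    H.lift n Φ = H.lift n Ψ :=
  H.hom_ext fun a w hw => by rw [H.lift_chain hΦ hw, H.lift_chain hΨ hw, h a w hw]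

theorem lift_add {n : ℤ} {Φ Ψ : List A → E} (hΦ : WordMultilinear k Φ)
    (hΨ : WordMultilinear k Ψ) : H.lift n (Φ + Ψ) = H.lift n Φ + H.lift n Ψ :=
  H.hom_ext fun a w hw => by
    rw [H.lift_chain (hΦ.add hΨ) hw, LinearMap.add_apply, H.lift_chain hΦ hw, H.lift_chain hΨ hw]
    rfl

theorem lift_smul {n : ℤ} {Φ : List A → E} (hΦ : WordMultilinear k Φ) (c : k) :
    H.lift n (c • Φ) = c • H.lift n Φ :=
  H.hom_ext fun a w hw => by
    rw [H.lift_chain (hΦ.smul c) hw, LinearMap.smul_apply, H.lift_chain hΦ hw]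
    rfl

theorem lift_zsmul {n : ℤ} {Φ : List A → E} (hΦ : WordMultilinear k Φ) (c : ℤ) :
    H.lift n (c • Φ) = c • H.lift n Φ :=
  H.hom_ext fun a w hw => by
    rw [H.lift_chain (hΦ.zsmul c) hw, LinearMap.smul_apply, H.lift_chain hΦ hw]
    rfl

theorem lift_zero {n : ℤ} : H.lift n (0 : List A → E) = 0 := by
  have h : WordMultilinear k (0 : List A → E) := fun _ _ => ⟨fun _ _ => by simp, fun _ _ => by simp⟩
  simpa using H.lift_smul (n := n) h (0 : k)

section Operators

variable {V : Type (max u v)} [AddCommGroup V] [Module k V]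
  {X : ∀ {E : Type (max u v)} [AddCommGroup E] [Module k E], (List A → E) → List A → E} {d : ℤ}

theorem map_lift {E' : Type*} [AddCommGroup E'] [Module k E'] (φ : E →ₗ[k] E') {n : ℤ}
    {Φ : List A → E} (h : WordMultilinear k Φ) (x : IntExt H.Chains n) :
    φ (H.lift n Φ x) = H.lift n (φ ∘ Φ) x := by
  have h' : WordMultilinear k (φ ∘ Φ) := h.comp_linear φ
  have : φ ∘ₗ H.lift n Φ = H.lift n (φ ∘ Φ) := H.hom_ext fun a w hw => by
    rw [LinearMap.comp_apply, H.lift_chain h hw, H.lift_chain h' hw]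
    rfl
  exact LinearMap.congr_fun this x

/-- A function of words that is supported in length `n + 1` factors through the chains. -/
theorem lift_comp_chain {n : ℤ} {Φ : List A → E} (h : WordMultilinear k Φ)
    (hΦ : ∀ w : List A, w = [] ∨ (w.length : ℤ) ≠ n + 1 → Φ w = 0) :
    H.lift n Φ ∘ H.chain n = Φ := by
  ext w
  rw [Function.comp_apply]
  cases w with
  | nil => rw [chain_nil, map_zero, hΦ _ (Or.inl rfl)]
  | cons a w =>
    by_cases hw : ((a :: w).length : ℤ) = n + 1
    · exact H.lift_chain h hw
    · rw [H.chain_of_ne hw, map_zero, hΦ _ (Or.inr hw)]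

/-- The map on chains given by a natural operator on functions of words. -/
noncomputable def op (X : ∀ {E : Type (max u v)} [AddCommGroup E] [Module k E],
    (List A → E) → List A → E) (n m : ℤ) : IntExt H.Chains n →ₗ[k] IntExt H.Chains m :=
  H.lift n (X (H.chain m))

/-- The map on chains given by `X` is dual to `X`. Compositions of maps on chains thus correspond to
compositions of operators on functions in the opposite order. -/
theorem lift_op (hX : IsWordOp k X d) {n m : ℤ} (h : m + d = n) {Φ : List A → V}
    (hΦ : WordMultilinear k Φ) (x : IntExt H.Chains n) :
    H.lift m Φ (H.op X n m x) = H.lift n (X Φ) x := by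
  have hc := H.wordMultilinear_chain m
  have hc' : WordMultilinear k (H.lift m Φ ∘ H.chain m) := hc.comp_linear _
  rw [op, H.map_lift _ (hX.multilinear hc), ← hX.map]
  congr 1
  refine H.lift_congr (hX.multilinear hc') (hX.multilinear hΦ) fun a w hw => ?_
  refine hX.congr hc' hΦ (N := m + 1) (fun b w' hw' => H.lift_chain hΦ hw') _ (by omega)

end Operators

/-- The Hochschild boundary as an operator on functions of words. -/
noncomputable abbrev bnd {E : Type (max u v)} [AddCommGroup E] [Module k E] (Φ : List A → E) :
    List A → E := lieOp H.wordMul 1 Φ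

theorem isWordOp_bnd : IsWordOp.{u, v, max u v} k (fun Φ => H.bnd Φ) 1 :=
  isWordOp_lieOp H.isWordProduct.arity H.isWordProduct.multilinear

theorem lift_comp_chain_bnd (l : ℤ) :
    H.lift (l + 1) (H.bnd (H.chain l)) ∘ H.chain (l + 1) = H.bnd (H.chain l) := by
  have hc := H.wordMultilinear_chain l
  refine H.lift_comp_chain (H.isWordOp_bnd.multilinear hc) ?_
  rintro w (rfl | hw)
  · rfl
  · have h0 : WordMultilinear k (0 : List A → IntExt H.Chains l) := fun _ _ =>
      ⟨fun _ _ => by simp, fun _ _ => by simp⟩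
    have := H.isWordOp_bnd.congr hc h0 (N := w.length - 1) (fun a w' hw' => by
      rw [H.chain_of_ne (by omega)]; rfl) w (by omega)
    rw [this, H.isWordOp_bnd.map_zero]
    rfl

/-- The Hochschild boundary, for all integral degrees. -/
noncomputable def boundaryZ (n m : ℤ) : IntExt H.Chains n →ₗ[k] IntExt H.Chains m :=
  H.op (fun Φ => H.bnd Φ) n m

/-- Hochschild cycles, for all integral degrees. -/
noncomputable def cyclesZ (n : ℤ) : Submodule k (IntExt H.Chains n) :=
  LinearMap.ker (H.boundaryZ n (n - 1))

theorem mem_cyclesZ_iff {n m : ℤ} (h : m + 1 = n) {x : IntExt H.Chains n} :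
    x ∈ H.cyclesZ n ↔ H.boundaryZ n m x = 0 := by
  obtain rfl : m = n - 1 := by omega
  rfl

/-- Functions of words of the form `bnd Φ` vanish on cycles. -/
theorem lift_bnd_of_mem {n : ℤ} {x : IntExt H.Chains n} (hx : x ∈ H.cyclesZ n)
    {V : Type (max u v)} [AddCommGroup V] [Module k V] {Φ : List A → V}
    (hΦ : WordMultilinear k Φ) : H.lift n (H.bnd Φ) x = 0 := by
  rw [← H.lift_op H.isWordOp_bnd (m := n - 1) (by omega) hΦ]
  exact (congrArg _ hx).trans (map_zero _)

/-- A natural operator evaluated at a boundary of words is a boundary of chains. -/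
theorem op_boundaryZ {X : ∀ {E : Type (max u v)} [AddCommGroup E] [Module k E],
    (List A → E) → List A → E} (hX : IsNatural k X) {n l : ℤ} (x : IntExt H.Chains n) :
    H.lift n (X (H.bnd (H.chain l))) x = H.boundaryZ (l + 1) l (H.op X n (l + 1) x) := by
  rw [boundaryZ, op, op, H.map_lift _ (hX.multilinear (H.wordMultilinear_chain _)), ← hX.map,
    lift_comp_chain_bnd]

/-- Chains given by two natural operators are homologous at every cycle if the operators differ by
a homotopy. -/
theorem exists_boundaryZ_eq {T : ∀ {E : Type (max u v)} [AddCommGroup E] [Module k E],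
    (List A → E) → List A → E} (hT : IsNatural k T) {n l : ℤ} {x : IntExt H.Chains n}
    (hx : x ∈ H.cyclesZ n) {Φ Φ' Θ : List A → IntExt H.Chains l} (hΦ' : WordMultilinear k Φ')
    (hΘ : WordMultilinear k Θ) (c c' : ℤ)
    (h : Φ = Φ' + c • H.bnd Θ + c' • T (H.bnd (H.chain l))) :
    ∃ y, H.lift n Φ x = H.lift n Φ' x + H.boundaryZ (l + 1) l y := by
  have hb := H.isWordOp_bnd.multilinear hΘ
  have hT' := hT.multilinear (H.isWordOp_bnd.multilinear (H.wordMultilinear_chain l))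
  refine ⟨c' • H.op T n (l + 1) x, ?_⟩
  rw [h, H.lift_add (hΦ'.add (hb.zsmul c)) (hT'.zsmul c'), H.lift_add hΦ' (hb.zsmul c),
    H.lift_zsmul hb, H.lift_zsmul hT', LinearMap.add_apply, LinearMap.add_apply,
    LinearMap.smul_apply, LinearMap.smul_apply, H.lift_bnd_of_mem hx hΘ, H.op_boundaryZ hT,
    smul_zero, add_zero, map_zsmul]

end RegularUnitalHomAssocAlgebra

/-! ### Cycles and cocycles -/

namespace RegularUnitalHomAssocAlgebra

variable {k : Type u} {A : Type v} [CommRing k] [AddCommGroup A] [Module k A]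
  (H : RegularUnitalHomAssocAlgebra k A)

/-- The boundary is the Lie derivative along the product, up to sign. -/
theorem boundary_eq_neg_lie (n : ℕ) :
    H.boundary n = -H.lie (show n + 2 = (n + 1) + 1 by omega) H.mulCochain := by
  have e₁ : ∀ i : Fin n, (-1 : k) ^ ((i.succ : Fin (n + 1)) : ℕ) •
      H.bullet (p := 2) (n := n + 1) (m := n) (by omega) i.succ H.mulCochain =
      -(((((2 : ℕ) : ℤ) - 1) * ((i : ℕ) : ℤ)).negOnePow •
        H.bullet (p := 2) (n := n + 1) (m := n) (by omega) i.succ H.mulCochain) := fun i => by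
    rw [neg_one_pow_smul, negOnePow_smul, ← neg_smul]
    congr 1
    push_cast
    rw [Fin.val_succ]
    push_cast
    rw [_root_.one_mul]
    generalize ((i : ℕ) : ZMod 2) = x
    revert x; decide
  rw [boundary, lie, Fin.sum_univ_succ, Fin.sum_univ_two, eq_neg_iff_add_eq_zero]
  simp only [e₁]
  simp only [Finset.sum_neg_distrib]
  -- The two terms of the second sum of `lie` are the one with the cyclic operator and `μ •₀ x`.
  have e2 : ∀ x : H.Chains (n + 1) →ₗ[k] H.Chains n,
      ((((n + 1 : ℕ) : ℤ) * (((1 : Fin 2) : ℕ) : ℤ) + ((2 : ℕ) : ℤ) - 1).negOnePow • x) =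
      -((-1 : k) ^ (n + 1) • x) := fun x => by
    rw [neg_one_pow_smul, negOnePow_smul, ← neg_smul]
    congr 1
    push_cast
    generalize (n : ZMod 2) = x
    revert x; decide
  have e3 : ∀ x : H.Chains (n + 1) →ₗ[k] H.Chains n,
      ((((n + 1 : ℕ) : ℤ) * (((0 : Fin 2) : ℕ) : ℤ) + ((2 : ℕ) : ℤ) - 1).negOnePow • x) =
      -x := fun x => by
    rw [negOnePow_smul, ← neg_one_smul ℤ]
    congr 1
  rw [e2, e3]
  simp only [Fin.val_zero, Fin.val_one, pow_zero, pow_one, one_smul, LinearMap.comp_id,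
    Module.End.one_eq_id]
  abel

theorem boundaryZ_natCast (n : ℕ) :
    H.boundaryZ (Int.ofNat (n + 1)) (Int.ofNat n) = H.boundary n := by
  refine H.hom_ext fun a w hw => ?_
  have hw' : (a :: w).length = n + 1 + 1 := by simp at hw ⊢; omega
  have h := H.lie_chainWord (show n + 2 = (n + 1) + 1 by omega) H.mulCochain_mem hw'
  rw [boundaryZ, op, H.lift_chain (H.isWordOp_bnd.multilinear (H.wordMultilinear_chain _)) hw,
    boundary_eq_neg_lie]
  change _ = -(H.lie _ H.mulCochain (H.chainWord (n + 1) (a :: w)))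
  rw [h, toWord_mulCochain, show parity ((2 : ℕ) : ℤ) = 1 from rfl, sgn_one, neg_one_smul, neg_neg]
  rfl

theorem boundaryZ_boundaryZ {n m l : ℤ} (h : m + 1 = n) (x : IntExt H.Chains n) :
    H.boundaryZ m l (H.boundaryZ n m x) = 0 := by
  have hc := H.wordMultilinear_chain l
  rw [boundaryZ, boundaryZ, op, H.lift_op H.isWordOp_bnd h (H.isWordOp_bnd.multilinear hc),
    show H.bnd (H.bnd (H.chain l)) = 0 from H.isWordProduct.lieOp_lieOp_self hc, lift_zero,
    LinearMap.zero_apply]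

theorem boundaryZ_mem (n : ℤ) (y : IntExt H.Chains (n + 1)) :
    H.boundaryZ (n + 1) n y ∈ H.cyclesZ n :=
  H.boundaryZ_boundaryZ rfl y

theorem mem_cyclesZ_natCast : ∀ (n : ℕ) (x : H.Chains n),
    x ∈ H.cycles n ↔ (show IntExt H.Chains (Int.ofNat n) from x) ∈ H.cyclesZ (Int.ofNat n)
  | 0, x => ⟨fun _ => (H.mem_cyclesZ_iff (n := Int.ofNat 0) (m := Int.negSucc 0) rfl).2
      (Subsingleton.elim (α := PUnit) _ _), fun _ => trivial⟩
  | n + 1, x => by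
    refine Iff.trans ?_ (H.mem_cyclesZ_iff (n := Int.ofNat (n + 1)) (m := Int.ofNat n) rfl).symm
    rw [boundaryZ_natCast]
    rfl

theorem boundaries_le_cycles (n : ℕ) : H.boundaries n ≤ H.cycles n := by
  rintro _ ⟨y, rfl⟩
  rw [mem_cyclesZ_natCast, ← boundaryZ_natCast]
  exact H.boundaryZ_mem (Int.ofNat n) y

/-- The homology class of a cycle, for all integral degrees. -/
noncomputable def homologyClassZ : ∀ n : ℤ, H.cyclesZ n →ₗ[k] IntExt H.Homology n
  | Int.ofNat n => H.homologyClass n ∘ₗ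
      (Submodule.inclusion (fun x hx => (H.mem_cyclesZ_natCast n x).2 hx) :
        (H.cyclesZ (Int.ofNat n) : Submodule k (H.Chains n)) →ₗ[k] H.cycles n)
  | Int.negSucc _ => 0

theorem homologyClassZ_natCast {n : ℕ} (x : H.cycles n) :
    H.homologyClassZ n ⟨x.1, (H.mem_cyclesZ_natCast n x.1).1 x.2⟩ =
      IntExt.of k H.Homology n (H.homologyClass n x) := rfl

theorem homologyClassZ_surjective : ∀ n : ℤ, Function.Surjective (H.homologyClassZ n)
  | Int.ofNat n => fun y => by
    obtain ⟨x, hx⟩ := Submodule.mkQ_surjective _ y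
    exact ⟨⟨x.1, (H.mem_cyclesZ_natCast n x.1).1 x.2⟩, hx⟩
  | Int.negSucc _ => fun y => ⟨0, Subsingleton.elim (α := PUnit) _ _⟩

theorem homologyClassZ_eq_zero_iff : ∀ {n : ℤ} (x : H.cyclesZ n),
    H.homologyClassZ n x = 0 ↔ ∃ y, x.1 = H.boundaryZ (n + 1) n y
  | Int.ofNat n, x => by
    have h := Submodule.Quotient.mk_eq_zero ((H.boundaries n).submoduleOf (H.cycles n))
      (x := ⟨x.1, (H.mem_cyclesZ_natCast n x.1).2 x.2⟩)
    refine h.trans ⟨fun ⟨y, hy⟩ => ⟨y, ?_⟩, fun ⟨y, hy⟩ => ⟨y, ?_⟩⟩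
    · exact hy.symm.trans (LinearMap.congr_fun (H.boundaryZ_natCast n) y).symm
    · exact (hy.trans (LinearMap.congr_fun (H.boundaryZ_natCast n) y)).symm
  | Int.negSucc n, x =>
    ⟨fun _ => ⟨0, Subsingleton.elim (α := PUnit) _ _⟩, fun _ => Subsingleton.elim (α := PUnit) _ _⟩

section Cocycles

variable {p : ℕ}

theorem toWord_injective {f g : MultilinearMap k (fun _ : Fin p => A) A}
    (h : H.toWord f = H.toWord g) : f = g := by
  ext a
  rw [← f.onWords_ofFn, ← g.onWords_ofFn, ← pow_toWord, ← pow_toWord, h]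

theorem toWord_zero : H.toWord (0 : MultilinearMap k (fun _ : Fin p => A) A) = 0 := by
  simpa using H.toWord_smul (f := (0 : MultilinearMap k (fun _ : Fin p => A) A)) 0

theorem zero_wordBracket (ε η : ZMod 2) : wordBracket 0 ε H.wordMul η = 0 := by
  simpa using zsmul_wordBracket (φ := ε) (γ := η) H.isWordProduct.multilinear 0 (0 : List A → A)

theorem isCochain_toWord {f : MultilinearMap k (fun _ : Fin p => A) A} (hf : f ∈ H.cochains p) :
    IsCochain H.α p (H.toWord f) :=
  ⟨H.toWord_wordMultilinear f, H.toWord_hasArity f, H.toWord_equivariant_iff.2 hf⟩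

/-- Every cochain of the untwisted algebra that commutes with `α` comes from a cochain of `A`. -/
theorem exists_toWord_eq {f : List A → A} (hf : IsCochain H.α p f) :
    ∃ F ∈ H.cochains p, H.toWord F = f := by
  have h : WordMultilinear k fun w => H.pow (p - 1) (f w) := hf.multilinear.comp_linear _
  have e : H.toWord (h.toMultilinearMap p) = f := by
    ext w
    by_cases hw : w.length = p
    · rw [toWord, h.onWords_toMultilinearMap hw, ← H.pow_add_apply,
        show (1 - p + (p - 1) : ℤ) = 0 by ring, H.pow_zero_apply]
    · rw [H.toWord_of_ne _ hw]
      by_contra hne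
      exact hw (by exact_mod_cast hf.arity w (Ne.symm hne))
  exact ⟨_, H.toWord_equivariant_iff.1 (by rw [e]; exact hf.equivariant), e⟩

/-- The cocycles of arity `p` of the untwisted algebra that commute with the structure map. -/
def wordCocycles (p : ℤ) : Submodule k (List A → A) where
  carrier := {f | IsCochain H.α p f ∧ wordBracket f (parity p) H.wordMul 1 = 0}
  add_mem' hf hg := ⟨hf.1.add hg.1, by
    rw [add_wordBracket H.isWordProduct.multilinear, hf.2, hg.2, add_zero]⟩
  zero_mem' := ⟨.zero, H.zero_wordBracket _ _⟩
  smul_mem' c f hf := ⟨hf.1.smul c, by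
    rw [smul_wordBracket H.isWordProduct.multilinear, hf.2, smul_zero]⟩

theorem toWord_mem_wordCocycles {f : MultilinearMap k (fun _ : Fin p => A) A} :
    H.toWord f ∈ H.wordCocycles p ↔ f ∈ H.cocycles p := by
  constructor
  · intro h
    have hf := H.toWord_equivariant_iff.1 h.1.equivariant
    refine ⟨hf, H.toWord_injective ?_⟩
    rw [H.toWord_coboundary hf, h.2, neg_zero, toWord_zero]
  · intro h
    refine ⟨H.isCochain_toWord h.1, ?_⟩
    have := H.toWord_coboundary h.1
    rw [show H.coboundary p f = 0 from h.2] at this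
    rw [toWord_zero] at this
    exact neg_eq_zero.1 this.symm

theorem isCochain_wordMul : IsCochain H.α 2 H.wordMul :=
  ⟨H.isWordProduct.multilinear, H.isWordProduct.arity, H.equivariant_wordMul⟩

theorem wordBracket_mem_wordCocycles {p q : ℤ} (h : p + 1 = q) {g : List A → A}
    (hg : IsCochain H.α p g) :
    wordBracket g (parity p) H.wordMul 1 ∈ H.wordCocycles q := by
  subst h
  have := hg.wordBracket H.isCochain_wordMul (parity p) 1
  refine ⟨by rwa [show p + 2 - 1 = p + 1 by ring] at this, ?_⟩
  have e : parity (p + 1) = parity p + 1 := by rw [parity_add]; simp [parity]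
  rw [e, H.isWordProduct.bracket_bracket_self hg.hasParity hg.multilinear]

theorem coboundaries_le_cocycles : ∀ n : ℕ, H.coboundaries n ≤ H.cocycles n
  | 0 => bot_le
  | n + 1 => by
    rintro _ ⟨f, hf, rfl⟩
    rw [← toWord_mem_wordCocycles, H.toWord_coboundary hf]
    exact neg_mem (H.wordBracket_mem_wordCocycles (by simp) (H.isCochain_toWord hf))

/-- Cocycles of `A` are cocycles of the untwisted algebra that commute with the structure map. -/
noncomputable def cocyclesEquiv (p : ℕ) : H.cocycles p ≃ₗ[k] H.wordCocycles p :=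
  LinearEquiv.ofBijective
    { toFun := fun f => ⟨H.toWord f.1, H.toWord_mem_wordCocycles.2 f.2⟩
      map_add' := fun f g => Subtype.ext (H.toWord_add f.1 g.1)
      map_smul' := fun c f => Subtype.ext (H.toWord_smul f.1 c) }
    ⟨fun f g h => Subtype.ext (H.toWord_injective (congrArg Subtype.val h)), fun f => by
      obtain ⟨F, hF, e⟩ := H.exists_toWord_eq f.2.1
      exact ⟨⟨F, H.toWord_mem_wordCocycles.1 (e ▸ f.2)⟩, Subtype.ext e⟩⟩

/-- The cohomology class of a cocycle of the untwisted algebra. -/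
noncomputable def cohomologyClassZ : ∀ p : ℤ, H.wordCocycles p →ₗ[k] IntExt H.Cohomology p
  | Int.ofNat p => H.cohomologyClass p ∘ₗ (H.cocyclesEquiv p).symm.toLinearMap
  | Int.negSucc _ => 0

theorem cohomologyClassZ_natCast (f : H.cocycles p) :
    H.cohomologyClassZ p ⟨H.toWord f.1, H.toWord_mem_wordCocycles.2 f.2⟩ =
      IntExt.of k H.Cohomology p (H.cohomologyClass p f) :=
  congrArg (H.cohomologyClass p) ((H.cocyclesEquiv p).symm_apply_apply f)

theorem cohomologyClassZ_surjective : ∀ p : ℤ, Function.Surjective (H.cohomologyClassZ p)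
  | Int.ofNat p => fun y => by
    obtain ⟨f, hf⟩ := Submodule.mkQ_surjective _ y
    exact ⟨_, (H.cohomologyClassZ_natCast f).trans hf⟩
  | Int.negSucc _ => fun y => ⟨0, Subsingleton.elim (α := PUnit) _ _⟩

/-- Cochains of arity `-1` vanish, so the statement includes the cases `p ≤ 0`. -/
theorem cohomologyClassZ_eq_zero_iff : ∀ {p q : ℤ} (_ : q + 1 = p) (f : H.wordCocycles p),
    H.cohomologyClassZ p f = 0 ↔
      ∃ g, IsCochain H.α q g ∧ f.1 = wordBracket g (parity q) H.wordMul 1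
  | Int.ofNat p, q, hq, f => by
    obtain ⟨F, rfl⟩ := (H.cocyclesEquiv p).surjective f
    have h := Submodule.Quotient.mk_eq_zero ((H.coboundaries p).submoduleOf (H.cocycles p)) (x := F)
    rw [show H.cohomologyClassZ (Int.ofNat p) (H.cocyclesEquiv p F) = _ from
      H.cohomologyClassZ_natCast F]
    refine h.trans ?_
    change F.1 ∈ H.coboundaries p ↔ ∃ g, IsCochain H.α q g ∧ H.toWord F.1 = _
    cases p with
    | zero =>
      constructor
      · intro h
        have h0 : F.1 = 0 := h
        exact ⟨0, .zero, by rw [h0, toWord_zero, H.zero_wordBracket]⟩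
      · rintro ⟨g, hg, e⟩
        have : g = 0 := hg.eq_zero (by simp at hq; omega)
        refine H.toWord_injective ?_
        rw [e, this, toWord_zero, H.zero_wordBracket]
    | succ p =>
      obtain rfl : q = p := by simp at hq; omega
      constructor
      · rintro ⟨G, hG, e⟩
        refine ⟨H.toWord (-G), H.isCochain_toWord (neg_mem hG), ?_⟩
        rw [← e, H.toWord_coboundary hG, toWord_neg]
        simpa using (zsmul_wordBracket H.isWordProduct.multilinear (-1) (H.toWord G)).symm
      · rintro ⟨g, hg, e⟩
        obtain ⟨G, hG, rfl⟩ := H.exists_toWord_eq hg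
        refine ⟨-G, neg_mem hG, H.toWord_injective ?_⟩
        rw [map_neg, toWord_neg, H.toWord_coboundary hG, e, neg_neg]
  | Int.negSucc p, q, hq, f =>
    ⟨fun _ => ⟨0, .zero, by rw [H.zero_wordBracket]; exact f.2.1.eq_zero (Int.negSucc_lt_zero p)⟩,
      fun _ => Subsingleton.elim (α := PUnit) _ _⟩

end Cocycles

end RegularUnitalHomAssocAlgebra

/-! ### Factorization of bilinear maps through quotients -/

section Descend

variable {k : Type u} [CommRing k] {M M' Q Q' N : Type*} [AddCommGroup M] [Module k M]
  [AddCommGroup M'] [Module k M'] [AddCommGroup Q] [Module k Q] [AddCommGroup Q'] [Module k Q']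
  [AddCommGroup N] [Module k N]

/-- The factorization of a linear map through a surjection whose kernel it kills. -/
noncomputable def LinearMap.descend (a : M →ₗ[k] Q) (ha : Function.Surjective a) (β : M →ₗ[k] N)
    (h : ∀ x, a x = 0 → β x = 0) : Q →ₗ[k] N :=
  (LinearMap.ker a).liftQ β (fun x hx => h x (LinearMap.mem_ker.1 hx)) ∘ₗ
    (a.quotKerEquivOfSurjective ha).symm.toLinearMap

theorem LinearMap.descend_apply (a : M →ₗ[k] Q) (ha : Function.Surjective a) (β : M →ₗ[k] N)
    (h : ∀ x, a x = 0 → β x = 0) (x : M) : a.descend ha β h (a x) = β x := by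
  have : (a.quotKerEquivOfSurjective ha).symm (a x) = Submodule.Quotient.mk x := by
    rw [LinearEquiv.symm_apply_eq]; rfl
  rw [descend, LinearMap.comp_apply, LinearEquiv.coe_coe, this]
  exact Submodule.liftQ_apply _ _ _

/-- The factorization of a bilinear map through two surjections whose kernels it kills. -/
noncomputable def LinearMap.descend₂ (a : M →ₗ[k] Q) (ha : Function.Surjective a)
    (b : M' →ₗ[k] Q') (hb : Function.Surjective b) (β : M →ₗ[k] M' →ₗ[k] N)
    (h : ∀ x y, a x = 0 → β x y = 0) (h' : ∀ x y, b y = 0 → β x y = 0) : Q →ₗ[k] Q' →ₗ[k] N :=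
  a.descend ha
    { toFun := fun x => b.descend hb (β x) (h' x)
      map_add' := fun x x' => LinearMap.ext fun y => by
        obtain ⟨y, rfl⟩ := hb y
        simp only [LinearMap.add_apply, LinearMap.descend_apply, map_add]
      map_smul' := fun c x => LinearMap.ext fun y => by
        obtain ⟨y, rfl⟩ := hb y
        simp only [LinearMap.smul_apply, LinearMap.descend_apply, map_smul, RingHom.id_apply] }
    fun x hx => LinearMap.ext fun y => by
      obtain ⟨y, rfl⟩ := hb y
      simp only [LinearMap.coe_mk, AddHom.coe_mk, LinearMap.descend_apply, h x y hx,
        LinearMap.zero_apply]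

theorem LinearMap.descend₂_apply (a : M →ₗ[k] Q) (ha : Function.Surjective a)
    (b : M' →ₗ[k] Q') (hb : Function.Surjective b) (β : M →ₗ[k] M' →ₗ[k] N)
    (h : ∀ x y, a x = 0 → β x y = 0) (h' : ∀ x y, b y = 0 → β x y = 0) (x : M) (y : M') :
    a.descend₂ ha b hb β h h' (a x) (b y) = β x y := by
  rw [descend₂, descend_apply]
  exact b.descend_apply hb (β x) (h' x) y

end Descend

/-! ### Operations on cohomology -/

namespace RegularUnitalHomAssocAlgebra

variable {k : Type u} {A : Type v} [CommRing k] [AddCommGroup A] [Module k A]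
  (H : RegularUnitalHomAssocAlgebra k A)

section Cohomology

variable {p q r : ℤ} {f g h : List A → A}

theorem cohomologyClassZ_congr {f g : H.wordCocycles p} (hq : q + 1 = p) {x : List A → A}
    (hx : IsCochain H.α q x) (e : f.1 = g.1 + wordBracket x (parity q) H.wordMul 1) :
    H.cohomologyClassZ p f = H.cohomologyClassZ p g := by
  refine sub_eq_zero.1 ((map_sub (H.cohomologyClassZ p) f g).symm.trans ?_)
  refine (H.cohomologyClassZ_eq_zero_iff hq _).2 ⟨x, hx, ?_⟩
  rw [AddSubgroupClass.coe_sub, e, add_sub_cancel_left]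

theorem wordCup_mem (hr : p + q = r) (hf : f ∈ H.wordCocycles p) (hg : g ∈ H.wordCocycles q) :
    wordCup H.wordMul f g ∈ H.wordCocycles r := by
  subst hr
  have hm := H.isWordProduct
  refine ⟨.wordCup hm H.equivariant_wordMul hf.1 hg.1, ?_⟩
  rw [parity_add, hm.wordBracket_wordCup_self hf.1.hasParity hg.1.hasParity
    hg.1.multilinear, hf.2, hg.2]
  have h1 := wordCup_smul hm.multilinear 0 f 0
  have h2 := smul_wordCup hm.multilinear 0 0 g
  simp only [zero_smul] at h1 h2
  rw [h1, h2, smul_zero, add_zero]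

theorem wordBracket_mem (hr : p + q - 1 = r) (hf : f ∈ H.wordCocycles p)
    (hg : g ∈ H.wordCocycles q) :
    wordBracket f (parity p) g (parity q) ∈ H.wordCocycles r := by
  subst hr
  have hm := H.isWordProduct
  refine ⟨hf.1.wordBracket hg.1 _ _, ?_⟩
  have := wordBracket_jacobi hf.1.hasParity hg.1.hasParity hm.hasParity hf.1.multilinear
    hg.1.multilinear hm.multilinear
  have h1 := wordBracket_smul (φ := parity p) (γ := parity q + 1) hf.1.multilinear 0 0
  have h2 := wordBracket_smul (φ := parity q) (γ := parity p + 1) hg.1.multilinear 0 0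
  simp only [zero_smul] at h1 h2
  rw [hf.2, hg.2, h1, h2, smul_zero, add_zero] at this
  rw [parity_add_sub_one, ← this]

/-- The cup product on cohomology. -/
noncomputable def cohomologyCup (hr : p + q = r) :
    IntExt H.Cohomology p →ₗ[k] IntExt H.Cohomology q →ₗ[k] IntExt H.Cohomology r :=
  (H.cohomologyClassZ p).descend₂ (H.cohomologyClassZ_surjective p) (H.cohomologyClassZ q)
    (H.cohomologyClassZ_surjective q)
    (LinearMap.mk₂ k (fun f g => H.cohomologyClassZ r ⟨_, H.wordCup_mem hr f.2 g.2⟩)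
      (fun f f' g => by
        rw [← map_add]; congr 1
        exact Subtype.ext (add_wordCup H.isWordProduct.multilinear f.1 f'.1 g.1))
      (fun c f g => by
        rw [← map_smul]; congr 1
        exact Subtype.ext (smul_wordCup H.isWordProduct.multilinear c f.1 g.1))
      (fun f g g' => by
        rw [← map_add]; congr 1
        exact Subtype.ext (wordCup_add H.isWordProduct.multilinear f.1 g.1 g'.1))
      (fun c f g => by
        rw [← map_smul]; congr 1
        exact Subtype.ext (wordCup_smul H.isWordProduct.multilinear c f.1 g.1)))
    (fun f g hf => by
      have hm := H.isWordProduct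
      subst hr
      obtain ⟨x, hx, e⟩ := (H.cohomologyClassZ_eq_zero_iff (sub_add_cancel p 1) f).1 hf
      refine (H.cohomologyClassZ_eq_zero_iff (sub_add_cancel (p + q) 1) _).2
        ⟨sgn (parity q + 1) • wordCup H.wordMul x g.1, ?_, ?_⟩
      · have := (IsCochain.wordCup hm H.equivariant_wordMul hx g.2.1).zsmul (sgn (parity q + 1))
        rwa [show p - 1 + q = p + q - 1 by ring] at this
      · have i := hm.wordBracket_wordCup_self hx.hasParity g.2.1.hasParity
          g.2.1.multilinear
        have h1 := wordCup_smul hm.multilinear 0 x 0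
        simp only [zero_smul] at h1
        rw [g.2.2, h1, zero_add, ← e] at i
        rw [zsmul_wordBracket hm.multilinear, show parity (p + q - 1) =
          parity (p - 1) + parity q + 1 by rw [parity_sub_one, parity_add, parity_sub_one]; ring, i,
          sgn_smul_sgn_smul, CharTwo.add_self_eq_zero, sgn_zero, one_smul])
    (fun f g hg => by
      have hm := H.isWordProduct
      subst hr
      obtain ⟨x, hx, e⟩ := (H.cohomologyClassZ_eq_zero_iff (sub_add_cancel q 1) g).1 hg
      refine (H.cohomologyClassZ_eq_zero_iff (sub_add_cancel (p + q) 1) _).2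
        ⟨wordCup H.wordMul f.1 x, ?_, ?_⟩
      · have := IsCochain.wordCup hm H.equivariant_wordMul f.2.1 hx
        rwa [show p + (q - 1) = p + q - 1 by ring] at this
      · have i := hm.wordBracket_wordCup_self f.2.1.hasParity hx.hasParity
          hx.multilinear
        have h1 := smul_wordCup hm.multilinear 0 0 x
        simp only [zero_smul] at h1
        rw [f.2.2, h1, smul_zero, add_zero, ← e] at i
        rw [show parity (p + q - 1) =
          parity p + parity (q - 1) + 1 by rw [parity_sub_one, parity_add, parity_sub_one]; ring,
            i])

theorem cohomologyCup_apply (hr : p + q = r) (f : H.wordCocycles p) (g : H.wordCocycles q) :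
    H.cohomologyCup hr (H.cohomologyClassZ p f) (H.cohomologyClassZ q g) =
      H.cohomologyClassZ r ⟨_, H.wordCup_mem hr f.2 g.2⟩ :=
  LinearMap.descend₂_apply _ _ _ _ _ _ _ _ _

/-- The bracket of a cochain and a coboundary. -/
theorem wordBracket_exact (hr : p + q - 1 = r) (hf : f ∈ H.wordCocycles p) {x : List A → A}
    (hx : IsCochain H.α (q - 1) x) :
    wordBracket f (parity p) (wordBracket x (parity (q - 1)) H.wordMul 1) (parity q) =
      wordBracket (wordBracket f (parity p) x (parity (q - 1))) (parity (r - 1)) H.wordMul 1 := by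
  have hm := H.isWordProduct
  have := wordBracket_jacobi hf.1.hasParity hx.hasParity hm.hasParity hf.1.multilinear
    hx.multilinear hm.multilinear
  have h2 := wordBracket_smul (φ := parity (q - 1)) (γ := parity p + 1) hx.multilinear 0 0
  simp only [zero_smul] at h2
  rw [hf.2, h2, smul_zero, add_zero] at this
  subst hr
  rw [parity_sub_one (p + q - 1), parity_add_sub_one, parity_sub_one] at *
  rw [add_assoc, CharTwo.add_self_eq_zero, add_zero] at this
  rw [this, add_assoc]

/-- The Gerstenhaber bracket on cohomology. -/
noncomputable def cohomologyBracket (hr : p + q - 1 = r) :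
    IntExt H.Cohomology p →ₗ[k] IntExt H.Cohomology q →ₗ[k] IntExt H.Cohomology r :=
  (H.cohomologyClassZ p).descend₂ (H.cohomologyClassZ_surjective p) (H.cohomologyClassZ q)
    (H.cohomologyClassZ_surjective q)
    (LinearMap.mk₂ k (fun f g => H.cohomologyClassZ r ⟨_, H.wordBracket_mem hr f.2 g.2⟩)
      (fun f f' g => by
        rw [← map_add]; congr 1
        exact Subtype.ext (add_wordBracket g.2.1.multilinear f.1 f'.1))
      (fun c f g => by
        rw [← map_smul]; congr 1
        exact Subtype.ext (smul_wordBracket g.2.1.multilinear c f.1))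
      (fun f g g' => by
        rw [← map_add]; congr 1
        exact Subtype.ext (wordBracket_add f.2.1.multilinear g.1 g'.1))
      (fun c f g => by
        rw [← map_smul]; congr 1
        exact Subtype.ext (wordBracket_smul f.2.1.multilinear c g.1)))
    (fun f g hf => by
      obtain ⟨x, hx, e⟩ := (H.cohomologyClassZ_eq_zero_iff (sub_add_cancel p 1) f).1 hf
      refine (H.cohomologyClassZ_eq_zero_iff (sub_add_cancel r 1) _).2
        ⟨-(sgn (parity p * parity q) • wordBracket g.1 (parity q) x (parity (p - 1))), ?_, ?_⟩
      · have := ((g.2.1.wordBracket hx (parity q) (parity (p - 1))).zsmul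
          (-sgn (parity p * parity q)))
        rwa [show q + (p - 1) - 1 = r - 1 by omega, neg_smul] at this
      · have i := H.wordBracket_exact (show q + p - 1 = r by omega) g.2 hx
        have i' := wordBracket_skew (f := f.1) (φ := parity p) (g := g.1) (γ := parity q)
        rw [← e] at i
        have i'' := zsmul_wordBracket (φ := parity (r - 1)) (γ := 1) H.isWordProduct.multilinear
          (-sgn (parity p * parity q)) (wordBracket g.1 (parity q) x (parity (p - 1)))
        rw [← i] at i''
        dsimp only
        rw [i', ← neg_smul, ← i'', neg_smul])
    (fun f g hg => by
      obtain ⟨x, hx, e⟩ := (H.cohomologyClassZ_eq_zero_iff (sub_add_cancel q 1) g).1 hg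
      refine (H.cohomologyClassZ_eq_zero_iff (sub_add_cancel r 1) _).2
        ⟨wordBracket f.1 (parity p) x (parity (q - 1)), ?_, ?_⟩
      · have := f.2.1.wordBracket hx (parity p) (parity (q - 1))
        rwa [show p + (q - 1) - 1 = r - 1 by omega] at this
      · rw [← H.wordBracket_exact hr f.2 hx, ← e])

theorem cohomologyBracket_apply (hr : p + q - 1 = r) (f : H.wordCocycles p)
    (g : H.wordCocycles q) :
    H.cohomologyBracket hr (H.cohomologyClassZ p f) (H.cohomologyClassZ q g) =
      H.cohomologyClassZ r ⟨_, H.wordBracket_mem hr f.2 g.2⟩ :=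
  LinearMap.descend₂_apply _ _ _ _ _ _ _ _ _

end Cohomology

end RegularUnitalHomAssocAlgebra

/-! ### Operations on homology -/

namespace RegularUnitalHomAssocAlgebra

variable {k : Type u} {A : Type v} [CommRing k] [AddCommGroup A] [Module k A]
  (H : RegularUnitalHomAssocAlgebra k A)

/-- An operator of degree `d` on functions of words that commutes with the Hochschild boundary up
to a sign. -/
structure IsChainOp (X : ∀ {E : Type (max u v)} [AddCommGroup E] [Module k E],
    (List A → E) → List A → E) (d : ℤ) : Prop extends IsWordOp.{u, v, max u v} k X d where
  bnd : ∃ c : ZMod 2, ∀ {E : Type (max u v)} [AddCommGroup E] [Module k E] {Φ : List A → E},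
    WordMultilinear k Φ → X (H.bnd Φ) = sgn c • H.bnd (X Φ)

theorem homologyClassZ_congr {n : ℤ} {x y : H.cyclesZ n}
    (h : ∃ z, x.1 = y.1 + H.boundaryZ (n + 1) n z) :
    H.homologyClassZ n x = H.homologyClassZ n y := by
  refine sub_eq_zero.1 ((map_sub (H.homologyClassZ n) x y).symm.trans ?_)
  obtain ⟨z, hz⟩ := h
  refine (H.homologyClassZ_eq_zero_iff _).2 ⟨z, ?_⟩
  rw [AddSubgroupClass.coe_sub, hz, add_sub_cancel_left]

section Operators

variable {X : ∀ {E : Type (max u v)} [AddCommGroup E] [Module k E], (List A → E) → List A → E}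
  {d n m : ℤ}

variable {H} in
theorem IsChainOp.op_mem (hX : H.IsChainOp X d) (h : m + d = n) {x : IntExt H.Chains n}
    (hx : x ∈ H.cyclesZ n) : H.op X n m x ∈ H.cyclesZ m := by
  obtain ⟨c, hc⟩ := hX.bnd
  have hm := H.wordMultilinear_chain (m - 1)
  have hm' := hX.multilinear hm
  refine (H.mem_cyclesZ_iff (sub_add_cancel m 1)).2 ?_
  rw [boundaryZ, op, H.lift_op hX.toIsWordOp h (H.isWordOp_bnd.multilinear hm), hc hm,
    H.lift_zsmul (H.isWordOp_bnd.multilinear hm'), LinearMap.smul_apply,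
    H.lift_bnd_of_mem hx hm', smul_zero]

variable {H} in
theorem IsChainOp.op_boundaryZ (hX : H.IsChainOp X d) (y : IntExt H.Chains (n + 1)) :
    ∃ z, H.op X n m (H.boundaryZ (n + 1) n y) = H.boundaryZ (m + 1) m z := by
  obtain ⟨c, hc⟩ := hX.bnd
  have hm := H.wordMultilinear_chain m
  have hm' := hX.multilinear hm
  refine ⟨sgn c • H.op X (n + 1) (m + 1) y, ?_⟩
  have e : H.bnd (X (H.chain m)) = sgn c • X (H.bnd (H.chain m)) := by
    rw [hc hm, sgn_smul_sgn_smul, CharTwo.add_self_eq_zero, sgn_zero, one_smul]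
  rw [boundaryZ, op, H.lift_op H.isWordOp_bnd rfl hm', e,
    H.lift_zsmul (hX.multilinear (H.isWordOp_bnd.multilinear hm)), LinearMap.smul_apply,
    H.op_boundaryZ hX.toIsNatural, map_zsmul]

/-- The map on homology given by an operator on functions of words. -/
noncomputable def homologyOp (hX : H.IsChainOp X d) (h : m + d = n) :
    IntExt H.Homology n →ₗ[k] IntExt H.Homology m :=
  (H.homologyClassZ n).descend (H.homologyClassZ_surjective n)
    (H.homologyClassZ m ∘ₗ (H.op X n m).restrict fun _ hx => hX.op_mem h hx) fun x hx => by
      obtain ⟨y, hy⟩ := (H.homologyClassZ_eq_zero_iff x).1 hx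
      obtain ⟨z, hz⟩ := hX.op_boundaryZ y
      exact (H.homologyClassZ_eq_zero_iff _).2 ⟨z, (congrArg _ hy).trans hz⟩

theorem homologyOp_apply (hX : H.IsChainOp X d) (h : m + d = n) (x : H.cyclesZ n) :
    H.homologyOp hX h (H.homologyClassZ n x) =
      H.homologyClassZ m ⟨H.op X n m x.1, hX.op_mem h x.2⟩ :=
  LinearMap.descend_apply _ _ _ _ _

end Operators

section Action

variable {p d n m : ℤ} {X : (List A → A) →
  ∀ {E : Type (max u v)} [AddCommGroup E] [Module k E], (List A → E) → List A → E}

/-- The bilinear map from cohomology and homology to homology given by a family of operators on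
functions of words that is indexed by cocycles, is linear in the cocycle, and sends coboundaries to
operators that are null homotopic. -/
noncomputable def homologyAction (hX : ∀ f ∈ H.wordCocycles p, H.IsChainOp (X f) d)
    (h : m + d = n)
    (hadd : ∀ f g, X (f + g) (H.chain m) = X f (H.chain m) + X g (H.chain m))
    (hsmul : ∀ (c : k) f, X (c • f) (H.chain m) = c • X f (H.chain m))
    (hexact : ∀ g, IsCochain H.α (p - 1) g → ∀ x ∈ H.cyclesZ n, ∃ y,
      H.op (X (wordBracket g (parity (p - 1)) H.wordMul 1)) n m x = H.boundaryZ (m + 1) m y) :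
    IntExt H.Cohomology p →ₗ[k] IntExt H.Homology n →ₗ[k] IntExt H.Homology m :=
  (H.cohomologyClassZ p).descend (H.cohomologyClassZ_surjective p)
    { toFun := fun f => H.homologyOp (hX f.1 f.2) h
      map_add' := fun f g => LinearMap.ext fun x => by
        obtain ⟨x, rfl⟩ := H.homologyClassZ_surjective n x
        rw [LinearMap.add_apply, homologyOp_apply, homologyOp_apply, homologyOp_apply, ← map_add]
        refine congrArg (H.homologyClassZ m) (Subtype.ext ?_)
        have := H.lift_add (n := n)
          ((hX f.1 f.2).multilinear (H.wordMultilinear_chain m))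
          ((hX g.1 g.2).multilinear (H.wordMultilinear_chain m))
        rw [← hadd] at this
        exact LinearMap.congr_fun this x.1
      map_smul' := fun c f => LinearMap.ext fun x => by
        obtain ⟨x, rfl⟩ := H.homologyClassZ_surjective n x
        rw [LinearMap.smul_apply, homologyOp_apply, homologyOp_apply, ← map_smul]
        refine congrArg (H.homologyClassZ m) (Subtype.ext ?_)
        have := H.lift_smul (n := n)
          ((hX f.1 f.2).multilinear (H.wordMultilinear_chain m)) c
        rw [← hsmul] at this
        exact LinearMap.congr_fun this x.1 }
    fun f hf => LinearMap.ext fun x => by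
      obtain ⟨x, rfl⟩ := H.homologyClassZ_surjective n x
      obtain ⟨g, hg, e⟩ := (H.cohomologyClassZ_eq_zero_iff (sub_add_cancel p 1) f).1 hf
      obtain ⟨y, hy⟩ := hexact g hg x.1 x.2
      rw [← e] at hy
      rw [LinearMap.zero_apply]
      refine (H.homologyOp_apply (hX f.1 f.2) h x).trans ?_
      exact (H.homologyClassZ_eq_zero_iff _).2 ⟨y, hy⟩

theorem homologyAction_apply (hX : ∀ f ∈ H.wordCocycles p, H.IsChainOp (X f) d) (h : m + d = n)
    (hadd hsmul hexact) (f : H.wordCocycles p) (x : H.cyclesZ n) :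
    H.homologyAction hX h hadd hsmul hexact (H.cohomologyClassZ p f) (H.homologyClassZ n x) =
      H.homologyClassZ m ⟨H.op (X f.1) n m x.1, (hX f.1 f.2).op_mem h x.2⟩ := by
  rw [homologyAction, LinearMap.descend_apply]
  exact H.homologyOp_apply (hX f.1 f.2) h x

end Action

section Cap

variable {p n m : ℤ} {f : List A → A}

theorem isChainOp_wordCap (hf : f ∈ H.wordCocycles p) :
    H.IsChainOp (fun Φ => wordCap H.wordMul f Φ) p where
  toIsWordOp := isWordOp_wordCap H.isWordProduct.multilinear hf.1.arity hf.1.multilinear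
  bnd := ⟨parity p + 1, fun {E _ _ Φ} hΦ => by
    have hm := H.isWordProduct
    have h := hm.lieOp_capOp_self hf.1.hasParity hf.1.multilinear hΦ
    have h0 : capOp H.wordMul 0 (parity p + 1) Φ = 0 := by
      simpa using capOp_zsmul_mid hΦ hm.multilinear 0 0 (parity p + 1)
    rw [hf.2, h0, hm.capOp_eq hΦ, lieOp_zsmul,
      hm.capOp_eq (hΦ.lieOp hm.multilinear 1), sgn_smul_sgn_smul, CharTwo.add_self_eq_zero,
      sgn_zero, one_smul] at h
    rw [← neg_sgn_smul]
    exact eq_neg_of_add_eq_zero_right h⟩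

/-- The cap product on homology. -/
noncomputable def homologyCap (h : n - p = m) :
    IntExt H.Cohomology p →ₗ[k] IntExt H.Homology n →ₗ[k] IntExt H.Homology m :=
  H.homologyAction (X := fun f _ _ _ Φ => wordCap H.wordMul f Φ) (d := p)
    (fun _ hf => H.isChainOp_wordCap hf) (by omega)
    (add_wordCap H.isWordProduct.multilinear (H.wordMultilinear_chain m))
    (smul_wordCap H.isWordProduct.multilinear (H.wordMultilinear_chain m))
    (fun g hg x hx => by
      have hm := H.isWordProduct
      have hc := H.wordMultilinear_chain m
      obtain ⟨y, hy⟩ := H.exists_boundaryZ_eq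
        (isNatural_capOp (ε := parity (p - 1)) hm.multilinear hg.multilinear) hx (Φ' := 0)
        (fun _ _ => ⟨fun _ _ => by simp, fun _ _ => by simp⟩)
        (hc.capOp hm.multilinear hg.multilinear (parity (p - 1))) (sgn (parity (p - 1) + 1)) (sgn 1)
        (Φ := wordCap H.wordMul (wordBracket g (parity (p - 1)) H.wordMul 1) (H.chain m)) (by
          have e := hm.lieOp_capOp_self hg.hasParity hg.multilinear hc
          rw [hm.capOp_eq hc (wordBracket _ _ _ _)] at e
          linear_combination (norm := skip) (-sgn (parity (p - 1) + 1)) • e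
          match_scalars <;> (generalize parity (p - 1) = x; decide +revert))
      refine ⟨y, hy.trans ?_⟩
      rw [lift_zero, LinearMap.zero_apply, zero_add])

theorem homologyCap_apply (h : n - p = m) (f : H.wordCocycles p) (x : H.cyclesZ n) :
    H.homologyCap h (H.cohomologyClassZ p f) (H.homologyClassZ n x) =
      H.homologyClassZ m ⟨H.op (fun Φ => wordCap H.wordMul f.1 Φ) n m x.1,
        (H.isChainOp_wordCap f.2).op_mem (by omega) x.2⟩ :=
  H.homologyAction_apply _ _ _ _ _ f x

end Cap

section Lie

variable {p n m : ℤ} {f : List A → A}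

theorem isChainOp_lieOp (hf : f ∈ H.wordCocycles p) :
    H.IsChainOp (fun Φ => lieOp f (parity p) Φ) (p - 1) where
  toIsWordOp := isWordOp_lieOp hf.1.arity hf.1.multilinear
  bnd := ⟨parity p, fun {E _ _ Φ} hΦ => by
    have hm := H.isWordProduct
    have h := lieOp_wordBracket hf.1.hasParity hm.hasParity hf.1.multilinear hm.multilinear hΦ
    rw [hf.2, zero_lieOp hΦ, _root_.mul_one] at h
    rw [bnd, bnd, sub_eq_zero.1 h.symm, sgn_smul_sgn_smul, CharTwo.add_self_eq_zero, sgn_zero,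
      one_smul]⟩

/-- The Lie derivative on homology. -/
noncomputable def homologyLie (h : n - p + 1 = m) :
    IntExt H.Cohomology p →ₗ[k] IntExt H.Homology n →ₗ[k] IntExt H.Homology m :=
  sgn (parity p) • H.homologyAction (X := fun f _ _ _ Φ => lieOp f (parity p) Φ) (d := p - 1)
    (fun _ hf => H.isChainOp_lieOp hf) (by omega)
    (fun f g => add_lieOp (H.wordMultilinear_chain m) f g (parity p))
    (fun c f => smul_lieOp (H.wordMultilinear_chain m) c f (parity p))
    (fun g hg x hx => by
      have hm := H.isWordProduct
      have hc := H.wordMultilinear_chain m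
      obtain ⟨y, hy⟩ := H.exists_boundaryZ_eq
        (isWordOp_lieOp (ε := parity (p - 1)) hg.arity hg.multilinear).toIsNatural hx (Φ' := 0)
        (fun _ _ => ⟨fun _ _ => by simp, fun _ _ => by simp⟩)
        (hc.lieOp hg.multilinear (parity (p - 1))) 1 (-sgn (parity (p - 1)))
        (Φ := lieOp (wordBracket g (parity (p - 1)) H.wordMul 1) (parity p) (H.chain m)) (by
          have e := lieOp_wordBracket hg.hasParity hm.hasParity hg.multilinear hm.multilinear hc
          rw [show parity p = parity (p - 1) + 1 by
            rw [parity_sub_one, add_assoc, CharTwo.add_self_eq_zero, add_zero], e, _root_.mul_one]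
          module)
      refine ⟨y, hy.trans ?_⟩
      rw [lift_zero, LinearMap.zero_apply, zero_add])

theorem homologyLie_apply (h : n - p + 1 = m) (f : H.wordCocycles p) (x : H.cyclesZ n) :
    H.homologyLie h (H.cohomologyClassZ p f) (H.homologyClassZ n x) =
      sgn (parity p) • H.homologyClassZ m ⟨H.op (fun Φ => lieOp f.1 (parity p) Φ) n m x.1,
        (H.isChainOp_lieOp f.2).op_mem (by omega) x.2⟩ :=
  congrArg (sgn (parity p) • ·) (H.homologyAction_apply _ _ _ _ _ f x)

end Lie

section Connes

variable {n m : ℤ}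

theorem isChainOp_dOp : H.IsChainOp (fun Φ => dOp H.one Φ) (-1) where
  toIsWordOp := isWordOp_dOp H.one
  bnd := ⟨1, fun {E _ _ Φ} hΦ => by
    rw [bnd, bnd, H.isWordProduct.lieOp_dOp hΦ, sgn_one, neg_one_smul, neg_neg]⟩

/-- Connes' operator on homology, given by the first of its two terms. -/
noncomputable def homologyB (h : n + 1 = m) : IntExt H.Homology n →ₗ[k] IntExt H.Homology m :=
  H.homologyOp H.isChainOp_dOp (by omega)

theorem homologyB_apply (h : n + 1 = m) (x : H.cyclesZ n) :
    H.homologyB h (H.homologyClassZ n x) = H.homologyClassZ m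
      ⟨H.op (fun Φ => dOp H.one Φ) n m x.1, H.isChainOp_dOp.op_mem (by omega) x.2⟩ :=
  H.homologyOp_apply _ _ x

end Connes

end RegularUnitalHomAssocAlgebra

/-! ### The laws of a noncommutative differential calculus -/

namespace RegularUnitalHomAssocAlgebra

variable {k : Type u} {A : Type v} [CommRing k] [AddCommGroup A] [Module k A]
  (H : RegularUnitalHomAssocAlgebra k A)

section Gerstenhaber

variable {p q r pq qr pr s : ℤ}

theorem intCast_eq_parity_add_one (p : ℤ) : (p : ZMod 2) = parity p + 1 := by
  simp only [parity]; push_cast; generalize (p : ZMod 2) = x; decide +revert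

/-- A linear relation, up to a coboundary, between cocycles gives a relation between cohomology
classes. -/
theorem cohomologyClassZ_eq_add (hq : q + 1 = p) {f f₁ f₂ : H.wordCocycles p} {x : List A → A}
    (hx : IsCochain H.α q x) (c₁ c₂ : ℤ)
    (e : f.1 = c₁ • f₁.1 + c₂ • f₂.1 + wordBracket x (parity q) H.wordMul 1) :
    H.cohomologyClassZ p f = c₁ • H.cohomologyClassZ p f₁ + c₂ • H.cohomologyClassZ p f₂ := by
  rw [← map_zsmul (H.cohomologyClassZ p) c₁ f₁, ← map_zsmul (H.cohomologyClassZ p) c₂ f₂, ← map_add]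
  exact H.cohomologyClassZ_congr hq hx e

theorem cohomologyCup_comm (h : p + q = r) (h' : q + p = r) (f : IntExt H.Cohomology p)
    (g : IntExt H.Cohomology q) :
    H.cohomologyCup h f g = (p * q).negOnePow • H.cohomologyCup h' g f := by
  obtain ⟨f, rfl⟩ := H.cohomologyClassZ_surjective p f
  obtain ⟨g, rfl⟩ := H.cohomologyClassZ_surjective q g
  rw [cohomologyCup_apply, cohomologyCup_apply, negOnePow_smul]
  subst h
  rw [H.cohomologyClassZ_eq_add (sub_add_cancel (p + q) 1)
    ((f.2.1.ins g.2.1 (parity q)).zsmul (sgn (parity q))) (sgn ((p * q : ℤ) : ZMod 2)) 0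
    (f₁ := ⟨_, H.wordCup_mem h' g.2 f.2⟩) (f₂ := 0) ?_, zero_zsmul, add_zero]
  have := H.isWordProduct.wordCup_comm f.2.1.hasParity g.2.1.hasParity f.2.1.multilinear
    f.2.2 g.2.2
  rw [parity_add_sub_one]
  dsimp only
  rw [zero_smul, add_zero, this, Int.cast_mul, intCast_eq_parity_add_one, intCast_eq_parity_add_one]

theorem cohomologyCup_assoc (h₁ : p + q = pq) (h₂ : pq + r = s) (h₃ : q + r = qr)
    (h₄ : p + qr = s) (f : IntExt H.Cohomology p) (g : IntExt H.Cohomology q)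
    (h : IntExt H.Cohomology r) :
    H.cohomologyCup h₂ (H.cohomologyCup h₁ f g) h =
      H.cohomologyCup h₄ f (H.cohomologyCup h₃ g h) := by
  obtain ⟨f, rfl⟩ := H.cohomologyClassZ_surjective p f
  obtain ⟨g, rfl⟩ := H.cohomologyClassZ_surjective q g
  obtain ⟨h, rfl⟩ := H.cohomologyClassZ_surjective r h
  simp only [cohomologyCup_apply]
  congr 2
  exact H.isWordProduct.wordCup_assoc

theorem cohomologyBracket_skew (h : p + q - 1 = r) (h' : q + p - 1 = r)
    (f : IntExt H.Cohomology p) (g : IntExt H.Cohomology q) :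
    H.cohomologyBracket h f g =
      -(((p - 1) * (q - 1)).negOnePow • H.cohomologyBracket h' g f) := by
  obtain ⟨f, rfl⟩ := H.cohomologyClassZ_surjective p f
  obtain ⟨g, rfl⟩ := H.cohomologyClassZ_surjective q g
  rw [cohomologyBracket_apply, cohomologyBracket_apply, negOnePow_smul]
  rw [H.cohomologyClassZ_eq_add (sub_add_cancel r 1) .zero
    (-sgn (((p - 1) * (q - 1) : ℤ) : ZMod 2)) 0 (f₁ := ⟨_, H.wordBracket_mem h' g.2 f.2⟩)
    (f₂ := 0) ?_, zero_zsmul, add_zero, neg_zsmul (H.cohomologyClassZ r _)]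
  rw [zero_smul, add_zero, zero_wordBracket, add_zero, Int.cast_mul, neg_smul]
  exact wordBracket_skew

theorem cohomologyBracket_jacobi (h₁ : q + r - 1 = qr) (h₂ : p + qr - 1 = s)
    (h₃ : p + q - 1 = pq) (h₄ : pq + r - 1 = s) (h₅ : p + r - 1 = pr) (h₆ : q + pr - 1 = s)
    (f : IntExt H.Cohomology p) (g : IntExt H.Cohomology q) (h : IntExt H.Cohomology r) :
    H.cohomologyBracket h₂ f (H.cohomologyBracket h₁ g h) =
      H.cohomologyBracket h₄ (H.cohomologyBracket h₃ f g) h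
        + ((p - 1) * (q - 1)).negOnePow •
          H.cohomologyBracket h₆ g (H.cohomologyBracket h₅ f h) := by
  obtain ⟨f, rfl⟩ := H.cohomologyClassZ_surjective p f
  obtain ⟨g, rfl⟩ := H.cohomologyClassZ_surjective q g
  obtain ⟨h, rfl⟩ := H.cohomologyClassZ_surjective r h
  simp only [cohomologyBracket_apply]
  have := wordBracket_jacobi f.2.1.hasParity g.2.1.hasParity h.2.1.hasParity f.2.1.multilinear
    g.2.1.multilinear h.2.1.multilinear
  subst h₁ h₃ h₅
  rw [negOnePow_smul, H.cohomologyClassZ_eq_add (sub_add_cancel s 1) .zero 1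
    (sgn (((p - 1) * (q - 1) : ℤ) : ZMod 2))
    (f₁ := ⟨_, H.wordBracket_mem h₄ (H.wordBracket_mem rfl f.2 g.2) h.2⟩)
    (f₂ := ⟨_, H.wordBracket_mem h₆ g.2 (H.wordBracket_mem rfl f.2 h.2)⟩) ?_, one_zsmul]
  rw [one_smul, zero_wordBracket, add_zero, Int.cast_mul]
  simp only [parity_add_sub_one]
  exact this

theorem cohomologyBracket_cup (h₁ : q + r = qr) (h₂ : p + qr - 1 = s)
    (h₃ : p + q - 1 = pq) (h₄ : pq + r = s) (h₅ : p + r - 1 = pr) (h₆ : q + pr = s)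
    (f : IntExt H.Cohomology p) (g : IntExt H.Cohomology q) (h : IntExt H.Cohomology r) :
    H.cohomologyBracket h₂ f (H.cohomologyCup h₁ g h) =
      H.cohomologyCup h₄ (H.cohomologyBracket h₃ f g) h
        + ((p - 1) * q).negOnePow • H.cohomologyCup h₆ g (H.cohomologyBracket h₅ f h) := by
  obtain ⟨f, rfl⟩ := H.cohomologyClassZ_surjective p f
  obtain ⟨g, rfl⟩ := H.cohomologyClassZ_surjective q g
  obtain ⟨h, rfl⟩ := H.cohomologyClassZ_surjective r h
  simp only [cohomologyBracket_apply, cohomologyCup_apply]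
  have := H.isWordProduct.wordBracket_wordCup f.2.1.hasParity g.2.1.hasParity h.2.1.hasParity
    f.2.1.multilinear h.2.1.multilinear f.2.2 g.2.2 h.2.2
  subst h₁ h₃ h₅
  have hx := (f.2.1.ins2 h.2.1 g.2.1 (parity r) (parity q)).zsmul
    (sgn (parity q * parity r + parity r + 1))
  rw [negOnePow_smul, H.cohomologyClassZ_eq_add (q := p + r + q - 2) (by omega) hx 1
    (sgn (((p - 1) * q : ℤ) : ZMod 2))
    (f₁ := ⟨_, H.wordCup_mem h₄ (H.wordBracket_mem rfl f.2 g.2) h.2⟩)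
    (f₂ := ⟨_, H.wordCup_mem h₆ g.2 (H.wordBracket_mem rfl f.2 h.2)⟩) ?_, one_zsmul]
  have e : parity (p + r + q - 2) = parity p + parity q + parity r := by
    simp only [parity]; push_cast
    generalize (p : ZMod 2) = x, (q : ZMod 2) = y, (r : ZMod 2) = z
    decide +revert
  dsimp only
  rw [one_smul, Int.cast_mul, e, parity_add, intCast_eq_parity_add_one q]
  exact this

end Gerstenhaber

section Precalculus

variable {p q pq n m m' l : ℤ}

/-- A linear relation, up to homotopy, between functions of words gives a relation between homology
classes. -/
theorem homologyClassZ_eq_add {T : ∀ {E : Type (max u v)} [AddCommGroup E] [Module k E],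
    (List A → E) → List A → E} (hT : IsNatural k T) {x : IntExt H.Chains n}
    (hx : x ∈ H.cyclesZ n) {Φ Φ₁ Φ₂ Θ : List A → IntExt H.Chains l} (h₁ : WordMultilinear k Φ₁)
    (h₂ : WordMultilinear k Φ₂) (hΘ : WordMultilinear k Θ) (c₁ c₂ c c' : ℤ)
    (h : Φ = c₁ • Φ₁ + c₂ • Φ₂ + c • H.bnd Θ + c' • T (H.bnd (H.chain l)))
    {a a₁ a₂ : H.cyclesZ l} (ha : a.1 = H.lift n Φ x) (ha₁ : a₁.1 = H.lift n Φ₁ x)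
    (ha₂ : a₂.1 = H.lift n Φ₂ x) :
    H.homologyClassZ l a = c₁ • H.homologyClassZ l a₁ + c₂ • H.homologyClassZ l a₂ := by
  obtain ⟨y, hy⟩ := H.exists_boundaryZ_eq hT hx ((h₁.zsmul c₁).add (h₂.zsmul c₂)) hΘ c c' h
  rw [← map_zsmul (H.homologyClassZ l) c₁ a₁, ← map_zsmul (H.homologyClassZ l) c₂ a₂, ← map_add]
  refine H.homologyClassZ_congr ⟨y, ?_⟩
  rw [ha, hy, H.lift_add (h₁.zsmul c₁) (h₂.zsmul c₂), H.lift_zsmul h₁, H.lift_zsmul h₂]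
  change _ = c₁ • a₁.1 + c₂ • a₂.1 + _
  rw [ha₁, ha₂]
  rfl

theorem homologyCap_cup (h₁ : p + q = pq) (h₂ : n - pq = l) (h₃ : n - q = m) (h₄ : m - p = l)
    (f : IntExt H.Cohomology p) (g : IntExt H.Cohomology q) (x : IntExt H.Homology n) :
    H.homologyCap h₂ (H.cohomologyCup h₁ f g) x = H.homologyCap h₄ f (H.homologyCap h₃ g x) := by
  obtain ⟨f, rfl⟩ := H.cohomologyClassZ_surjective p f
  obtain ⟨g, rfl⟩ := H.cohomologyClassZ_surjective q g
  obtain ⟨x, rfl⟩ := H.homologyClassZ_surjective n x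
  simp only [cohomologyCup_apply, homologyCap_apply]
  refine congrArg _ (Subtype.ext ?_)
  have hc := H.wordMultilinear_chain l
  change H.lift n (wordCap H.wordMul (wordCup H.wordMul f.1 g.1) (H.chain l)) x.1 =
    H.lift m (wordCap H.wordMul f.1 (H.chain l)) (H.op (fun Φ => wordCap H.wordMul g.1 Φ) n m x.1)
  rw [H.lift_op (H.isChainOp_wordCap g.2).toIsWordOp (by omega)
    ((H.isChainOp_wordCap f.2).multilinear hc), H.isWordProduct.wordCap_wordCup hc]

theorem homologyLie_bracket (h₁ : p + q - 1 = pq) (h₂ : n - pq + 1 = l)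
    (h₃ : n - q + 1 = m) (h₄ : m - p + 1 = l) (h₅ : n - p + 1 = m') (h₆ : m' - q + 1 = l)
    (f : IntExt H.Cohomology p) (g : IntExt H.Cohomology q) (x : IntExt H.Homology n) :
    H.homologyLie h₂ (H.cohomologyBracket h₁ f g) x = H.homologyLie h₄ f (H.homologyLie h₃ g x)
      - ((p - 1) * (q - 1)).negOnePow • H.homologyLie h₆ g (H.homologyLie h₅ f x) := by
  obtain ⟨f, rfl⟩ := H.cohomologyClassZ_surjective p f
  obtain ⟨g, rfl⟩ := H.cohomologyClassZ_surjective q g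
  obtain ⟨x, rfl⟩ := H.homologyClassZ_surjective n x
  simp only [cohomologyBracket_apply, homologyLie_apply, map_zsmul]
  have hc := H.wordMultilinear_chain l
  have hf := H.isChainOp_lieOp f.2
  have hg := H.isChainOp_lieOp g.2
  subst h₁
  rw [H.homologyClassZ_eq_add H.isWordOp_bnd.toIsNatural x.2 (hg.multilinear (hf.multilinear hc))
    (hf.multilinear (hg.multilinear hc)) hc 1 (-sgn (parity p * parity q)) 0 0 ?_ rfl
    (H.lift_op hg.toIsWordOp (m := m) (by omega) (hf.multilinear hc) x.1)
    (H.lift_op hf.toIsWordOp (m := m') (by omega) (hg.multilinear hc) x.1)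
    (a₁ := ⟨_, hf.op_mem (m := l) (by omega) (hg.op_mem (m := m) (by omega) x.2)⟩)
    (a₂ := ⟨_, hg.op_mem (m := l) (by omega) (hf.op_mem (m := m') (by omega) x.2)⟩)]
  · rw [negOnePow_smul, parity_add_sub_one, Int.cast_mul, intCast_eq_parity_add_one (p - 1),
      intCast_eq_parity_add_one (q - 1), parity_sub_one, parity_sub_one]
    match_scalars <;> (generalize parity p = x, parity q = y; decide +revert)
  · have := lieOp_wordBracket f.2.1.hasParity g.2.1.hasParity f.2.1.multilinear g.2.1.multilinear hc
    dsimp only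
    rw [parity_add_sub_one, this]
    module

/-- The homotopy is `capOp` with `g` in place of the product. -/
theorem homologyCap_bracket (h₁ : p + q - 1 = pq) (h₂ : n - pq = l)
    (h₃ : n - q + 1 = m) (h₄ : m - p = l) (h₅ : n - p = m') (h₆ : m' - q + 1 = l)
    (f : IntExt H.Cohomology p) (g : IntExt H.Cohomology q) (x : IntExt H.Homology n) :
    H.homologyCap h₂ (H.cohomologyBracket h₁ f g) x = H.homologyCap h₄ f (H.homologyLie h₃ g x)
      - (p * (q + 1)).negOnePow • H.homologyLie h₆ g (H.homologyCap h₅ f x) := by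
  obtain ⟨f, rfl⟩ := H.cohomologyClassZ_surjective p f
  obtain ⟨g, rfl⟩ := H.cohomologyClassZ_surjective q g
  obtain ⟨x, rfl⟩ := H.homologyClassZ_surjective n x
  simp only [cohomologyBracket_apply, homologyLie_apply, homologyCap_apply, map_zsmul]
  have hm := H.isWordProduct
  have hc := H.wordMultilinear_chain l
  have hf := H.isChainOp_wordCap f.2
  have hg := H.isChainOp_lieOp g.2
  subst h₁
  rw [H.homologyClassZ_eq_add
    (isNatural_capOp (ε := parity p) g.2.1.multilinear f.2.1.multilinear) x.2
    (hg.multilinear (hf.multilinear hc)) (hf.multilinear (hg.multilinear hc))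
    (hc.capOp g.2.1.multilinear f.2.1.multilinear (parity p))
    (sgn (parity q)) (sgn (parity q * parity p + 1))
    (-sgn (parity q * parity p)) (sgn (parity q * parity p + parity q + parity p)) ?_ rfl
    (H.lift_op hg.toIsWordOp (m := m) (by omega) (hf.multilinear hc) x.1)
    (H.lift_op hf.toIsWordOp (m := m') (by omega) (hg.multilinear hc) x.1)
    (a₁ := ⟨_, hf.op_mem (m := l) (by omega) (hg.op_mem (m := m) (by omega) x.2)⟩)
    (a₂ := ⟨_, hg.op_mem (m := l) (by omega) (hf.op_mem (m := m') (by omega) x.2)⟩)]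
  · rw [negOnePow_smul, Int.cast_mul, intCast_eq_parity_add_one p,
      intCast_eq_parity_add_one (q + 1), ← parity_sub_one (q + 1), add_sub_cancel_right]
    match_scalars <;> (generalize parity p = x, parity q = y; decide +revert)
  · have := hm.capOp_wordBracket f.2.1.hasParity g.2.1.hasParity f.2.1.multilinear
      g.2.1.multilinear hc f.2.2 g.2.2
    rw [hm.capOp_eq hc, hm.capOp_eq hc, hm.capOp_eq (hg.multilinear hc), lieOp_zsmul] at this
    linear_combination (norm := skip) sgn (parity p + parity q) • this
    match_scalars <;> (generalize parity p = x, parity q = y; decide +revert)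

end Precalculus

section Calculus

variable {p n m l r : ℤ}

theorem homologyB_homologyB (h₁ : n + 1 = m) (h₂ : m + 1 = l) (x : IntExt H.Homology n) :
    H.homologyB h₂ (H.homologyB h₁ x) = 0 := by
  obtain ⟨x, rfl⟩ := H.homologyClassZ_surjective n x
  simp only [homologyB_apply]
  have hd := H.isChainOp_dOp
  have hc := H.wordMultilinear_chain l
  obtain ⟨y, hy⟩ := H.exists_boundaryZ_eq (IsNatural.comp (isNatural_nrm_cons_cons H.one)
    hd.toIsNatural) x.2 (Φ' := 0) (fun _ _ => ⟨fun _ _ => by simp, fun _ _ => by simp⟩)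
    ((isNatural_nrm_cons_cons H.one).multilinear (hd.multilinear hc)) 1 1
    (Φ := dOp H.one (dOp H.one (H.chain l)))
    (by rw [one_smul, one_smul, zero_add]; exact H.isWordProduct.dOp_dOp hc)
  refine (H.homologyClassZ_eq_zero_iff _).2 ⟨y, ?_⟩
  rw [lift_zero, LinearMap.zero_apply, zero_add] at hy
  exact (H.lift_op hd.toIsWordOp (m := m) (by omega) (hd.multilinear hc) x.1).trans hy

/-- The homotopy is `rotIns` applied after putting the unit in front. -/
theorem homologyLie_eq (h₁ : n - p + 1 = r) (h₂ : n - p = m) (h₃ : m + 1 = r)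
    (h₄ : n + 1 = l) (h₅ : l - p = r) (f : IntExt H.Cohomology p) (x : IntExt H.Homology n) :
    H.homologyLie h₁ f x = H.homologyB h₃ (H.homologyCap h₂ f x)
      - p.negOnePow • H.homologyCap h₅ f (H.homologyB h₄ x) := by
  obtain ⟨f, rfl⟩ := H.cohomologyClassZ_surjective p f
  obtain ⟨x, rfl⟩ := H.homologyClassZ_surjective n x
  simp only [homologyB_apply, homologyLie_apply, homologyCap_apply]
  have hm := H.isWordProduct
  have hc := H.wordMultilinear_chain r
  have hf := H.isChainOp_wordCap f.2
  have hd := H.isChainOp_dOp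
  rw [H.homologyClassZ_eq_add (isNatural_rotIns_cons (ε := parity p) f.2.1.multilinear H.one) x.2
    (hf.multilinear (hd.multilinear hc)) (hd.multilinear (hf.multilinear hc))
    ((isNatural_rotIns_cons (ε := parity p) f.2.1.multilinear H.one).multilinear hc)
    (sgn (parity p)) 1 (sgn (parity p)) 1 ?_ rfl
    (H.lift_op hf.toIsWordOp (m := m) (by omega) (hd.multilinear hc) x.1)
    (H.lift_op hd.toIsWordOp (m := l) (by omega) (hf.multilinear hc) x.1)
    (a₁ := ⟨_, hd.op_mem (m := r) (by omega) (hf.op_mem (m := m) (by omega) x.2)⟩)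
    (a₂ := ⟨_, hf.op_mem (m := r) (by omega) (hd.op_mem (m := l) (by omega) x.2)⟩)]
  · rw [negOnePow_smul, intCast_eq_parity_add_one]
    match_scalars <;> (generalize parity p = x; decide +revert)
  · have := hm.lieOp_eq f.2.1.hasParity f.2.1.multilinear hc f.2.2
    dsimp only
    rw [this]
    module

end Calculus

end RegularUnitalHomAssocAlgebra

/-! ### Comparison with the twisted operations -/

namespace RegularUnitalHomAssocAlgebra

variable {k : Type u} {A : Type v} [CommRing k] [AddCommGroup A] [Module k A]
  (H : RegularUnitalHomAssocAlgebra k A)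

section Comparison

variable {p n m : ℕ} {f : MultilinearMap k (fun _ : Fin p => A) A}

theorem cap_chainWord (h : m + p = n) (hf : f ∈ H.cochains p) {w : List A}
    (hw : w.length = n + 1) :
    H.cap h f (H.chainWord n w) = wordCap H.wordMul (H.toWord f) (H.chainWord m) w := by
  obtain ⟨a, w, rfl⟩ := List.exists_cons_of_length_eq_add_one hw
  simp only [List.length_cons, Nat.add_right_cancel_iff] at hw
  obtain ⟨v, c, rfl, hv⟩ : ∃ v c, w = v ++ c ∧ v.length = p :=
    ⟨w.take p, w.drop p, by simp, by simp; omega⟩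
  have := H.bullet_chainWord (n := n) (m := m) (p := p + 1) (by omega) 0
    (H.circ_one_mulCochain_mem (by omega) hf) (u := []) (v := a :: v) (z := c) rfl (by simp [hv])
    (by simpa using hw)
  rw [wordCap, splits_eq_single v c rfl]
  · simpa [H.toWord_circ_one_mulCochain, cap] using this
  · intro v' c' hv'
    rw [H.toWord_of_ne f (by omega), H.isWordProduct.multilinear.zero_of_mem (by simp),
      (H.wordMultilinear_chainWord m).zero_of_mem (by simp)]

theorem cap_eq_op (h : m + p = n) (hf : f ∈ H.cochains p) :
    @Eq (IntExt H.Chains n →ₗ[k] IntExt H.Chains m) (H.cap h f)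
      (H.op (fun Φ => wordCap H.wordMul (H.toWord f) Φ) n m) := by
  refine H.hom_ext (n := (n : ℤ)) (E := IntExt H.Chains m) fun a w hw => ?_
  have hX := isWordOp_wordCap.{u, v, max u v} H.isWordProduct.multilinear (H.toWord_hasArity f)
    (H.toWord_wordMultilinear f)
  rw [op, H.lift_chain (hX.multilinear (H.wordMultilinear_chain m)) hw]
  exact H.cap_chainWord h hf (by exact_mod_cast hw)

theorem lie_eq_op (h : m + p = n + 1) (hf : f ∈ H.cochains p) :
    @Eq (IntExt H.Chains n →ₗ[k] IntExt H.Chains m) (H.lie h f)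
      (sgn (parity p) • H.op (fun Φ => lieOp (H.toWord f) (parity p) Φ) n m) := by
  refine H.hom_ext (n := (n : ℤ)) (E := IntExt H.Chains m) fun a w hw => ?_
  have hX := isWordOp_lieOp.{u, v, max u v} (ε := parity p) (H.toWord_hasArity f)
    (H.toWord_wordMultilinear f)
  rw [op, LinearMap.smul_apply, H.lift_chain (hX.multilinear (H.wordMultilinear_chain m)) hw]
  exact H.lie_chainWord h hf (by exact_mod_cast hw)

/-- On cycles, Connes' operator is homologous to the map given by `dOp`, since its second term is
null homotopic. -/
theorem connesB_eq_op (n : ℕ) {x : H.Chains n} (hx : x ∈ H.cycles n) :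
    ∃ y : IntExt H.Chains ((n + 1 : ℕ) + 1), H.connesB n x =
      H.op (fun Φ => dOp H.one Φ) n (n + 1 : ℕ) x +
        H.boundaryZ ((n + 1 : ℕ) + 1) (n + 1 : ℕ) y := by
  have hc := H.wordMultilinear_chain (n + 1 : ℕ)
  have hd := isWordOp_dOp.{u, v, max u v} (k := k) H.one
  have hP := isNatural_nrm_cons_cons.{u, v, max u v} (k := k) H.one
  have hPb := hP.multilinear (H.isWordOp_bnd.multilinear hc)
  have hbP := H.isWordOp_bnd.multilinear (hP.multilinear hc)
  have e : dOp H.one (H.chain (n + 1 : ℕ) + sgn (n : ZMod 2) • lst (H.chain (n + 1 : ℕ))) =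
      dOp H.one (H.chain (n + 1 : ℕ)) +
        sgn (n : ZMod 2) • H.bnd (nrm fun w => H.chain (n + 1 : ℕ) (H.one :: H.one :: w)) +
        (-sgn (n : ZMod 2)) • nrm fun w => H.bnd (H.chain (n + 1 : ℕ)) (H.one :: H.one :: w) := by
    change nrm ((fun w => H.chain (n + 1 : ℕ) (H.one :: w)) +
      sgn (n : ZMod 2) • fun w => lst (H.chain (n + 1 : ℕ)) (H.one :: w)) = _
    rw [nrm_add, nrm_zsmul, show nrm (fun w => lst (H.chain (n + 1 : ℕ)) (H.one :: w)) = _ from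
      H.isWordProduct.dOp_lst hc]
    simp only [dOp]
    module
  -- The function on the right is multilinear by `e`.
  have e' : H.connesB n = H.lift (n : ℤ) (dOp H.one (H.chain (n + 1 : ℕ) +
      sgn (n : ZMod 2) • lst (H.chain (n + 1 : ℕ)))) := by
    refine H.hom_ext (n := (n : ℤ)) (E := IntExt H.Chains (n + 1 : ℕ)) fun a w hw => ?_
    rw [H.lift_chain _ hw]
    · exact H.connesB_chainWord (by exact_mod_cast hw)
    · rw [e]
      exact ((hd.multilinear hc).add (hbP.zsmul _)).add (hPb.zsmul _)
  obtain ⟨y, hy⟩ := H.exists_boundaryZ_eq hP (n := (n : ℤ)) (x := x)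
    ((H.mem_cyclesZ_natCast n x).1 hx) (hd.multilinear hc) (hP.multilinear hc) (sgn (n : ZMod 2))
    (-sgn (n : ZMod 2)) e
  exact ⟨y, by rw [e']; exact hy⟩

end Comparison

end RegularUnitalHomAssocAlgebra

/-- The calculus on the cohomology and the homology of a regular unital hom-associative algebra. -/
noncomputable def RegularUnitalHomAssocAlgebra.calculus {k : Type u} {A : Type v} [CommRing k]
    [AddCommGroup A] [Module k A] (H : RegularUnitalHomAssocAlgebra k A) :
    NCDifferentialCalculus k (IntExt H.Cohomology) (IntExt H.Homology) where
  cup := H.cohomologyCup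
  bracket := H.cohomologyBracket
  cup_comm := H.cohomologyCup_comm
  cup_assoc := H.cohomologyCup_assoc
  bracket_skew := H.cohomologyBracket_skew
  jacobi := H.cohomologyBracket_jacobi
  leibniz := H.cohomologyBracket_cup
  i := H.homologyCap
  L := H.homologyLie
  i_cup := H.homologyCap_cup
  L_bracket := H.homologyLie_bracket
  i_bracket := H.homologyCap_bracket
  B := H.homologyB
  B_B := H.homologyB_homologyB
  cartan := H.homologyLie_eq

theorem mainTheorem1 {k : Type u} {A : Type v} [CommRing k] [CharZero k] [AddCommGroup A]
    [Module k A] (H : RegularUnitalHomAssocAlgebra k A) :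
    (∀ n, H.coboundaries n ≤ H.cocycles n) ∧
    (∀ n, H.boundaries n ≤ H.cycles n) ∧
    ∃ S : NCDifferentialCalculus k (IntExt H.Cohomology) (IntExt H.Homology),
      (∀ (p q r : ℕ) (h : p + q = r) (f : H.cocycles p) (g : H.cocycles q),
        ∃ hc : H.cup h f.1 g.1 ∈ H.cocycles r,
          S.cup (p := p) (q := q) (r := r) (by omega)
              (IntExt.of k H.Cohomology p (H.cohomologyClass p f))
              (IntExt.of k H.Cohomology q (H.cohomologyClass q g)) =
            IntExt.of k H.Cohomology r (H.cohomologyClass r ⟨H.cup h f.1 g.1, hc⟩)) ∧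
      (∀ (p q r : ℕ) (h : r + 1 = p + q) (f : H.cocycles p) (g : H.cocycles q),
        ∃ hc : H.bracket h f.1 g.1 ∈ H.cocycles r,
          S.bracket (p := p) (q := q) (r := r) (by omega)
              (IntExt.of k H.Cohomology p (H.cohomologyClass p f))
              (IntExt.of k H.Cohomology q (H.cohomologyClass q g)) =
            IntExt.of k H.Cohomology r (H.cohomologyClass r ⟨H.bracket h f.1 g.1, hc⟩)) ∧
      (∀ (p n m : ℕ) (h : m + p = n) (f : H.cocycles p) (x : H.cycles n),
        ∃ hc : H.cap h f.1 x.1 ∈ H.cycles m,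
          S.i (p := p) (n := n) (m := m) (by omega)
              (IntExt.of k H.Cohomology p (H.cohomologyClass p f))
              (IntExt.of k H.Homology n (H.homologyClass n x)) =
            IntExt.of k H.Homology m (H.homologyClass m ⟨H.cap h f.1 x.1, hc⟩)) ∧
      (∀ (p n m : ℕ) (h : m + p = n + 1) (f : H.cocycles p) (x : H.cycles n),
        ∃ hc : H.lie h f.1 x.1 ∈ H.cycles m,
          S.L (p := p) (n := n) (m := m) (by omega)
              (IntExt.of k H.Cohomology p (H.cohomologyClass p f))
              (IntExt.of k H.Homology n (H.homologyClass n x)) =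
            IntExt.of k H.Homology m (H.homologyClass m ⟨H.lie h f.1 x.1, hc⟩)) ∧
      (∀ (n : ℕ) (x : H.cycles n),
        ∃ hc : H.connesB n x.1 ∈ H.cycles (n + 1),
          S.B (n := n) (m := (n + 1 : ℕ)) (by omega)
              (IntExt.of k H.Homology n (H.homologyClass n x)) =
            IntExt.of k H.Homology (n + 1)
              (H.homologyClass (n + 1) ⟨H.connesB n x.1, hc⟩)) := by
  have hz : ∀ {n : ℕ} {x : IntExt H.Chains n}, x ∈ H.cyclesZ n → x ∈ H.cycles n :=
    fun {n x} h => (H.mem_cyclesZ_natCast n x).2 h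
  have hz' : ∀ {n : ℕ} (x : H.cycles n), (x.1 : IntExt H.Chains n) ∈ H.cyclesZ n :=
    fun {n} x => (H.mem_cyclesZ_natCast n x.1).1 x.2
  have hw : ∀ {p : ℕ} (f : H.cocycles p), H.toWord f.1 ∈ H.wordCocycles p :=
    fun f => H.toWord_mem_wordCocycles.2 f.2
  refine ⟨H.coboundaries_le_cocycles, H.boundaries_le_cycles, H.calculus, ?_, ?_, ?_, ?_, ?_⟩
  · intro p q r h f g
    have hr : (p + q : ℤ) = r := by exact_mod_cast h
    have e := H.toWord_cup h f.2.1 g.1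
    have hc := H.wordCup_mem hr (hw f) (hw g)
    rw [← e] at hc
    refine ⟨H.toWord_mem_wordCocycles.1 hc, ?_⟩
    rw [← H.cohomologyClassZ_natCast, ← H.cohomologyClassZ_natCast, ← H.cohomologyClassZ_natCast]
    exact (H.cohomologyCup_apply hr ⟨_, hw f⟩ ⟨_, hw g⟩).trans
      (congrArg (H.cohomologyClassZ r) (Subtype.ext e.symm))
  · intro p q r h f g
    have hr : (p + q - 1 : ℤ) = r := by omega
    have e := H.toWord_bracket h f.2.1 g.2.1
    have hc := H.wordBracket_mem hr (hw f) (hw g)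
    rw [← e] at hc
    refine ⟨H.toWord_mem_wordCocycles.1 hc, ?_⟩
    rw [← H.cohomologyClassZ_natCast, ← H.cohomologyClassZ_natCast, ← H.cohomologyClassZ_natCast]
    exact (H.cohomologyBracket_apply hr ⟨_, hw f⟩ ⟨_, hw g⟩).trans
      (congrArg (H.cohomologyClassZ r) (Subtype.ext e.symm))
  · intro p n m h f x
    have hm : (n - p : ℤ) = m := by omega
    have e := LinearMap.congr_fun (H.cap_eq_op h f.2.1) x.1
    have hc := (H.isChainOp_wordCap (hw f)).op_mem (m := m) (by omega) (hz' x)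
    refine ⟨hz (e ▸ hc), ?_⟩
    rw [← H.cohomologyClassZ_natCast, ← H.homologyClassZ_natCast, ← H.homologyClassZ_natCast]
    exact (H.homologyCap_apply hm ⟨_, hw f⟩ ⟨_, hz' x⟩).trans
      (congrArg (H.homologyClassZ m) (Subtype.ext e.symm))
  · intro p n m h f x
    have hm : (n - p + 1 : ℤ) = m := by omega
    have e := LinearMap.congr_fun (H.lie_eq_op h f.2.1) x.1
    have hc := zsmul_mem ((H.isChainOp_lieOp (hw f)).op_mem (m := m) (by omega) (hz' x))
      (sgn (parity p))
    refine ⟨hz (e ▸ hc), ?_⟩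
    rw [← H.cohomologyClassZ_natCast, ← H.homologyClassZ_natCast, ← H.homologyClassZ_natCast]
    refine (H.homologyLie_apply hm ⟨_, hw f⟩ ⟨_, hz' x⟩).trans ?_
    refine (map_zsmul (H.homologyClassZ m) _ _).symm.trans ?_
    exact congrArg (H.homologyClassZ m) (Subtype.ext e.symm)
  · intro n x
    have hm : (n + 1 : ℤ) = (n + 1 : ℕ) := by omega
    obtain ⟨y, e⟩ := H.connesB_eq_op n x.2
    have hc := add_mem (H.isChainOp_dOp.op_mem (m := (n + 1 : ℕ)) (by omega) (hz' x))
      (H.boundaryZ_mem _ y)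
    refine ⟨hz (e ▸ hc), ?_⟩
    rw [← H.homologyClassZ_natCast, ← H.homologyClassZ_natCast]
    exact (H.homologyB_apply hm ⟨_, hz' x⟩).trans (H.homologyClassZ_congr ⟨y, e⟩).symm
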